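/- Let $t$ be a positive multiple of $4$, $n\ge 1$, $\omega\in\mathbb C$ a primitive $t$-th root of unity, and $X=(x_1,\dots,x_n)$ indeterminates. Write $\bar x=1/x$, $\overline X=(\bar x_1,\dots,\bar x_n)$, $X^{k}=(x_1^{k},\dots,x_n^{k})$, and let $$X_\omega=(\omega X,\omega^3X,\dots,\omega^{t-1}X,\ \omega,\omega^3,\dots,\omega^{t/2-1}),$$ a tuple of length $tn/2+t/4$. **Characters.** Let $h_m$ be the complete homogeneous symmetric polynomial, with $h_m=0$ for $m<0$. For $Z=(z_1,\dots,z_N)$, $N\geq 1$, and a partition $\lambda$ with at most $N$ nonzero parts, put $$s_\lambda(Z)=\det\big(h_{\lambda_i-i+j}(Z)\big)_{1\le i,j\le N},\qquad \mathrm{sp}_\lambda(Z)=\tfrac12\det\big(h_{\lambda_i-i+j}(Z,\overline Z)+h_{\lambda_i-i-j+2}(Z,\overline Z)\big)_{1\le i,j\le N},$$ $$\mathrm{o}_\lambda(Z)=\det\big(h_{\lambda_i-i+j}(Z,\overline Z,1)-h_{\lambda_i-i-j}(Z,\overline Z,1)\big)_{1\le i,j\le N}.$$ **Partitions.** Let $\ell(\lambda)$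 be the number of nonzero parts, $|\lambda|$ the sum of the parts and $\lambda'$ the conjugate. The rank of $\lambda$ is the largest $r$ with $\lambda_r\ge r$ ($0$ if $\lambda$ is empty); $\lambda$ is *symplectic* if $\lambda'_i-i=\lambda_i-i+1$ for all $1\le i\le r$. For $\ell(\lambda)+\ell(\mu)\le N$ let $(\lambda,-\mu)_N$ be the partition $\mu_1+(\lambda_1,\lambda_2,\dots,0,\dots,0,\dots,-\mu_2,-\mu_1)$ with $N$ entries. Let $\lambda$ be a partition with $\ell(\lambda)\le tn/2+t/4$. Put $m=tn+t/2$, $\beta_i=\lambda_i+m-i$ for $1\le i\le m$, and for $0\le i\le t/2-1$ let $n_i$ be the number of $\beta_j$ congruent to $i$ modulo $t/2$. The partition with beta-set $b_1>\dots>b_k$ is $(b_j-k+j)_{1\le j\le k}$. The $(t/2)$-core of $\lambda$ is the partition with beta-set $\{\tfrac t2 j+i:\ 0\le i\le t/2-1,\ 0\le j\le n_i-1\}$, and the $(t/2)$-quotient is $(\lambda^{(0)},\dots,\lambda^{(t/2-1)})$, where $\lambda^{(i)}$ has beta-set $\{(\beta_j-i)/(t/2):\ \beta_j\equiv i \bmod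 t/2\}$. Let $\sigma_\lambda\in S_m$ be the permutation such that $\beta_{\sigma_\lambda(1)},\dots,\beta_{\sigma_\lambda(m)}$ lists the $\beta_j$ by increasing residue modulo $t/2$, in decreasing order within each residue class. **Theorem.** $\mathrm{sp}_\lambda(X_\omega)\ne0$ if and only if the $(t/2)$-core of $\lambda$ is symplectic. In that case $\ell(\lambda^{(t/2-1)})\le n+1$, $\ell(\lambda^{((t-4)/4)})\le n$, $\ell(\lambda^{(i)})+\ell(\lambda^{(t/2-2-i)})\le 2n+1$ for $0\le i\le (t-8)/4$, and, with $r$ the rank of the $(t/2)$-core, $$\mathrm{sp}_\lambda(X_\omega)=(-1)^{\epsilon}\,\mathrm{sgn}(\sigma_\lambda)\ \mathrm{o}_{\lambda^{(t/2-1)}}(-X^{t/2},-1)\ \mathrm{sp}_{\lambda^{((t-4)/4)}}(-X^{t/2})\prod_{i=0}^{(t-8)/4}s_{(\lambda^{(i)},-\lambda^{(t/2-2-i)})_{2n+1}}(X^{t/2},\overline X^{t/2},1),$$ $$\epsilon=-\sum_{i=t/4}^{(t-4)/2}\binom{n_i+1}{2}+n+1+r+\sum_{i=0}^{(t-8)/4}\big(|\lambda^{(i)}|-|\lambda^{(t/2-2-i)}|\big).$$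 Sums and products whose upper limit is smaller than the lower one are empty. -/

import Mathlib

noncomputable section

/-! ### Partitions, beta-sets, cores and quotients

A partition is a `YoungDiagram`; its parts are `lam.rowLen 0 ≥ lam.rowLen 1 ≥ ⋯`, its length is
`lam.colLen 0`, its size is `lam.card`, and the parts of its conjugate are `lam.colLen j`.
All indices are 0-based. -/

/-- The partition with parts `f 0 ≥ f 1 ≥ ⋯ ≥ f (m - 1)` (zero parts allowed). -/
def partitionOfFn {m : ℕ} (f : Fin m → ℕ) (hf : Antitone f) : YoungDiagram :=
  YoungDiagram.ofRowLens (List.ofFn f) (List.sortedGE_ofFn_iff.mpr hf)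

theorem gaps_monotone {m : ℕ} (e : Fin m ↪o ℕ) : Monotone (fun i : Fin m => e i - (i : ℕ)) := by
  rcases m with _ | m
  · intro i
    exact i.elim0
  · rw [Fin.monotone_iff_le_succ]
    intro i
    have h := e.strictMono (Fin.castSucc_lt_succ (i := i))
    simp only [Fin.val_castSucc, Fin.val_succ]
    omega

/-- The partition whose beta-set is the finite set `B = {b₀ > b₁ > ⋯ > b_{m-1}}`:
its parts are `bᵢ - (m - 1 - i)`. -/
def partitionOfBeta (B : Finset ℕ) : YoungDiagram :=
  partitionOfFn (fun i : Fin B.card => B.orderEmbOfFin rfl i.rev - (i.rev : ℕ))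
    (fun _ _ hij => gaps_monotone _ (Fin.rev_le_rev.mpr hij))

/-- The beta-numbers `λᵢ + m - i` (`1 ≤ i ≤ m`) of `lam`, in 0-based indexing. -/
def beta (lam : YoungDiagram) (m : ℕ) (i : Fin m) : ℕ :=
  lam.rowLen i + (m - 1 - i)

/-- The number `nᵢ(λ, m)` of entries of the beta-set congruent to `i` modulo `p`. -/
def betaCount (p : ℕ) (lam : YoungDiagram) (m i : ℕ) : ℕ :=
  (Finset.univ.filter (fun j : Fin m => beta lam m j % p = i)).card

/-- The `p`-core of `lam`, computed from the beta-set with `m` entries (`m` a multiple of `p`):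
the partition whose beta-set consists of the numbers `p * j + i`, `0 ≤ i < p`, `0 ≤ j < nᵢ`. -/
def core (p : ℕ) (lam : YoungDiagram) (m : ℕ) : YoungDiagram :=
  partitionOfBeta ((Finset.range p).biUnion fun i =>
    (Finset.range (betaCount p lam m i)).image fun j => p * j + i)

/-- The `i`-th entry of the `p`-quotient of `lam`, computed from the beta-set with `m` entries:
the partition whose beta-set is `{(b - i) / p}`, `b` running over the entries congruent to `i`. -/
def quotientPart (p : ℕ) (lam : YoungDiagram) (m i : ℕ) : YoungDiagram :=
  partitionOfBeta
    ((Finset.univ.filter (fun j : Fin m => beta lam m j % p = i)).image fun j => beta lam m j / p)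

/-- The permutation `σ_λ` of the `m` positions that lists the beta-numbers by increasing residue
modulo `p` and, within one residue class, in decreasing order. -/
def sigmaPerm (p : ℕ) (lam : YoungDiagram) (m : ℕ) : Equiv.Perm (Fin m) :=
  Tuple.sort fun j : Fin m =>
    (toLex (beta lam m j % p, OrderDual.toDual (beta lam m j)) : ℕ ×ₗ ℕᵒᵈ)

/-- The Frobenius rank: the number of boxes on the main diagonal. -/
def frobeniusRank (lam : YoungDiagram) : ℕ :=
  (lam.cells.filter fun c => c.1 = c.2).card

/-- The Frobenius coordinate `αᵢ = λᵢ - i` (meaningful for `i` below the rank). -/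
def frobeniusArm (lam : YoungDiagram) (i : ℕ) : ℕ := lam.rowLen i - (i + 1)

/-- The Frobenius coordinate `βᵢ = λ'ᵢ - i` (meaningful for `i` below the rank). -/
def frobeniusLeg (lam : YoungDiagram) (i : ℕ) : ℕ := lam.colLen i - (i + 1)

/-- `λ = (α | α + 1)` in Frobenius coordinates. -/
def IsSymplectic (lam : YoungDiagram) : Prop :=
  ∀ i < frobeniusRank lam, frobeniusLeg lam i = frobeniusArm lam i + 1

/-- The partition `(λ, -μ)_N = μ₁ + (λ₁, λ₂, …, 0, …, 0, …, -μ₂, -μ₁)` with `N` entries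
(meaningful when `ℓ(λ) + ℓ(μ) ≤ N`). -/
def pairPartition (lam mu : YoungDiagram) (N : ℕ) : YoungDiagram :=
  partitionOfFn
    (fun i : Fin N => lam.rowLen i + (mu.rowLen 0 - mu.rowLen (i.rev : ℕ)))
    (fun i j hij => by
      have h : (j.rev : ℕ) ≤ (i.rev : ℕ) := Fin.rev_le_rev.mpr hij
      have h1 := lam.rowLen_anti i j hij
      have h2 := mu.rowLen_anti _ _ h
      simp only
      omega)

/-! ### Characters

Variables are a family `x : ι → F` over a finite index type; every polynomial below is symmetric,
so no order on the variables is needed, and the number of variables is `Fintype.card ι`. -/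

section Characters

variable {F : Type*} [Field F] {ι : Type*} [Fintype ι] [DecidableEq ι]

/-- The complete homogeneous symmetric polynomial `h_m(x)`, zero for negative `m`. -/
def completeH (x : ι → F) (m : ℤ) : F :=
  if 0 ≤ m then MvPolynomial.aeval x (MvPolynomial.hsymm ι ℤ m.toNat) else 0

/-- The variables `(X, X̄)`. -/
def withInv (x : ι → F) : ι ⊕ ι → F := Sum.elim x fun i => (x i)⁻¹

/-- The variables `(X, y)`. -/
def adjoin (x : ι → F) (y : F) : ι ⊕ Unit → F := Sum.elim x fun _ => y

/-- The Schur polynomial `s_λ(x) = det (h_{λᵢ-i+j}(x))`. -/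
def schurPoly (lam : YoungDiagram) (x : ι → F) : F :=
  Matrix.det (Matrix.of fun i j : Fin (Fintype.card ι) =>
    completeH x ((lam.rowLen i : ℤ) - (i : ℕ) + (j : ℕ)))

/-- The symplectic character
`sp_λ(X) = ½ det (h_{λᵢ-i+j}(X, X̄) + h_{λᵢ-i-j+2}(X, X̄))_{1 ≤ i, j ≤ n}`. -/
def spChar (lam : YoungDiagram) (x : ι → F) : F :=
  1 / 2 * Matrix.det (Matrix.of fun i j : Fin (Fintype.card ι) =>
    completeH (withInv x) ((lam.rowLen i : ℤ) - (i : ℕ) + (j : ℕ)) +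
      completeH (withInv x) ((lam.rowLen i : ℤ) - (i : ℕ) - (j : ℕ)))

/-- The odd orthogonal character
`oo_λ(X) = det (h_{λᵢ-i+j}(X, X̄, 1) - h_{λᵢ-i-j}(X, X̄, 1))_{1 ≤ i, j ≤ n}`. -/
def ooChar (lam : YoungDiagram) (x : ι → F) : F :=
  Matrix.det (Matrix.of fun i j : Fin (Fintype.card ι) =>
    completeH (adjoin (withInv x) 1) ((lam.rowLen i : ℤ) - (i : ℕ) + (j : ℕ)) -
      completeH (adjoin (withInv x) 1) ((lam.rowLen i : ℤ) - (i : ℕ) - (j : ℕ) - 2))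

end Characters

/-- The field `ℂ(x₁, …, xₙ)`. -/
abbrev RatFun (n : ℕ) : Type := FractionRing (MvPolynomial (Fin n) ℂ)

/-- The indeterminates `X = (x₁, …, xₙ)` in `ℂ(x₁, …, xₙ)`. -/
def indet (n : ℕ) (i : Fin n) : RatFun n :=
  algebraMap (MvPolynomial (Fin n) ℂ) (RatFun n) (MvPolynomial.X i)

/-- `X_ω = (ωX, ω³X, …, ω^{t-1}X, ω, ω³, …, ω^{t/2-1})`. -/
def twistedVars (t n : ℕ) (ω : ℂ) : (Fin (t / 2) × Fin n) ⊕ Fin (t / 4) → RatFun n :=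
  Sum.elim
    (fun p => algebraMap ℂ (RatFun n) (ω ^ (2 * (p.1 : ℕ) + 1)) * indet n p.2)
    (fun k => algebraMap ℂ (RatFun n) (ω ^ (2 * (k : ℕ) + 1)))

end

/-!
Write `t = 4 T`, `N = 2 T n + T` for the number of variables, and let `W = (Y, Y⁻¹, 1)` with
`Y = X ^ (2 T)`. The odd powers of `ω` make `∏ (1 - w z)`, over the variables `X_ω` and their
inverses, equal to `∏ (1 + w z ^ (2 T))` over `w ∈ W` (`genDenom_twistedVars`). Hence `h_k` of the
twisted variables is `h_{k / 2 T}(-W)` when `2 T ∣ k` and zero otherwise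
(`ringCompleteH_of_expand`). An entry `h_{a + j} + h_{a - j}` of the Jacobi–Trudi matrix therefore
vanishes unless `j ≡ ± a` modulo `2 T`, where `a = λᵢ - i` is a shifted beta-number: rows and
columns split into blocks, one for each pair of residues exchanged by `u ↦ 2 T - 2 - u`, and one
for each of the two self-paired residues `T - 1` and `2 T - 1` (`jacobiTrudi_entry`).

*Vanishing.* A nonzero term of the Leibniz expansion matches the rows of every block with its
columns, so a nonzero determinant forces all blocks to be square. Squareness is a condition on the
numbers `nᵤ`, and it says that the core is symplectic (`balancedResidues_betaResidue_iff`).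

*The blocks.* The block of `2 T - 1` is twice an odd orthogonal determinant (`det_block_last`), that
of `T - 1` a symplectic one (`det_block_middle`). In the block of a pair `u, 2 T - 2 - u` the rows of
the second residue carry `h` with reflected indices. Since `∏_{w ∈ W} (1 - w z)` is antipalindromic,
the sequence `h_k(W)` extends to all integers by the reflection `k ↦ - (2 n + 1) - k` as a solution
of the same linear recurrence (`extendedH`), and a determinant of its values is invariant under a
common shift of the indices (`det_extendedH_add`). This turns the block into the Schur polynomial
of the pair of quotients (`det_pairBlock`).

*The sign.* Ordering rows and columns by blocks costs the sign of the two orderings, counted by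
inversions (`sign_symm_trans`). The block order and the order by residues that defines `σ_λ` differ
in a way symmetric in the two residues, so modulo 2 the difference depends on the numbers `nᵤ` only
(`pairCount_parity`). Among the terms that arise, `∑ (nᵤ + 1)` over `T ≤ u < 2 T - 1` is congruent
to the rank of the core (`exists_frobeniusRank_add`).

*Nonvanishing.* Specialising all `x_i` to `1` makes `h_k(W)` a polynomial in `k` of degree `2 n`. A
vector in the kernel of one of the block matrices gives a polynomial of degree at most `2 n` with
too many zeros (`det_ne_zero_of_many_zeros`), so no factor vanishes.
-/


/-! ### Generating functions of complete homogeneous symmetric polynomials -/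

section GeneratingFunctions

open PowerSeries

variable {R : Type*} [CommRing R] {ι : Type*} [Fintype ι]

/-- The reciprocal `∏ (1 - xᵢ z)` of the generating function of the `h_k(x)`. -/
noncomputable def genDenom (x : ι → R) : R⟦X⟧ := ∏ i, (1 - C (x i) * X)

theorem genDenom_sumElim {κ : Type*} [Fintype κ] (x : ι → R) (y : κ → R) :
    genDenom (Sum.elim x y) = genDenom x * genDenom y := by
  simp [genDenom]

variable [DecidableEq ι]

/-- `completeH` over an arbitrary commutative ring, so that it can be specialised along ring
homomorphisms. -/
noncomputable def ringCompleteH (x : ι → R) (k : ℤ) : R :=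
  if 0 ≤ k then MvPolynomial.aeval x (MvPolynomial.hsymm ι ℤ k.toNat) else 0

theorem completeH_eq_ringCompleteH {F : Type*} [Field F] (x : ι → F) :
    completeH x = ringCompleteH x := rfl

theorem ringCompleteH_of_neg (x : ι → R) {k : ℤ} (hk : k < 0) : ringCompleteH x k = 0 :=
  if_neg (by omega)

theorem ringCompleteH_natCast (x : ι → R) (k : ℕ) :
    ringCompleteH x k = ∑ s : Sym ι k, (s.1.map x).prod := by
  simp [ringCompleteH, MvPolynomial.hsymm, map_sum, map_multiset_prod, Multiset.map_map]

theorem map_ringCompleteH {S : Type*} [CommRing S] (f : R →+* S) (x : ι → R) (k : ℤ) :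
    f (ringCompleteH x k) = ringCompleteH (fun i => f (x i)) k := by
  rcases lt_or_ge k 0 with hk | hk
  · simp [ringCompleteH_of_neg, hk]
  · lift k to ℕ using hk
    simp [ringCompleteH_natCast, map_sum, map_multiset_prod, Multiset.map_map]

theorem ringCompleteH_zero (x : ι → R) : ringCompleteH x 0 = 1 := by
  simp [ringCompleteH]

theorem ringCompleteH_neg (x : ι → R) (k : ℕ) :
    ringCompleteH (fun i => -x i) k = (-1) ^ k * ringCompleteH x k := by
  rw [ringCompleteH_natCast, ringCompleteH_natCast, Finset.mul_sum]
  refine Finset.sum_congr rfl fun s _ => ?_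
  have h : s.1.map (fun i => -x i) = (s.1.map x).map Neg.neg := by simp
  rw [h, Multiset.prod_map_neg]
  simp

theorem mk_pow_mul (a : R) : PowerSeries.mk (fun k => a ^ k) * (1 - C a * X) = 1 := by
  ext k
  rw [mul_sub, mul_one, ← mul_assoc, map_sub]
  rcases k with _ | k
  · simp
  · simp [coeff_succ_mul_X, coeff_mul_C, coeff_one, pow_succ]

theorem mk_ringCompleteH (x : ι → R) :
    PowerSeries.mk (fun k : ℕ => ringCompleteH x k) =
      ∏ i, PowerSeries.mk (fun k => x i ^ k) := by
  ext k
  rw [coeff_mk, coeff_prod, ringCompleteH_natCast]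
  refine Finset.sum_bij (fun s _ => Multiset.toFinsupp s.1) ?_ ?_ ?_ ?_
  · intro s _
    rw [Finset.mem_finsuppAntidiag]
    refine ⟨?_, by simp⟩
    have h := s.2
    rw [← Multiset.toFinsupp_sum_eq] at h
    exact (Finsupp.sum_fintype _ _ (fun _ => rfl)).symm.trans h
  · intro s _ s' _ h
    exact Subtype.ext (Multiset.toFinsupp.injective h)
  · intro f hf
    rw [Finset.mem_finsuppAntidiag] at hf
    refine ⟨⟨Finsupp.toMultiset f, ?_⟩, Finset.mem_univ _, by simp⟩
    rw [Finsupp.card_toMultiset, Finsupp.sum_fintype _ _ (fun _ => rfl)]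
    exact hf.1
  · intro s _
    rw [Finset.prod_multiset_map_count]
    simp only [coeff_mk, Multiset.toFinsupp_apply]
    refine Finset.prod_subset (Finset.subset_univ _) fun i _ hi => ?_
    rw [Multiset.count_eq_zero_of_notMem (by simpa using hi), pow_zero]

theorem mk_ringCompleteH_mul_genDenom (x : ι → R) :
    PowerSeries.mk (fun k : ℕ => ringCompleteH x k) * genDenom x = 1 := by
  rw [mk_ringCompleteH, genDenom, ← Finset.prod_mul_distrib]
  exact Finset.prod_eq_one fun i _ => mk_pow_mul (x i)

theorem mk_ringCompleteH_unique (x : ι → R) {f : R⟦X⟧} (hf : f * genDenom x = 1) :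
    PowerSeries.mk (fun k : ℕ => ringCompleteH x k) = f := by
  calc _ = PowerSeries.mk (fun k : ℕ => ringCompleteH x k) * (f * genDenom x) := by
        rw [hf, mul_one]
    _ = f * (PowerSeries.mk (fun k : ℕ => ringCompleteH x k) * genDenom x) := by ring
    _ = f := by rw [mk_ringCompleteH_mul_genDenom, mul_one]

/-- Removing one variable `y` from the family `x`. -/
theorem ringCompleteH_sub_mul {κ : Type*} [Fintype κ] [DecidableEq κ] (x : ι → R) (x' : κ → R)
    (y : R) (h : genDenom x = genDenom x' * (1 - C y * X)) (k : ℤ) :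
    ringCompleteH x k - y * ringCompleteH x (k - 1) = ringCompleteH x' k := by
  have h1 : PowerSeries.mk (fun k : ℕ => ringCompleteH x' k) =
      PowerSeries.mk (fun k : ℕ => ringCompleteH x k) * (1 - C y * X) := by
    apply mk_ringCompleteH_unique
    rw [mul_assoc, mul_comm (1 - _), ← h, mk_ringCompleteH_mul_genDenom]
  rcases lt_or_ge k 0 with hk | hk
  · rw [ringCompleteH_of_neg _ hk, ringCompleteH_of_neg _ hk, ringCompleteH_of_neg _ (by omega)]
    ring
  · lift k to ℕ using hk
    have h2 := congrArg (coeff k) h1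
    rw [mul_sub, mul_one, ← mul_assoc, map_sub, coeff_mk, coeff_mk] at h2
    rw [h2]
    rcases k with _ | k
    · simp [ringCompleteH_of_neg]
    · rw [coeff_succ_mul_X, coeff_mul_C, coeff_mk]
      push_cast
      rw [add_sub_cancel_right, mul_comm]

/-- If `∏ (1 - xᵢ z) = ∏ (1 - yⱼ z^p)`, then `h_k(x)` is `h_{k/p}(y)` or zero. -/
theorem ringCompleteH_of_expand {κ : Type*} [Fintype κ] [DecidableEq κ] (p : ℕ) (hp : p ≠ 0)
    (x : ι → R) (y : κ → R) (h : genDenom x = (genDenom y).expand p hp) :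
    (∀ b : ℤ, ringCompleteH x (p * b) = ringCompleteH y b) ∧
      ∀ k : ℤ, ¬ (p : ℤ) ∣ k → ringCompleteH x k = 0 := by
  have h1 := mk_ringCompleteH_unique x
    (f := (PowerSeries.mk (fun k : ℕ => ringCompleteH y k)).expand p hp)
    (by rw [h, ← map_mul, mk_ringCompleteH_mul_genDenom, map_one])
  constructor
  · intro b
    rcases lt_or_ge b 0 with hb | hb
    · rw [ringCompleteH_of_neg _ hb, ringCompleteH_of_neg]
      have : (0 : ℤ) < p := by exact_mod_cast Nat.pos_of_ne_zero hp
      nlinarith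
    · lift b to ℕ using hb
      have h2 := congrArg (coeff (p * b)) h1
      rw [coeff_expand_mul, coeff_mk, coeff_mk] at h2
      exact_mod_cast h2
  · intro k hk
    rcases lt_or_ge k 0 with hk0 | hk0
    · exact ringCompleteH_of_neg _ hk0
    · lift k to ℕ using hk0
      have h2 := congrArg (coeff k) h1
      rw [coeff_mk, coeff_expand_of_not_dvd p hp _ (by exact_mod_cast hk)] at h2
      exact h2

end GeneratingFunctions

section Twisted

open PowerSeries

variable {F : Type*} [Field F]

/-- `∏ (1 - ζ^{2k+1} y z) = 1 + y^{2T} z^{2T}` for a primitive `4T`-th root of unity `ζ`: the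
odd powers of `ζ` are the `2T`-th roots of `-1`. -/
theorem prod_one_sub_odd_pow (T : ℕ) (hT : 0 < T) (ζ : F) (hζ : IsPrimitiveRoot ζ (4 * T)) (y : F) :
    ∏ k : Fin (2 * T), (1 - C (ζ ^ (2 * (k : ℕ) + 1) * y) * X : F⟦X⟧) =
      1 + C (y ^ (2 * T)) * X ^ (2 * T) := by
  have h2 : IsPrimitiveRoot (ζ ^ 2) (2 * T) :=
    hζ.pow (by omega) (by ring)
  have hneg : ζ ^ (2 * T) = -1 := by
    have h3 : IsPrimitiveRoot (ζ ^ (2 * T)) 2 := hζ.pow (by omega) (by ring)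
    exact h3.eq_neg_one_of_two_right
  have h4 : IsPrimitiveRoot (C (ζ ^ 2) : F⟦X⟧) (2 * T) :=
    h2.map_of_injective (C_injective (R := F))
  have h5 := h4.pow_sub_pow_eq_prod_sub_mul (1 : F⟦X⟧) (C (ζ * y) * X) (by omega)
  rw [one_pow, mul_pow, ← map_pow, mul_pow, hneg] at h5
  have h6 : ∏ k : Fin (2 * T), (1 - C (ζ ^ (2 * (k : ℕ) + 1) * y) * X : F⟦X⟧) =
      ∏ μ ∈ Polynomial.nthRootsFinset (2 * T) (1 : F⟦X⟧), (1 - μ * (C (ζ * y) * X)) := by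
    refine Finset.prod_bij (fun k _ => C (ζ ^ 2) ^ (k : ℕ)) ?_ ?_ ?_ ?_
    · intro k _
      rw [Polynomial.mem_nthRootsFinset (by omega), ← pow_mul, mul_comm, pow_mul, h4.pow_eq_one,
        one_pow]
    · intro k _ k' _ h
      exact Fin.ext (h4.pow_inj k.2 k'.2 h)
    · intro μ hμ
      rw [Polynomial.mem_nthRootsFinset (by omega)] at hμ
      have : NeZero (2 * T) := ⟨by omega⟩
      obtain ⟨i, hi, rfl⟩ := h4.eq_pow_of_pow_eq_one hμ
      exact ⟨⟨i, hi⟩, Finset.mem_univ _, rfl⟩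
    · intro k _
      rw [← map_pow, ← mul_assoc, ← map_mul]
      congr 3
      ring
  rw [h6, ← h5]
  simp

theorem prod_one_sub_odd_pow_half (T : ℕ) (hT : 0 < T) (ζ : F)
    (hζ : IsPrimitiveRoot ζ (4 * T)) :
    (∏ k : Fin T, (1 - C (ζ ^ (2 * (k : ℕ) + 1)) * X : F⟦X⟧)) *
      ∏ k : Fin T, (1 - C ((ζ ^ (2 * (k : ℕ) + 1))⁻¹) * X : F⟦X⟧) = 1 + X ^ (2 * T) := by
  have h := prod_one_sub_odd_pow T hT ζ hζ 1
  simp only [mul_one, one_pow, map_one, one_mul] at h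
  rw [← h, Fin.prod_univ_eq_prod_range (fun k => (1 - C (ζ ^ (2 * k + 1)) * X : F⟦X⟧)),
    Fin.prod_univ_eq_prod_range (fun k => (1 - C (ζ ^ (2 * k + 1)) * X : F⟦X⟧)),
    Fin.prod_univ_eq_prod_range (fun k => (1 - C ((ζ ^ (2 * k + 1))⁻¹) * X : F⟦X⟧)), two_mul,
    Finset.prod_range_add]
  congr 1
  rw [← Finset.prod_range_reflect]
  refine Finset.prod_congr rfl fun k hk => ?_
  rw [Finset.mem_range] at hk
  congr 3
  -- the inverse of `ζ ^ (2 k + 1)` is `ζ ^ (4 T - 2 k - 1)`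
  apply inv_eq_of_mul_eq_one_right
  rw [← pow_add, ← hζ.pow_eq_one]
  congr 1
  omega

end Twisted

section TwistedVars

open PowerSeries

/-- The variables `(-Y, -Y⁻¹, -1)`, whose complete symmetric polynomials are those of `X_ω`. -/
noncomputable def negVars {F : Type*} [Field F] {n : ℕ} (Y : Fin n → F) :
    (Fin n ⊕ Fin n) ⊕ Unit → F :=
  adjoin (withInv fun k => -Y k) (-1)

theorem genDenom_negVars {F : Type*} [Field F] {n : ℕ} (Y : Fin n → F) :
    genDenom (negVars Y) =
      (∏ i, (1 + C (Y i) * X)) * (∏ i, (1 + C (Y i)⁻¹ * X)) * (1 + X) := by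
  rw [negVars, adjoin, genDenom_sumElim, withInv, genDenom_sumElim]
  simp [genDenom, inv_neg]

theorem indet_ne_zero (n : ℕ) (i : Fin n) : indet n i ≠ 0 := by
  rw [indet, Ne, IsFractionRing.to_map_eq_zero_iff]
  exact MvPolynomial.X_ne_zero i

theorem genDenom_twistedVars (T n : ℕ) (hT : 0 < T) (ω : ℂ) (hω : IsPrimitiveRoot ω (4 * T))
    (Y : Fin n → RatFun n) (hY : ∀ k, Y k = indet n k ^ (2 * T)) :
    genDenom (withInv (twistedVars (4 * T) n ω)) =
      (genDenom (negVars Y)).expand (2 * T) (by omega) := by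
  have e1 : 4 * T / 2 = 2 * T := by omega
  have e2 : 4 * T / 4 = T := by omega
  set ζ : RatFun n := algebraMap ℂ (RatFun n) ω with hζdef
  have hζ : IsPrimitiveRoot ζ (4 * T) :=
    hω.map_of_injective (algebraMap ℂ (RatFun n)).injective
  have hL : genDenom (withInv (twistedVars (4 * T) n ω)) =
      (∏ i : Fin n, ((1 + C (indet n i ^ (2 * T)) * X ^ (2 * T)) *
        (1 + C ((indet n i)⁻¹ ^ (2 * T)) * X ^ (2 * T)))) * (1 + X ^ (2 * T)) := by
    rw [← prod_one_sub_odd_pow_half T hT ζ hζ, Finset.prod_mul_distrib]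
    simp only [← prod_one_sub_odd_pow T hT ζ hζ]
    have hinv : ∀ i : Fin n,
        ∏ k : Fin (2 * T), (1 - C (ζ ^ (2 * (k : ℕ) + 1) * (indet n i)⁻¹) * X : (RatFun n)⟦X⟧) =
        ∏ k : Fin (2 * T), (1 - C ((ζ ^ (2 * (k : ℕ) + 1) * indet n i)⁻¹) * X) := by
      intro i
      rw [prod_one_sub_odd_pow T hT ζ hζ, ← prod_one_sub_odd_pow T hT ζ⁻¹ hζ.inv]
      refine Finset.prod_congr rfl fun k _ => ?_
      rw [mul_inv, inv_pow]
    simp only [hinv]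
    rw [Finset.prod_comm, Finset.prod_comm (s := (Finset.univ : Finset (Fin n)))
      (t := (Finset.univ : Finset (Fin (2 * T))))
      (f := fun i k => (1 - C ((ζ ^ (2 * (k : ℕ) + 1) * indet n i)⁻¹) * X))]
    have h0 : genDenom (withInv (twistedVars (4 * T) n ω)) =
        ((∏ k : Fin (4 * T / 2), ∏ i : Fin n,
            (1 - C (ζ ^ (2 * (k : ℕ) + 1) * indet n i) * X)) *
          ∏ k : Fin (4 * T / 4), (1 - C (ζ ^ (2 * (k : ℕ) + 1)) * X)) *
        ((∏ k : Fin (4 * T / 2), ∏ i : Fin n,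
            (1 - C ((ζ ^ (2 * (k : ℕ) + 1) * indet n i)⁻¹) * X)) *
          ∏ k : Fin (4 * T / 4), (1 - C ((ζ ^ (2 * (k : ℕ) + 1))⁻¹) * X)) := by
      simp only [genDenom, withInv, twistedVars, Fintype.prod_sum_type, Sum.elim_inl,
        Sum.elim_inr, Fintype.prod_prod_type, map_pow, ← hζdef]
    rw [h0, e1, e2]
    ring
  rw [hL, genDenom_negVars]
  simp only [map_mul, map_prod, map_add, map_one, expand_C, expand_X, hY, Finset.prod_mul_distrib,
    inv_pow]

end TwistedVars

/-! ### The two-sided extension of the complete symmetric polynomials -/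

section Palindrome

variable {R : Type*} [CommRing R]

/-- The polynomial `∏ (1 - w z)` over `w ∈ (Y, Y⁻¹, 1)`, written in terms of `s = y + y⁻¹`. -/
noncomputable def palPoly {n : ℕ} (s : Fin n → R) : Polynomial R :=
  (∏ k, (1 - Polynomial.C (s k) * Polynomial.X + Polynomial.X ^ 2)) * (1 - Polynomial.X)

open Polynomial in
theorem reflect_palPoly {n : ℕ} (s : Fin n → R) :
    (palPoly s).natDegree ≤ 2 * n + 1 ∧ (palPoly s).reflect (2 * n + 1) = -palPoly s := by
  have h2 : ∀ c : R, (1 - C c * X + X ^ 2 : R[X]).natDegree ≤ 2 := fun c => by compute_degree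
  have h2' : ∀ c : R, (1 - C c * X + X ^ 2 : R[X]).reflect 2 = 1 - C c * X + X ^ 2 := by
    intro c
    ext i
    rw [coeff_reflect]
    rcases i with _ | _ | _ | i
    · rw [revAt_le (by omega)]; simp [coeff_one, coeff_X]
    · rw [revAt_le (by omega)]
    · rw [revAt_le (by omega)]; simp [coeff_one, coeff_X]
    · rw [revAt_eq_self_of_lt (by omega)]
  have key : ∀ t : Finset (Fin n),
      (∏ k ∈ t, (1 - C (s k) * X + X ^ 2 : R[X])).natDegree ≤ 2 * t.card ∧
      (∏ k ∈ t, (1 - C (s k) * X + X ^ 2 : R[X])).reflect (2 * t.card) =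
        ∏ k ∈ t, (1 - C (s k) * X + X ^ 2 : R[X]) := by
    intro t
    induction t using Finset.induction_on with
    | empty => simp
    | insert a t ha ih =>
      rw [Finset.prod_insert ha, Finset.card_insert_of_notMem ha,
        show 2 * (t.card + 1) = 2 + 2 * t.card by ring]
      refine ⟨natDegree_mul_le_of_le (h2 _) ih.1, ?_⟩
      rw [reflect_mul _ _ (h2 _) ih.1, ih.2, h2']
  have hu := key Finset.univ
  rw [Finset.card_univ, Fintype.card_fin] at hu
  have h1 : (1 - X : R[X]).natDegree ≤ 1 := by compute_degree
  refine ⟨natDegree_mul_le_of_le hu.1 h1, ?_⟩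
  rw [palPoly, reflect_mul _ _ hu.1 h1, hu.2, ← mul_neg]
  congr 1
  ext i
  rw [coeff_reflect]
  rcases i with _ | _ | i
  · rw [revAt_le (by omega)]; simp [coeff_one, coeff_X]
  · rw [revAt_le (by omega)]; simp [coeff_one, coeff_X]
  · rw [revAt_eq_self_of_lt (by omega)]
    simp [coeff_one, coeff_X]

theorem palPoly_coeff_sub {n : ℕ} (s : Fin n → R) {i : ℕ} (hi : i ≤ 2 * n + 1) :
    (palPoly s).coeff (2 * n + 1 - i) = -(palPoly s).coeff i := by
  have h := congrArg (fun q => Polynomial.coeff q i) (reflect_palPoly s).2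
  simpa [Polynomial.coeff_reflect, Polynomial.revAt_le hi] using h

theorem palPoly_coeff_zero {n : ℕ} (s : Fin n → R) : (palPoly s).coeff 0 = 1 := by
  simp [palPoly, Polynomial.coeff_zero_eq_eval_zero, Polynomial.eval_prod]

variable {ι : Type*} [Fintype ι] [DecidableEq ι]

theorem sum_palPoly_mul {n : ℕ} (s : Fin n → R) (w : ι → R)
    (h : genDenom w = (palPoly s : PowerSeries R)) (k : ℤ) :
    ∑ i ∈ Finset.range (2 * n + 2), (palPoly s).coeff i * ringCompleteH w (k - i) =
      if k = 0 then 1 else 0 := by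
  rcases lt_or_ge k 0 with hk | hk
  · rw [if_neg (by omega)]
    exact Finset.sum_eq_zero fun i _ => by rw [ringCompleteH_of_neg _ (by omega), mul_zero]
  · lift k to ℕ using hk
    have h1 := congrArg (PowerSeries.coeff k) (mk_ringCompleteH_mul_genDenom w)
    rw [mul_comm, h, PowerSeries.coeff_mul, PowerSeries.coeff_one,
      Finset.Nat.sum_antidiagonal_eq_sum_range_succ_mk] at h1
    simp only [Polynomial.coeff_coe, PowerSeries.coeff_mk] at h1
    have h2 : (if (k : ℤ) = 0 then (1 : R) else 0) = if k = 0 then 1 else 0 := by simp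
    rw [h2, ← h1]
    have h3 : ∀ M, k ≤ M → 2 * n + 1 ≤ M → ∑ i ∈ Finset.range (M + 1),
        (palPoly s).coeff i * ringCompleteH w ((k : ℤ) - i) =
        ∑ i ∈ Finset.range (2 * n + 2), (palPoly s).coeff i * ringCompleteH w ((k : ℤ) - i) := by
      intro M _ hM
      symm
      refine Finset.sum_subset (by simpa using hM) fun i _ hi => ?_
      rw [Finset.mem_range, not_lt] at hi
      rw [Polynomial.coeff_eq_zero_of_natDegree_lt (by have := (reflect_palPoly s).1; omega),
        zero_mul]
    rw [← h3 (max k (2 * n + 1)) (le_max_left _ _) (le_max_right _ _)]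
    symm
    refine Finset.sum_subset_zero_on_sdiff (by simp) ?_ ?_
    · intro i hi
      simp only [Finset.mem_sdiff, Finset.mem_range, not_lt] at hi
      rw [ringCompleteH_of_neg _ (by omega), mul_zero]
    · intro i hi
      rw [Finset.mem_range] at hi
      push_cast [Nat.le_of_lt_succ hi]
      rfl

/-- The extension of `k ↦ h_k(w)` (`2 n + 1` variables closed under inversion, product `1`) to a
solution over all of `ℤ` of the linear recurrence with characteristic polynomial
`∏ (1 - wᵢ z)`. -/
noncomputable def extendedH (n : ℕ) (w : ι → R) (k : ℤ) : R :=
  if -(2 * n + 1 : ℤ) < k then ringCompleteH w k else ringCompleteH w (-(2 * n + 1) - k)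

theorem extendedH_of_neg (n : ℕ) (w : ι → R) {k : ℤ} (hk : k < 0) :
    extendedH n w k = ringCompleteH w (-(2 * n + 1) - k) := by
  rw [extendedH]
  split_ifs with h
  · rw [ringCompleteH_of_neg _ hk, ringCompleteH_of_neg _ (by omega)]
  · rfl

theorem extendedH_of_gt (n : ℕ) (w : ι → R) {k : ℤ} (hk : -(2 * n + 1 : ℤ) < k) :
    extendedH n w k = ringCompleteH w k := if_pos hk

/-- The recurrence `∑ cᵢ h_{k-i} = 0`, which for `h` itself fails at `k = 0` only, holds for the
extended sequence at every integer: at `k = 0` the reflected value `h_0` at `-(2 n + 1)` supplies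
the missing term. -/
theorem sum_palPoly_mul_extendedH {n : ℕ} (s : Fin n → R) (w : ι → R)
    (h : genDenom w = (palPoly s : PowerSeries R)) (k : ℤ) :
    ∑ i ∈ Finset.range (2 * n + 2), (palPoly s).coeff i * extendedH n w (k - i) = 0 := by
  rcases lt_trichotomy k 0 with hk | hk | hk
  · rw [← Finset.sum_range_reflect]
    have h1 := sum_palPoly_mul s w h (-k)
    rw [if_neg (by omega)] at h1
    rw [← neg_eq_zero, ← Finset.sum_neg_distrib, ← h1]
    refine Finset.sum_congr rfl fun i hi => ?_
    rw [Finset.mem_range] at hi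
    rw [show 2 * n + 2 - 1 - i = 2 * n + 1 - i by omega, palPoly_coeff_sub s (by omega),
      extendedH_of_neg n w (by omega), neg_mul, neg_neg]
    congr 2
    omega
  · subst hk
    have h1 := sum_palPoly_mul s w h 0
    rw [if_pos rfl] at h1
    rw [Finset.sum_range_succ] at h1 ⊢
    rw [extendedH_of_neg n w (k := 0 - ((2 * n + 1 : ℕ) : ℤ)) (by omega)]
    rw [ringCompleteH_of_neg w (k := 0 - ((2 * n + 1 : ℕ) : ℤ)) (by omega), mul_zero, add_zero]
      at h1
    have h2 := palPoly_coeff_sub s (i := 0) (by omega)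
    rw [Nat.sub_zero, palPoly_coeff_zero] at h2
    rw [h2, show (-(2 * n + 1) - (0 - ((2 * n + 1 : ℕ) : ℤ)) : ℤ) = 0 by push_cast; ring,
      ringCompleteH_zero, mul_one, ← h1, ← sub_eq_add_neg, sub_eq_zero]
    refine Finset.sum_congr rfl fun i hi => ?_
    rw [Finset.mem_range] at hi
    rw [extendedH_of_gt n w (by omega)]
  · have h1 := sum_palPoly_mul s w h k
    rw [if_neg (by omega)] at h1
    rw [← h1]
    refine Finset.sum_congr rfl fun i hi => ?_
    rw [Finset.mem_range] at hi
    rw [extendedH_of_gt n w (by omega)]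

/-- The companion matrix of the recurrence has determinant `1`, so a determinant of windows of
`extendedH` does not change when all windows are shifted by one. -/
theorem det_extendedH_succ {n : ℕ} (s : Fin n → R) (w : ι → R)
    (h : genDenom w = (palPoly s : PowerSeries R)) (e : Fin (2 * n + 1) → ℤ) :
    Matrix.det (Matrix.of fun x y : Fin (2 * n + 1) => extendedH n w (e x + (y : ℕ) + 1)) =
      Matrix.det (Matrix.of fun x y : Fin (2 * n + 1) => extendedH n w (e x + (y : ℕ))) := by
  let S : Matrix (Fin (2 * n + 1)) (Fin (2 * n + 1)) R := Matrix.of fun x y =>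
    if (y : ℕ) = 2 * n then (palPoly s).coeff x else if (x : ℕ) = y + 1 then 1 else 0
  have hS : S.det = 1 := by
    rw [Matrix.det_succ_row_zero, Finset.sum_eq_single (Fin.last (2 * n))]
    · have h1 : S.submatrix Fin.succ (Fin.last (2 * n)).succAbove = 1 := by
        ext x y
        have := y.2
        simp only [S, Matrix.submatrix_apply, Matrix.of_apply, Fin.succAbove_last,
          Fin.val_castSucc, Fin.val_succ, Matrix.one_apply, Fin.ext_iff]
        rw [if_neg (by omega)]
        simp
      rw [h1]
      simp [S, palPoly_coeff_zero]
    · intro y _ hy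
      have : (y : ℕ) ≠ 2 * n := fun h => hy (Fin.ext h)
      simp [S, this]
    · simp
  have hmul : (Matrix.of fun x y : Fin (2 * n + 1) => extendedH n w (e x + (y : ℕ) + 1)) =
      (Matrix.of fun x y : Fin (2 * n + 1) => extendedH n w (e x + (y : ℕ))) * S := by
    ext x y
    rw [Matrix.mul_apply]
    simp only [Matrix.of_apply, S]
    by_cases hy : (y : ℕ) = 2 * n
    · simp only [hy, if_true]
      have h1 := sum_palPoly_mul_extendedH s w h (e x + (2 * n + 1))
      rw [← Finset.sum_range_reflect, Finset.sum_range_succ] at h1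
      rw [Fin.sum_univ_eq_sum_range
        (fun i => extendedH n w (e x + (i : ℕ)) * (palPoly s).coeff i)]
      rw [show 2 * n + 2 - 1 - (2 * n + 1) = 0 by omega, palPoly_coeff_zero, one_mul,
        add_eq_zero_iff_eq_neg'] at h1
      push_cast at h1 ⊢
      rw [show e x + 2 * n + 1 = e x + (2 * n + 1) - 0 by ring, h1, ← Finset.sum_neg_distrib]
      refine Finset.sum_congr rfl fun i hi => ?_
      rw [Finset.mem_range] at hi
      rw [palPoly_coeff_sub s (by omega), neg_mul, neg_neg, mul_comm]
      congr 2
      omega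
    · have := y.2
      simp only [hy, if_false]
      rw [Finset.sum_eq_single ⟨y + 1, by omega⟩]
      · simp [add_assoc]
      · intro z _ hz
        rw [if_neg (fun h => hz (Fin.ext h)), mul_zero]
      · simp
  rw [hmul, Matrix.det_mul, hS, mul_one]

theorem det_extendedH_add {n : ℕ} (s : Fin n → R) (w : ι → R)
    (h : genDenom w = (palPoly s : PowerSeries R)) (e : Fin (2 * n + 1) → ℤ) (c : ℤ) :
    Matrix.det (Matrix.of fun x y : Fin (2 * n + 1) => extendedH n w (e x + (y : ℕ) + c)) =
      Matrix.det (Matrix.of fun x y : Fin (2 * n + 1) => extendedH n w (e x + (y : ℕ))) := by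
  induction c using Int.induction_on with
  | zero => simp
  | succ i ih =>
    rw [← ih]
    refine Eq.trans ?_ ((det_extendedH_succ s w h (fun x => e x + i)).trans ?_) <;>
      (congr 1; ext x y; simp only [Matrix.of_apply]; congr 1; ring)
  | pred i ih =>
    rw [← ih]
    refine Eq.trans ?_ ((det_extendedH_succ s w h (fun x => e x - i - 1)).symm.trans ?_) <;>
      (congr 1; ext x y; simp only [Matrix.of_apply]; congr 1; ring)

end Palindrome

/-! ### Blocks of the Jacobi–Trudi matrix as characters -/

section Blocks

variable {F : Type*} [Field F]

/-- The variables `(Y, Y⁻¹, 1)`. -/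
noncomputable def palVars {n : ℕ} (Y : Fin n → F) : (Fin n ⊕ Fin n) ⊕ Unit → F :=
  adjoin (withInv Y) 1

theorem negVars_eq {n : ℕ} (Y : Fin n → F) : negVars Y = fun i => -palVars Y i := by
  funext i
  rcases i with (i | i) | i <;> simp [negVars, palVars, adjoin, withInv, inv_neg]

theorem genDenom_palVars {n : ℕ} (Y : Fin n → F) (hY : ∀ k, Y k ≠ 0) :
    genDenom (palVars Y) = (palPoly (fun k => Y k + (Y k)⁻¹) : PowerSeries F) := by
  rw [palVars, adjoin, genDenom_sumElim, withInv, genDenom_sumElim, genDenom, genDenom,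
    ← Finset.prod_mul_distrib, palPoly, genDenom]
  have : ∀ k, (1 - PowerSeries.C (Y k) * PowerSeries.X) *
      (1 - PowerSeries.C (Y k)⁻¹ * PowerSeries.X) =
      1 - PowerSeries.C (Y k + (Y k)⁻¹) * PowerSeries.X + PowerSeries.X ^ 2 := by
    intro k
    have h1 : PowerSeries.C (Y k) * PowerSeries.C (Y k)⁻¹ = 1 := by
      rw [← map_mul, mul_inv_cancel₀ (hY k), map_one]
    rw [map_add]
    linear_combination (PowerSeries.X ^ 2) * h1
  simp only [this]
  rw [← Polynomial.coeToPowerSeries.ringHom_apply, map_mul, map_prod]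
  simp

theorem completeH_negVars {n : ℕ} (Y : Fin n → F) (k : ℤ) :
    completeH (negVars Y) k = (-1) ^ k * completeH (palVars Y) k := by
  rw [negVars_eq, completeH_eq_ringCompleteH]
  rcases lt_or_ge k 0 with hk | hk
  · rw [completeH_eq_ringCompleteH, ringCompleteH_of_neg _ hk, ringCompleteH_of_neg _ hk, mul_zero]
  · lift k to ℕ using hk
    rw [ringCompleteH_neg, completeH_eq_ringCompleteH, zpow_natCast]

theorem schurPoly_eq_det {ι : Type*} [Fintype ι] [DecidableEq ι] (lam : YoungDiagram) (x : ι → F)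
    (N : ℕ) (hN : Fintype.card ι = N) :
    schurPoly lam x = Matrix.det (Matrix.of fun i j : Fin N =>
      completeH x ((lam.rowLen i : ℤ) - (i : ℕ) + (j : ℕ))) := by
  subst hN; rfl

theorem spChar_eq_det {ι : Type*} [Fintype ι] [DecidableEq ι] (lam : YoungDiagram) (x : ι → F)
    (N : ℕ) (hN : Fintype.card ι = N) :
    spChar lam x = 1 / 2 * Matrix.det (Matrix.of fun i j : Fin N =>
      completeH (withInv x) ((lam.rowLen i : ℤ) - (i : ℕ) + (j : ℕ)) +
        completeH (withInv x) ((lam.rowLen i : ℤ) - (i : ℕ) - (j : ℕ))) := by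
  subst hN; rfl

theorem ooChar_eq_det {ι : Type*} [Fintype ι] [DecidableEq ι] (lam : YoungDiagram) (x : ι → F)
    (N : ℕ) (hN : Fintype.card ι = N) :
    ooChar lam x = Matrix.det (Matrix.of fun i j : Fin N =>
      completeH (adjoin (withInv x) 1) ((lam.rowLen i : ℤ) - (i : ℕ) + (j : ℕ)) -
        completeH (adjoin (withInv x) 1) ((lam.rowLen i : ℤ) - (i : ℕ) - (j : ℕ) - 2)) := by
  subst hN; rfl

/-- Any window of `2 n + 1` consecutive columns of the extended sequence gives the same Schur
polynomial. -/
theorem det_extendedH_eq_schurPoly {n : ℕ} (Y : Fin n → F) (hY : ∀ k, Y k ≠ 0)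
    (κ : YoungDiagram) (e : Fin (2 * n + 1) → ℤ) (c : ℤ)
    (he : ∀ x, e x = (κ.rowLen x : ℤ) - (x : ℕ) + c) :
    Matrix.det (Matrix.of fun x y : Fin (2 * n + 1) =>
        extendedH n (palVars Y) (e x + ((y : ℕ) - n))) =
      schurPoly κ (adjoin (withInv Y) 1) := by
  rw [schurPoly_eq_det κ _ (2 * n + 1) (by simp; ring)]
  refine Eq.trans ?_ ((det_extendedH_add _ _ (genDenom_palVars Y hY)
    (fun x => (κ.rowLen x : ℤ) - (x : ℕ)) (c - n)).trans ?_)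
  · congr 1
    ext x y
    simp only [Matrix.of_apply, he]
    congr 1
    ring
  · congr 1
    ext x y
    have := x.2
    simp only [Matrix.of_apply]
    rw [extendedH_of_gt n _ (by omega)]
    rfl

/-- Replacing column `0` by its double. -/
theorem det_double_col_zero {k : ℕ} (A B : Matrix (Fin (k + 1)) (Fin (k + 1)) F)
    (h0 : ∀ x, A x 0 = 2 * B x 0) (h1 : ∀ x (y : Fin k), A x y.succ = B x y.succ) :
    A.det = 2 * B.det := by
  have : A = B.updateCol 0 ((2 : F) • fun x => B x 0) := by
    ext x y
    refine Fin.cases ?_ (fun y => ?_) y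
    · simp [h0]
    · rw [Matrix.updateCol_ne (Fin.succ_ne_zero y), h1]
  rw [this, Matrix.det_updateCol_smul]
  congr 2
  exact Matrix.updateCol_eq_self B 0

/-- The symplectic character in terms of `(Y, Y⁻¹, 1)`, negated: adding to each column the preceding
one passes from the determinant of this lemma to the defining one, whose first column is doubled. -/
theorem spChar_neg_eq_det {n : ℕ} (hn : 0 < n) (h2 : (2 : F) ≠ 0) (Y : Fin n → F)
    (κ : YoungDiagram) :
    spChar κ (fun k => -Y k) = Matrix.det (Matrix.of fun x y : Fin n =>
      completeH (negVars Y) ((κ.rowLen x : ℤ) - (x : ℕ) + (y : ℕ)) +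
        completeH (negVars Y) ((κ.rowLen x : ℤ) - (x : ℕ) - 1 - (y : ℕ))) := by
  obtain ⟨n, rfl⟩ : ∃ k, n = k + 1 := ⟨n - 1, by omega⟩
  have hE : ∀ k, completeH (withInv fun k => -Y k) k =
      completeH (negVars Y) k + completeH (negVars Y) (k - 1) := by
    intro k
    have := ringCompleteH_sub_mul (negVars Y) (withInv fun k => -Y k) (-1)
      (by rw [negVars, adjoin, genDenom_sumElim]; simp [genDenom]) k
    rw [completeH_eq_ringCompleteH, completeH_eq_ringCompleteH, ← this]
    ring
  rw [spChar_eq_det κ _ (n + 1) (by simp)]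
  set D : Matrix (Fin (n + 1)) (Fin (n + 1)) F := Matrix.of fun x y : Fin (n + 1) =>
      completeH (negVars Y) ((κ.rowLen x : ℤ) - (x : ℕ) + (y : ℕ)) +
        completeH (negVars Y) ((κ.rowLen x : ℤ) - (x : ℕ) - 1 - (y : ℕ)) with hD
  set E := Matrix.of fun x y : Fin (n + 1) =>
      completeH (withInv fun k => -Y k) ((κ.rowLen x : ℤ) - (x : ℕ) + (y : ℕ)) +
        completeH (withInv fun k => -Y k) ((κ.rowLen x : ℤ) - (x : ℕ) - (y : ℕ)) with hE'
  set B : Matrix (Fin (n + 1)) (Fin (n + 1)) F := Matrix.of fun x y =>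
    Fin.cases (D x 0) (fun y => E x y.succ) y with hB
  have h3 : E.det = 2 * B.det := by
    apply det_double_col_zero
    · intro x
      simp only [hB, hE', hD, Matrix.of_apply, Fin.cases_zero, hE, Fin.val_zero]
      push_cast
      ring_nf
    · intro x y
      simp [hB]
  have h4 : D.det = B.det := by
    apply Matrix.det_eq_of_forall_col_eq_smul_add_pred (fun _ => -1)
    · intro x
      simp [hB]
    · intro x y
      simp only [hB, hE', hD, Matrix.of_apply, Fin.cases_succ, hE, Fin.val_succ, Fin.val_castSucc]
      push_cast
      ring_nf
  rw [h3, h4]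
  field_simp

/-- The odd orthogonal character of `(-Y, -1)` in terms of the variables `(-Y, -Y⁻¹, -1)` alone; the
factor `2` comes from the first column, both of whose terms agree. -/
theorem det_eq_two_mul_ooChar {n : ℕ} (Y : Fin n → F) (κ : YoungDiagram) :
    Matrix.det (Matrix.of fun x y : Fin (n + 1) =>
      completeH (negVars Y) ((κ.rowLen x : ℤ) - (x : ℕ) + (y : ℕ)) +
        completeH (negVars Y) ((κ.rowLen x : ℤ) - (x : ℕ) - (y : ℕ))) =
      2 * ooChar κ (adjoin (fun k => -Y k) (-1)) := by
  set G := completeH (adjoin (withInv (adjoin (fun k => -Y k) (-1))) 1) with hG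
  have hH : ∀ k, completeH (negVars Y) k = G k - G (k - 2) := by
    intro k
    have h1 := ringCompleteH_sub_mul (adjoin (withInv (adjoin (fun k => -Y k) (-1))) 1)
      (adjoin (negVars Y) 1) (-1) (by
        simp only [negVars, adjoin, withInv, genDenom, Fintype.prod_sum_type, Sum.elim_inl,
          Sum.elim_inr, Finset.univ_unique, Finset.prod_const, Finset.card_singleton, pow_one,
          inv_neg, inv_one]
        ring)
    have h2 := ringCompleteH_sub_mul (adjoin (negVars Y) 1) (negVars Y) 1
      (by rw [adjoin, genDenom_sumElim]; simp [genDenom]) k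
    rw [hG, completeH_eq_ringCompleteH, completeH_eq_ringCompleteH, ← h2, ← h1, ← h1]
    ring_nf
  rw [ooChar_eq_det κ _ (n + 1) (by simp)]
  set A : Matrix (Fin (n + 1)) (Fin (n + 1)) F := Matrix.of fun x y : Fin (n + 1) =>
    G ((κ.rowLen x : ℤ) - (x : ℕ) + (y : ℕ)) - G ((κ.rowLen x : ℤ) - (x : ℕ) - (y : ℕ) - 2)
    with hA
  set M : Matrix (Fin (n + 1)) (Fin (n + 1)) F := Matrix.of fun x y : Fin (n + 1) =>
      completeH (negVars Y) ((κ.rowLen x : ℤ) - (x : ℕ) + (y : ℕ)) +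
        completeH (negVars Y) ((κ.rowLen x : ℤ) - (x : ℕ) - (y : ℕ)) with hM
  -- `G_k - G_{k-2}` is formed by adding, then subtracting, the preceding column
  let J : Matrix (Fin (n + 1)) (Fin (n + 1)) F := Matrix.of fun x y =>
    Fin.cases (A x 0) (fun y => A x y.succ + A x y.castSucc) y
  let B : Matrix (Fin (n + 1)) (Fin (n + 1)) F := Matrix.of fun x y =>
    Fin.cases (A x 0) (fun y => M x y.succ) y
  have h1 : M.det = 2 * B.det := by
    apply det_double_col_zero
    · intro x
      simp only [B, hM, hA, Matrix.of_apply, Fin.cases_zero, hH, Fin.val_zero]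
      push_cast
      ring_nf
    · intro x y
      simp [B]
  have h2 : A.det = J.det := by
    apply Matrix.det_eq_of_forall_col_eq_smul_add_pred (fun _ => -1)
    · intro x
      simp [J]
    · intro x y
      simp [J]
  have h3 : J.det = B.det := by
    apply Matrix.det_eq_of_forall_col_eq_smul_add_pred (fun _ => 1)
    · intro x
      simp [J, B]
    · intro x y
      rcases y with ⟨_ | y, hy⟩
      · have : (⟨0, hy⟩ : Fin n).castSucc = 0 := rfl
        rw [this]
        simp only [J, B, hM, hA, hH, Matrix.of_apply, Fin.cases_succ, Fin.cases_zero, Fin.val_succ,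
          Fin.val_zero, Fin.val_castSucc]
        push_cast
        ring_nf
      · have : (⟨y + 1, hy⟩ : Fin n).castSucc = Fin.succ ⟨y, by omega⟩ := rfl
        rw [this]
        simp only [J, B, hM, hA, hH, Matrix.of_apply, Fin.cases_succ, Fin.val_succ,
          Fin.val_castSucc]
        push_cast
        ring_nf
  rw [h1, h2, h3]

end Blocks

/-! ### Nonvanishing of the generic characters -/

section Nonvanishing

open Polynomial

/-- `(z + 1) ⋯ (z + 2n)`, which is `(2n)! h_z(1, …, 1)` in `2n + 1` variables. -/
noncomputable def risingPoly (n : ℕ) : ℂ[X] := ∏ i ∈ Finset.range (2 * n), (X + C ((i : ℂ) + 1))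

theorem natDegree_risingPoly (n : ℕ) : (risingPoly n).natDegree ≤ 2 * n := by
  refine (natDegree_prod_le _ _).trans ?_
  refine (Finset.sum_le_card_nsmul _ _ 1 fun i _ => ?_).trans (by simp)
  exact (natDegree_X_add_C _).le

theorem eval_risingPoly (n : ℕ) (z : ℂ) :
    (risingPoly n).eval z = ∏ i ∈ Finset.range (2 * n), (z + (i + 1)) := by
  simp [risingPoly, eval_prod]

theorem eval_risingPoly_reflect (n : ℕ) (z : ℂ) :
    (risingPoly n).eval (-(2 * n + 1) - z) = (risingPoly n).eval z := by
  rw [eval_risingPoly, eval_risingPoly, ← Finset.prod_range_reflect]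
  have : ∀ i ∈ Finset.range (2 * n), -(2 * (n : ℂ) + 1) - z + (((2 * n - 1 - i : ℕ) : ℂ) + 1) =
      -1 * (z + (i + 1)) := by
    intro i hi
    rw [Finset.mem_range] at hi
    rw [Nat.sub_sub, Nat.cast_sub (by omega)]
    push_cast
    ring
  rw [Finset.prod_congr rfl this, Finset.prod_mul_distrib]
  simp

theorem eval_risingPoly_eq_zero (n : ℕ) {k : ℤ} (h1 : k < 0) (h2 : -(2 * n + 1 : ℤ) < k) :
    (risingPoly n).eval (k : ℂ) = 0 := by
  rw [eval_risingPoly]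
  refine Finset.prod_eq_zero (i := (-k - 1).toNat) (by rw [Finset.mem_range]; omega) ?_
  have : (((-k - 1).toNat : ℤ) : ℂ) = -k - 1 := by
    rw [Int.toNat_of_nonneg (by omega)]; push_cast; ring
  rw [← Int.cast_natCast, this]
  ring

theorem eval_risingPoly_zero_ne (n : ℕ) : (risingPoly n).eval 0 ≠ 0 := by
  rw [eval_risingPoly]
  refine Finset.prod_ne_zero_iff.mpr fun i _ => ?_
  rw [zero_add]
  exact_mod_cast Nat.succ_ne_zero i

/-- The principal specialisation `h_k(1, …, 1)` in `2n + 1` variables is polynomial in `k`. -/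
theorem ringCompleteH_one {ι : Type*} [Fintype ι] [DecidableEq ι] (n : ℕ)
    (hι : Fintype.card ι = 2 * n + 1) {k : ℤ} (hk : -(2 * n + 1 : ℤ) < k) :
    ((2 * n).factorial : ℂ) * ringCompleteH (fun _ : ι => (1 : ℂ)) k =
      (risingPoly n).eval (k : ℂ) := by
  rcases lt_or_ge k 0 with h | h
  · rw [ringCompleteH_of_neg _ h, mul_zero, eval_risingPoly_eq_zero n h hk]
  · lift k to ℕ using h
    have h1 : ringCompleteH (fun _ : ι => (1 : ℂ)) k = ((2 * n + k).choose (2 * n) : ℕ) := by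
      rw [ringCompleteH_natCast]
      simp only [Multiset.map_const', Multiset.prod_replicate, one_pow, Finset.sum_const,
        nsmul_eq_mul, mul_one, Finset.card_univ, Sym.card_sym_eq_choose, hι]
      congr 1
      rw [← Nat.choose_symm_of_eq_add (a := k) (b := 2 * n) (by omega)]
      congr 1
      omega
    rw [h1, eval_risingPoly]
    have h2 := Nat.ascFactorial_eq_factorial_mul_choose (n := k) (k := 2 * n)
    rw [← Nat.cast_mul, show 2 * n + k = k + 2 * n by ring, ← h2, Nat.ascFactorial_eq_prod_range]
    push_cast
    refine Finset.prod_congr rfl fun i _ => by ring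

/-- A combination of polynomials of degree at most `d`, triangular at suitable points, that
vanishes at more than `d` integers is trivial. -/
theorem eq_zero_of_many_zeros {k d : ℕ} (f : Fin k → ℂ[X]) (hdeg : ∀ y, (f y).natDegree ≤ d)
    (τ : Fin k → ℂ) (h0 : ∀ y y', y' < y → (f y').eval (τ y) = 0) (h1 : ∀ y, (f y).eval (τ y) ≠ 0)
    (v : Fin k → ℂ) (E : Finset ℤ) (hE : d < E.card)
    (hv : ∀ e ∈ E, ∑ y, v y * (f y).eval (e : ℂ) = 0) : v = 0 := by
  have hG : ∑ y, C (v y) * f y = 0 := by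
    apply eq_zero_of_natDegree_lt_card_of_eval_eq_zero' _ (E.map ⟨_, Int.cast_injective (α := ℂ)⟩)
    · intro e he
      simp only [Finset.mem_map, Function.Embedding.coeFn_mk] at he
      obtain ⟨e, he, rfl⟩ := he
      simpa [eval_finsetSum] using hv e he
    · rw [Finset.card_map]
      refine lt_of_le_of_lt (natDegree_sum_le_of_forall_le _ _ fun y _ => ?_) hE
      exact (natDegree_C_mul_le _ _).trans (hdeg y)
  by_contra hne
  have hS : (Finset.univ.filter fun y => v y ≠ 0).Nonempty := by
    obtain ⟨y, hy⟩ := Function.ne_iff.mp hne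
    exact ⟨y, by simpa using hy⟩
  obtain ⟨y, hy, hmax⟩ := Finset.exists_max_image _ id hS
  have h2 := congrArg (eval (τ y)) hG
  rw [eval_finsetSum, Finset.sum_eq_single y, eval_mul, eval_C, eval_zero] at h2
  · exact (mul_ne_zero (by simpa using hy) (h1 y)) h2
  · intro z _ hz
    rcases lt_or_gt_of_ne hz with h | h
    · simp [h0 y z h]
    · by_cases hvz : v z = 0
      · simp [hvz]
      · exact absurd (hmax z (by simpa using hvz)) (by simpa using h)
  · simp

theorem det_ne_zero_of_many_zeros {k d : ℕ} (f : Fin k → ℂ[X])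
    (hdeg : ∀ y, (f y).natDegree ≤ d)
    (τ : Fin k → ℂ) (h0 : ∀ y y', y' < y → (f y').eval (τ y) = 0) (h1 : ∀ y, (f y).eval (τ y) ≠ 0)
    (M : Matrix (Fin k) (Fin k) ℂ) (a : Fin k → ℂ) (c : Fin k → ℂ) (b : Fin k → ℤ)
    (hc : ∀ y, c y ≠ 0) (hM : ∀ x y, a x * M x y = c y * (f y).eval (b x : ℂ))
    (hE : ∀ v : Fin k → ℂ, (∀ x, ∑ y, v y * (f y).eval (b x : ℂ) = 0) →
      ∃ E : Finset ℤ, d < E.card ∧ ∀ e ∈ E, ∑ y, v y * (f y).eval (e : ℂ) = 0) :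
    M.det ≠ 0 := by
  intro hdet
  obtain ⟨v, hv, hMv⟩ := Matrix.exists_mulVec_eq_zero_iff.mpr hdet
  apply hv
  have h2 : (fun y => v y * c y) = 0 := by
    obtain ⟨E, hE1, hE2⟩ := hE (fun y => v y * c y) (by
      intro x
      have h3 := congrFun hMv x
      rw [Matrix.mulVec, dotProduct, Pi.zero_apply] at h3
      have h4 := congrArg (a x * ·) h3
      simp only [mul_zero, Finset.mul_sum] at h4
      rw [← h4]
      refine Finset.sum_congr rfl fun y _ => ?_
      rw [← mul_assoc, hM]
      ring)
    exact eq_zero_of_many_zeros f hdeg τ h0 h1 _ E hE1 hE2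
  funext y
  have := congrFun h2 y
  exact (mul_eq_zero.mp this).resolve_right (hc y)

variable {ι : Type*} [Fintype ι] [DecidableEq ι]

theorem natDegree_comp_X_add_C {f : ℂ[X]} {d : ℕ} (hf : f.natDegree ≤ d) (c : ℂ) :
    (f.comp (X + C c)).natDegree ≤ d := by
  rwa [natDegree_comp, natDegree_X_add_C, mul_one]

theorem det_schur_one_ne_zero (n : ℕ) (hι : Fintype.card ι = 2 * n + 1)
    (b : Fin (2 * n + 1) → ℤ) (hb : Function.Injective b) (hb' : ∀ x, -(2 * n + 1 : ℤ) < b x) :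
    Matrix.det (Matrix.of fun x y : Fin (2 * n + 1) =>
      ringCompleteH (fun _ : ι => (1 : ℂ)) (b x + (y : ℕ))) ≠ 0 := by
  have hev : ∀ (y : ℕ) (e : ℤ), ((risingPoly n).comp (X + C (y : ℂ))).eval (e : ℂ) =
      (risingPoly n).eval ((e + y : ℤ) : ℂ) := by
    intro y e; simp
  apply det_ne_zero_of_many_zeros (d := 2 * n)
    (fun y : Fin (2 * n + 1) => (risingPoly n).comp (X + C ((y : ℕ) : ℂ)))
    (fun y => natDegree_comp_X_add_C (natDegree_risingPoly n) _)
    (fun y => ((-(y : ℕ) : ℤ) : ℂ)) _ _ _ (fun _ => ((2 * n).factorial : ℂ)) (fun _ => 1) b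
  · simp
  · intro x y
    rw [hev, Matrix.of_apply, ringCompleteH_one n hι (by have := hb' x; omega), one_mul]
  · intro v hv
    refine ⟨Finset.univ.map ⟨b, hb⟩, by simp, ?_⟩
    simpa using hv
  · intro y y' h
    have := y.2
    rw [hev]
    exact eval_risingPoly_eq_zero n (by rw [Fin.lt_def] at h; omega) (by omega)
  · intro y
    rw [hev]
    simpa using eval_risingPoly_zero_ne n

theorem ringCompleteH_neg_one (n : ℕ) (hι : Fintype.card ι = 2 * n + 1) {k : ℤ}
    (hk : -(2 * n + 1 : ℤ) < k) :
    ((2 * n).factorial : ℂ) * ringCompleteH (fun _ : ι => (-1 : ℂ)) k =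
      (-1) ^ k * (risingPoly n).eval (k : ℂ) := by
  rw [← ringCompleteH_one n hι hk]
  rcases lt_or_ge k 0 with h | h
  · rw [ringCompleteH_of_neg _ h, ringCompleteH_of_neg _ h]; ring
  · lift k to ℕ using h
    rw [ringCompleteH_neg (fun _ : ι => (1 : ℂ)) k, zpow_natCast]
    ring

theorem det_sp_neg_one_ne_zero (n : ℕ) (hι : Fintype.card ι = 2 * n + 1)
    (b : Fin n → ℤ) (hb : Function.Injective b) (hb' : ∀ x, -(n : ℤ) < b x) :
    Matrix.det (Matrix.of fun x y : Fin n =>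
      ringCompleteH (fun _ : ι => (-1 : ℂ)) (b x + (y : ℕ)) +
        ringCompleteH (fun _ : ι => (-1 : ℂ)) (b x - 1 - (y : ℕ))) ≠ 0 := by
  let f : ℕ → ℂ[X] := fun y => (risingPoly n).comp (X + C (y : ℂ)) -
    (risingPoly n).comp (X + C (-1 - (y : ℂ)))
  have hev : ∀ (y : ℕ) (e : ℤ), (f y).eval (e : ℂ) =
      (risingPoly n).eval ((e + y : ℤ) : ℂ) - (risingPoly n).eval ((e - 1 - y : ℤ) : ℂ) := by
    intro y e
    simp only [f, eval_sub, eval_comp, eval_add, eval_X, eval_C]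
    push_cast
    ring_nf
  have hrefl : ∀ (y : ℕ) (e : ℤ), (f y).eval ((-2 * n - e : ℤ) : ℂ) = -(f y).eval (e : ℂ) := by
    intro y e
    rw [hev, hev, ← eval_risingPoly_reflect n ((e + y : ℤ) : ℂ),
      ← eval_risingPoly_reflect n ((e - 1 - y : ℤ) : ℂ)]
    push_cast
    ring_nf
  apply det_ne_zero_of_many_zeros (d := 2 * n) (fun y : Fin n => f y)
    (fun y => (natDegree_sub_le_of_le (natDegree_comp_X_add_C (natDegree_risingPoly n) _)
      (natDegree_comp_X_add_C (natDegree_risingPoly n) _)).trans (max_self _).le)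
    (fun y => ((-(y : ℕ) : ℤ) : ℂ)) _ _ _ (fun x => (-1) ^ b x * ((2 * n).factorial : ℂ))
    (fun y => (-1) ^ (y : ℕ)) b
  · intro y
    exact pow_ne_zero _ (by norm_num)
  · intro x y
    have := hb' x
    have := y.2
    rw [hev, Matrix.of_apply, mul_assoc, mul_add, ringCompleteH_neg_one n hι (by omega),
      ringCompleteH_neg_one n hι (by omega), zpow_add₀ (by norm_num), zpow_sub₀ (by norm_num),
      zpow_sub₀ (by norm_num), zpow_natCast]
    have h1 : ((-1 : ℂ) ^ b x) * (-1) ^ b x = 1 := by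
      rw [← mul_zpow]; norm_num
    have h2 : ((-1 : ℂ) ^ (y : ℕ))⁻¹ = (-1) ^ (y : ℕ) := by
      rw [← inv_pow]; norm_num
    rw [div_eq_mul_inv, h2, zpow_one]
    linear_combination ((-1) ^ (y : ℕ) * (eval (((b x + (y : ℕ) : ℤ)) : ℂ) (risingPoly n) -
      eval (((b x - 1 - (y : ℕ) : ℤ)) : ℂ) (risingPoly n))) * h1
  · intro v hv
    -- the zeros `b x`, their reflections `-2n - b x`, and the fixed point `-n`
    have hr : Function.Injective fun x => -2 * (n : ℤ) - b x :=
      fun x y h => hb (sub_right_injective h)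
    refine ⟨insert (-(n : ℤ)) (Finset.univ.image b ∪
      Finset.univ.image fun x => -2 * (n : ℤ) - b x), ?_, ?_⟩
    · rw [Finset.card_insert_of_notMem, Finset.card_union_of_disjoint,
        Finset.card_image_of_injective _ hb, Finset.card_image_of_injective _ hr]
      · simp; omega
      · rw [Finset.disjoint_left]
        intro e he he'
        simp only [Finset.mem_image, Finset.mem_univ, true_and] at he he'
        obtain ⟨x, rfl⟩ := he
        obtain ⟨y, hy⟩ := he'
        have := hb' x
        have := hb' y
        omega
      · simp only [Finset.mem_union, Finset.mem_image, Finset.mem_univ, true_and, not_or,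
          not_exists]
        refine ⟨fun x h => ?_, fun x h => ?_⟩ <;> have := hb' x <;> omega
    · intro e he
      simp only [Finset.mem_insert, Finset.mem_union, Finset.mem_image, Finset.mem_univ,
        true_and] at he
      rcases he with rfl | ⟨x, rfl⟩ | ⟨x, rfl⟩
      · refine Finset.sum_eq_zero fun y _ => ?_
        have h := hrefl y (-(n : ℤ))
        rw [show (-2 * (n : ℤ) - -(n : ℤ)) = -(n : ℤ) by ring, eq_neg_iff_add_eq_zero,
          add_self_eq_zero] at h
        rw [h, mul_zero]
      · exact hv x
      · simp only [hrefl, mul_neg, Finset.sum_neg_distrib, hv x, neg_zero]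
  · intro y y' h
    have := y.2
    rw [Fin.lt_def] at h
    rw [hev, eval_risingPoly_eq_zero n (by omega) (by omega),
      eval_risingPoly_eq_zero n (by omega) (by omega), sub_zero]
  · intro y
    have := y.2
    rw [hev, eval_risingPoly_eq_zero n (k := -(y : ℕ) - 1 - (y : ℕ)) (by omega) (by omega), sub_zero]
    simpa using eval_risingPoly_zero_ne n

theorem det_oo_neg_one_ne_zero (n : ℕ) (hι : Fintype.card ι = 2 * n + 1)
    (b : Fin (n + 1) → ℤ) (hb : Function.Injective b) (hb' : ∀ x, -(n : ℤ) ≤ b x) :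
    Matrix.det (Matrix.of fun x y : Fin (n + 1) =>
      ringCompleteH (fun _ : ι => (-1 : ℂ)) (b x + (y : ℕ)) +
        ringCompleteH (fun _ : ι => (-1 : ℂ)) (b x - (y : ℕ))) ≠ 0 := by
  let f : ℕ → ℂ[X] := fun y => (risingPoly n).comp (X + C (y : ℂ)) +
    (risingPoly n).comp (X + C (-(y : ℂ)))
  have hev : ∀ (y : ℕ) (e : ℤ), (f y).eval (e : ℂ) =
      (risingPoly n).eval ((e + y : ℤ) : ℂ) + (risingPoly n).eval ((e - y : ℤ) : ℂ) := by
    intro y e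
    simp only [f, eval_add, eval_comp, eval_X, eval_C]
    push_cast
    ring_nf
  have hrefl : ∀ (y : ℕ) (e : ℤ), (f y).eval ((-(2 * n + 1) - e : ℤ) : ℂ) = (f y).eval (e : ℂ) := by
    intro y e
    rw [hev, hev, ← eval_risingPoly_reflect n ((e + y : ℤ) : ℂ),
      ← eval_risingPoly_reflect n ((e - y : ℤ) : ℂ)]
    push_cast
    ring_nf
  apply det_ne_zero_of_many_zeros (d := 2 * n) (fun y : Fin (n + 1) => f y)
    (fun y => natDegree_add_le_of_degree_le (natDegree_comp_X_add_C (natDegree_risingPoly n) _)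
      (natDegree_comp_X_add_C (natDegree_risingPoly n) _))
    (fun y => ((-(y : ℕ) : ℤ) : ℂ)) _ _ _ (fun x => (-1) ^ b x * ((2 * n).factorial : ℂ))
    (fun y => (-1) ^ (y : ℕ)) b
  · intro y
    exact pow_ne_zero _ (by norm_num)
  · intro x y
    have := hb' x
    have := y.2
    rw [hev, Matrix.of_apply, mul_assoc, mul_add, ringCompleteH_neg_one n hι (by omega),
      ringCompleteH_neg_one n hι (by omega), zpow_add₀ (by norm_num), zpow_sub₀ (by norm_num),
      zpow_natCast]
    have h1 : ((-1 : ℂ) ^ b x) * (-1) ^ b x = 1 := by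
      rw [← mul_zpow]; norm_num
    have h2 : ((-1 : ℂ) ^ (y : ℕ))⁻¹ = (-1) ^ (y : ℕ) := by
      rw [← inv_pow]; norm_num
    rw [div_eq_mul_inv, h2]
    linear_combination ((-1) ^ (y : ℕ) * (eval (((b x + (y : ℕ) : ℤ)) : ℂ) (risingPoly n) +
      eval (((b x - (y : ℕ) : ℤ)) : ℂ) (risingPoly n))) * h1
  · intro v hv
    -- the zeros `b x` and their reflections `-(2n + 1) - b x`
    have hr : Function.Injective fun x => -(2 * (n : ℤ) + 1) - b x :=
      fun x y h => hb (sub_right_injective h)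
    refine ⟨Finset.univ.image b ∪ Finset.univ.image fun x => -(2 * (n : ℤ) + 1) - b x, ?_, ?_⟩
    · rw [Finset.card_union_of_disjoint,
        Finset.card_image_of_injective _ hb, Finset.card_image_of_injective _ hr]
      · simp; omega
      · rw [Finset.disjoint_left]
        intro e he he'
        simp only [Finset.mem_image, Finset.mem_univ, true_and] at he he'
        obtain ⟨x, rfl⟩ := he
        obtain ⟨y, hy⟩ := he'
        have := hb' x
        have := hb' y
        omega
    · intro e he
      simp only [Finset.mem_union, Finset.mem_image, Finset.mem_univ, true_and] at he
      rcases he with ⟨x, rfl⟩ | ⟨x, rfl⟩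
      · exact hv x
      · simp only [hrefl, hv x]
  · intro y y' h
    have := y.2
    rw [Fin.lt_def] at h
    rw [hev, eval_risingPoly_eq_zero n (by omega) (by omega),
      eval_risingPoly_eq_zero n (by omega) (by omega), add_zero]
  · intro y
    have := y.2
    rw [hev]
    rcases Nat.eq_zero_or_pos (y : ℕ) with h | h
    · rw [h]
      simpa using eval_risingPoly_zero_ne n
    · rw [eval_risingPoly_eq_zero n (k := -(y : ℕ) - (y : ℕ)) (by omega) (by omega), add_zero]
      simpa using eval_risingPoly_zero_ne n

end Nonvanishing

section Specialisation

/-- The subring of `ℂ(x₁, …, xₙ)` of fractions that can be evaluated at `x₁ = ⋯ = xₙ = 1`,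
presented abstractly together with its inclusion and its evaluation. -/
theorem exists_specialisation_at_one (n : ℕ) :
    ∃ (A : Type) (_ : CommRing A) (φ : A →+* RatFun n) (ψ : A →+* ℂ) (y y' : Fin n → A),
      Function.Injective φ ∧ (∀ k, φ (y k) = indet n k) ∧ (∀ k, φ (y' k) = (indet n k)⁻¹) ∧
      (∀ k, ψ (y k) = 1) ∧ ∀ k, ψ (y' k) = 1 := by
  let ev : MvPolynomial (Fin n) ℂ →+* ℂ := MvPolynomial.eval fun _ => 1
  let S : Submonoid (MvPolynomial (Fin n) ℂ) := (nonZeroDivisors ℂ).comap ev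
  have hS : ∀ s : S, ev s ≠ 0 := fun s => nonZeroDivisors.ne_zero s.2
  have hS0 : ∀ s : S, (s : MvPolynomial (Fin n) ℂ) ≠ 0 := fun s h => hS s (by rw [h, map_zero])
  have hφ : ∀ s : S, IsUnit (algebraMap (MvPolynomial (Fin n) ℂ) (RatFun n) s) := fun s =>
    IsUnit.mk0 _ (by rw [Ne, IsFractionRing.to_map_eq_zero_iff]; exact hS0 s)
  have hψ : ∀ s : S, IsUnit (ev s) := fun s => IsUnit.mk0 _ (hS s)
  have hX : ∀ k, (MvPolynomial.X k : MvPolynomial (Fin n) ℂ) ∈ S := by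
    intro k
    simp [S, ev]
  let φ : Localization S →+* RatFun n := IsLocalization.lift hφ
  let ψ : Localization S →+* ℂ := IsLocalization.lift hψ
  refine ⟨Localization S, inferInstance, φ, ψ,
    fun k => algebraMap (MvPolynomial (Fin n) ℂ) _ (MvPolynomial.X k),
    fun k => IsLocalization.mk' _ 1 (⟨MvPolynomial.X k, hX k⟩ : S),
    ?_, ?_, ?_, ?_, ?_⟩
  · rw [IsLocalization.lift_injective_iff]
    intro r s
    rw [(IsFractionRing.injective (MvPolynomial (Fin n) ℂ) (RatFun n)).eq_iff,
      (IsLocalization.injective (Localization S) fun s hs => mem_nonZeroDivisors_of_ne_zero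
        (hS0 ⟨s, hs⟩)).eq_iff]
  · intro k
    exact IsLocalization.lift_eq hφ _
  · intro k
    rw [IsLocalization.lift_mk'_spec hφ, map_one]
    exact (mul_inv_cancel₀ (indet_ne_zero n k)).symm
  · intro k
    rw [IsLocalization.lift_eq hψ]
    simp [ev]
  · intro k
    rw [IsLocalization.lift_mk'_spec hψ]
    simp [ev]

/-- A Laurent-polynomial determinant in `ℂ(x₁, …, xₙ)` that does not vanish at `x = 1` is
nonzero. -/
theorem det_ne_zero_of_specialisation {n k : ℕ} {A : Type} [CommRing A] (φ : A →+* RatFun n)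
    (ψ : A →+* ℂ) (hφ : Function.Injective φ) (M : Matrix (Fin k) (Fin k) A)
    (h : (M.map ψ).det ≠ 0) : (M.map φ).det ≠ 0 := by
  have h1 : ψ M.det ≠ 0 := by rwa [RingHom.map_det]
  have h2 : φ M.det ≠ 0 := fun h0 => h1 (by
    rw [(map_eq_zero_iff φ hφ).mp h0, map_zero])
  rwa [RingHom.map_det] at h2

/-- The two evaluations of `(Y, Y⁻¹, 1)`: at the indeterminates, and at `1`. -/
theorem exists_palVars_specialisation (n p : ℕ) :
    ∃ (A : Type) (_ : CommRing A) (φ : A →+* RatFun n) (ψ : A →+* ℂ)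
      (w : (Fin n ⊕ Fin n) ⊕ Unit → A), Function.Injective φ ∧
      (fun i => φ (w i)) = palVars (fun k => indet n k ^ p) ∧ (fun i => ψ (w i)) = fun _ => 1 := by
  obtain ⟨A, _, φ, ψ, y, y', hφ, h1, h2, h3, h4⟩ := exists_specialisation_at_one n
  refine ⟨A, inferInstance, φ, ψ,
    Sum.elim (Sum.elim (fun k => y k ^ p) fun k => y' k ^ p) fun _ => 1, hφ, ?_, ?_⟩
  · funext i
    rcases i with (i | i) | i <;> simp [palVars, adjoin, withInv, h1, h2]
  · funext i
    rcases i with (i | i) | i <;> simp [h3, h4]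

theorem rowLen_sub_strictAnti (κ : YoungDiagram) {a b : ℕ} (h : a < b) :
    (κ.rowLen b : ℤ) - b < (κ.rowLen a : ℤ) - a := by
  have := κ.rowLen_anti a b h.le
  omega

theorem rowLen_sub_injective (κ : YoungDiagram) (k : ℕ) :
    Function.Injective fun x : Fin k => (κ.rowLen x : ℤ) - (x : ℕ) := by
  intro x y h
  rcases lt_trichotomy (x : ℕ) y with h1 | h1 | h1
  · exact absurd h (rowLen_sub_strictAnti κ h1).ne'
  · exact Fin.ext h1
  · exact absurd h (rowLen_sub_strictAnti κ h1).ne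

theorem schurPoly_ne_zero (n p : ℕ) (κ : YoungDiagram) :
    schurPoly κ (adjoin (withInv fun k => indet n k ^ p) 1) ≠ 0 := by
  obtain ⟨A, _, φ, ψ, w, hφ, h1, h2⟩ := exists_palVars_specialisation n p
  rw [schurPoly_eq_det κ _ (2 * n + 1) (by simp; ring)]
  have h := det_ne_zero_of_specialisation φ ψ hφ (Matrix.of fun x y : Fin (2 * n + 1) =>
    ringCompleteH w ((κ.rowLen x : ℤ) - (x : ℕ) + (y : ℕ))) (by
      have := det_schur_one_ne_zero (ι := (Fin n ⊕ Fin n) ⊕ Unit) n (by simp; ring)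
        (fun x : Fin (2 * n + 1) => (κ.rowLen x : ℤ) - (x : ℕ)) (rowLen_sub_injective κ _)
        (fun x => by have := x.2; omega)
      simpa only [Matrix.map, Matrix.of_apply, map_ringCompleteH, h2] using this)
  simp only [Matrix.map, Matrix.of_apply, map_ringCompleteH, h1] at h
  exact h

theorem spChar_neg_ne_zero (n p : ℕ) (hn : 0 < n) (κ : YoungDiagram) :
    spChar κ (fun k => -indet n k ^ p) ≠ 0 := by
  obtain ⟨A, _, φ, ψ, w, hφ, h1, h2⟩ := exists_palVars_specialisation n p
  rw [spChar_neg_eq_det hn two_ne_zero (fun k => indet n k ^ p)]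
  have h1' : (fun i => φ (-w i)) = negVars (fun k => indet n k ^ p) := by
    rw [negVars_eq, ← h1]
    simp
  have h2' : (fun i => ψ (-w i)) = fun _ => -1 := by
    funext i
    rw [map_neg, congrFun h2 i]
  have h := det_ne_zero_of_specialisation φ ψ hφ (Matrix.of fun x y : Fin n =>
    ringCompleteH (fun i => -w i) ((κ.rowLen x : ℤ) - (x : ℕ) + (y : ℕ)) +
      ringCompleteH (fun i => -w i) ((κ.rowLen x : ℤ) - (x : ℕ) - 1 - (y : ℕ))) (by
      have := det_sp_neg_one_ne_zero (ι := (Fin n ⊕ Fin n) ⊕ Unit) n (by simp; ring)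
        (fun x : Fin n => (κ.rowLen x : ℤ) - (x : ℕ)) (rowLen_sub_injective κ _)
        (fun x => by have := x.2; omega)
      simpa only [Matrix.map, Matrix.of_apply, map_add, map_ringCompleteH, h2'] using this)
  simp only [Matrix.map, Matrix.of_apply, map_add, map_ringCompleteH, h1'] at h
  exact h

theorem ooChar_neg_ne_zero (n p : ℕ) (κ : YoungDiagram) :
    ooChar κ (adjoin (fun k => -indet n k ^ p) (-1)) ≠ 0 := by
  obtain ⟨A, _, φ, ψ, w, hφ, h1, h2⟩ := exists_palVars_specialisation n p
  have h1' : (fun i => φ (-w i)) = negVars (fun k => indet n k ^ p) := by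
    rw [negVars_eq, ← h1]
    simp
  have h2' : (fun i => ψ (-w i)) = fun _ => -1 := by
    funext i
    rw [map_neg, congrFun h2 i]
  have h := det_ne_zero_of_specialisation φ ψ hφ (Matrix.of fun x y : Fin (n + 1) =>
    ringCompleteH (fun i => -w i) ((κ.rowLen x : ℤ) - (x : ℕ) + (y : ℕ)) +
      ringCompleteH (fun i => -w i) ((κ.rowLen x : ℤ) - (x : ℕ) - (y : ℕ))) (by
      have := det_oo_neg_one_ne_zero (ι := (Fin n ⊕ Fin n) ⊕ Unit) n (by simp; ring)
        (fun x : Fin (n + 1) => (κ.rowLen x : ℤ) - (x : ℕ)) (rowLen_sub_injective κ _)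
        (fun x => by have := x.2; omega)
      simpa only [Matrix.map, Matrix.of_apply, map_add, map_ringCompleteH, h2'] using this)
  intro h0
  apply h
  have h3 := det_eq_two_mul_ooChar (fun k => indet n k ^ p) κ
  rw [h0, mul_zero] at h3
  rw [← h3]
  simp only [Matrix.map, Matrix.of_apply, map_add, map_ringCompleteH, h1',
    completeH_eq_ringCompleteH]

end Specialisation

/-! ### Partitions and their beta-sets -/

section BetaSets

theorem rowLen_partitionOfFn {m : ℕ} (f : Fin m → ℕ) (hf : Antitone f) (i : ℕ) :
    (partitionOfFn f hf).rowLen i = if h : i < m then f ⟨i, h⟩ else 0 := by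
  have key : ∀ j, j < (partitionOfFn f hf).rowLen i ↔ ∃ h : i < m, j < f ⟨i, h⟩ := by
    intro j
    rw [← YoungDiagram.mem_iff_lt_rowLen, partitionOfFn, YoungDiagram.mem_ofRowLens]
    simp
  split_ifs with h
  · refine le_antisymm ?_ ?_
    · by_contra! hlt
      obtain ⟨_, h2⟩ := (key _).mp hlt
      exact lt_irrefl _ h2
    · by_contra! hlt
      exact lt_irrefl _ ((key _).mpr ⟨h, hlt⟩)
  · by_contra hne
    obtain ⟨h2, _⟩ := (key 0).mp (Nat.pos_of_ne_zero hne)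
    exact h h2

theorem rowLen_partitionOfBeta_of_lt (B : Finset ℕ) {x : ℕ} (hx : x < B.card) :
    (partitionOfBeta B).rowLen x + (B.card - 1 - x) =
      B.orderEmbOfFin rfl (Fin.rev ⟨x, hx⟩) := by
  rw [show (partitionOfBeta B).rowLen x = _ from rowLen_partitionOfFn _ _ x, dif_pos hx]
  have hge : ∀ i : Fin B.card, (i : ℕ) ≤ B.orderEmbOfFin rfl i := by
    rintro ⟨i, hi⟩
    induction i with
    | zero => simp
    | succ i ih =>
      have h1 := ih (by omega)
      have h2 := (B.orderEmbOfFin rfl).strictMono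
        (show (⟨i, by omega⟩ : Fin B.card) < ⟨i + 1, hi⟩ from Nat.lt_succ_self i)
      simp only at h1 h2 ⊢
      omega
  have := hge (Fin.rev ⟨x, hx⟩)
  simp only [Fin.val_rev] at this ⊢
  omega

theorem rowLen_partitionOfBeta_of_ge (B : Finset ℕ) {x : ℕ} (hx : B.card ≤ x) :
    (partitionOfBeta B).rowLen x = 0 := by
  rw [show (partitionOfBeta B).rowLen x = _ from rowLen_partitionOfFn _ _ x, dif_neg (by omega)]

theorem rowLen_partitionOfBeta_mem (B : Finset ℕ) {x : ℕ} (hx : x < B.card) :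
    (partitionOfBeta B).rowLen x + (B.card - 1 - x) ∈ B := by
  rw [rowLen_partitionOfBeta_of_lt B hx]
  exact B.orderEmbOfFin_mem rfl _

theorem exists_rowLen_partitionOfBeta (B : Finset ℕ) {b : ℕ} (hb : b ∈ B) :
    ∃ x < B.card, b = (partitionOfBeta B).rowLen x + (B.card - 1 - x) := by
  have h : b ∈ Set.range (B.orderEmbOfFin rfl) := by
    rw [Finset.range_orderEmbOfFin]; exact hb
  obtain ⟨i, rfl⟩ := h
  refine ⟨i.rev, i.rev.2, ?_⟩
  rw [rowLen_partitionOfBeta_of_lt B i.rev.2, Fin.eta, Fin.rev_rev]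

theorem colLen_zero_le_of_rowLen_eq_zero (μ : YoungDiagram) {k : ℕ} (h : μ.rowLen k = 0) :
    μ.colLen 0 ≤ k := by
  by_contra! hlt
  rw [← YoungDiagram.mem_iff_lt_colLen, YoungDiagram.mem_iff_lt_rowLen] at hlt
  omega

theorem rowLen_eq_zero_of_colLen_zero_le (μ : YoungDiagram) {k : ℕ} (h : μ.colLen 0 ≤ k) :
    μ.rowLen k = 0 := by
  by_contra hne
  have : (k, 0) ∈ μ := YoungDiagram.mem_iff_lt_rowLen.mpr (Nat.pos_of_ne_zero hne)
  rw [YoungDiagram.mem_iff_lt_colLen] at this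
  omega

theorem card_eq_sum_rowLen (μ : YoungDiagram) {k : ℕ} (h : μ.rowLen k = 0) :
    μ.card = ∑ x ∈ Finset.range k, μ.rowLen x := by
  rw [YoungDiagram.card, Finset.card_eq_sum_card_fiberwise (f := Prod.fst) (t := Finset.range k)]
  · refine Finset.sum_congr rfl fun x _ => ?_
    rw [YoungDiagram.rowLen_eq_card]
    rfl
  · intro c hc
    simp only [Finset.coe_range, Set.mem_Iio]
    by_contra! hle
    have hc' : (c.1, c.2) ∈ μ := hc
    rw [YoungDiagram.mem_iff_lt_rowLen] at hc'
    have := μ.rowLen_anti _ _ hle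
    omega

end BetaSets

/-! ### Maya diagrams and the symplectic condition -/

section Maya

/-- Membership in the Maya diagram `{λᵢ - i - 1 : i ≥ 0} ⊆ ℤ` of a partition. -/
def InMaya (μ : YoungDiagram) (z : ℤ) : Prop := ∃ i : ℕ, z = (μ.rowLen i : ℤ) - i - 1

/-- The complement of the Maya diagram is `{j - λ'ⱼ : j ≥ 0}`. -/
theorem not_inMaya_iff (μ : YoungDiagram) (z : ℤ) :
    ¬ InMaya μ z ↔ ∃ j : ℕ, z = (j : ℤ) - μ.colLen j := by
  have hiff : ∀ i j, i < μ.colLen j ↔ j < μ.rowLen i := fun i j => by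
    rw [← YoungDiagram.mem_iff_lt_colLen, YoungDiagram.mem_iff_lt_rowLen]
  constructor
  · intro hz
    have hex : ∃ i : ℕ, (μ.rowLen i : ℤ) - i - 1 ≤ z := by
      refine ⟨μ.rowLen 0 + z.natAbs, ?_⟩
      have := μ.rowLen_anti 0 (μ.rowLen 0 + z.natAbs) (Nat.zero_le _)
      omega
    classical
    set i := Nat.find hex with hi
    have h1 : (μ.rowLen i : ℤ) - i - 1 ≤ z := Nat.find_spec hex
    have h2 : (μ.rowLen i : ℤ) - i - 1 ≠ z := fun h => hz ⟨i, h.symm⟩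
    refine ⟨(z + i).toNat, ?_⟩
    have h3 : ((z + i).toNat : ℤ) = z + i := Int.toNat_of_nonneg (by omega)
    have h4 : ¬ i < μ.colLen (z + i).toNat := by
      rw [hiff]; omega
    have h5 : i ≤ μ.colLen (z + i).toNat := by
      rcases Nat.eq_zero_or_pos i with h0 | h0
      · omega
      · have h6 := Nat.find_min hex (m := i - 1) (by omega)
        have h7 : i - 1 < μ.colLen (z + i).toNat := by
          rw [hiff]; omega
        omega
    omega
  · rintro ⟨j, rfl⟩ ⟨i, hi⟩
    have := hiff i j
    omega

theorem lt_frobeniusRank_iff (μ : YoungDiagram) (i : ℕ) :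
    i < frobeniusRank μ ↔ i < μ.rowLen i := by
  have hcell : ∀ k, (k, k) ∈ μ ↔ k < μ.rowLen k := fun k => YoungDiagram.mem_iff_lt_rowLen
  have hdown : ∀ k l, k ≤ l → l < μ.rowLen l → k < μ.rowLen k := by
    intro k l h1 h2
    have := μ.rowLen_anti k l h1
    omega
  have hex : ∃ k, ¬ k < μ.rowLen k := ⟨μ.rowLen 0, by
    have := μ.rowLen_anti 0 (μ.rowLen 0) (Nat.zero_le _)
    omega⟩
  classical
  have hr : frobeniusRank μ = Nat.find hex := by
    rw [frobeniusRank, ← Finset.card_range (Nat.find hex)]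
    symm
    refine Finset.card_bij (fun k _ => (k, k)) ?_ ?_ ?_
    · intro k hk
      rw [Finset.mem_range] at hk
      rw [Finset.mem_filter, YoungDiagram.mem_cells, hcell]
      exact ⟨not_not.mp (Nat.find_min hex hk), rfl⟩
    · intro a _ b _ h
      exact congrArg Prod.fst h
    · rintro ⟨a, b⟩ hab
      rw [Finset.mem_filter, YoungDiagram.mem_cells] at hab
      obtain ⟨h1, h2⟩ := hab
      simp only at h2
      subst h2
      refine ⟨a, ?_, rfl⟩
      rw [Finset.mem_range]
      by_contra hle
      exact Nat.find_spec hex (hdown _ _ (not_lt.mp hle) ((hcell a).mp h1))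
  rw [hr]
  constructor
  · intro h
    exact not_not.mp (Nat.find_min hex h)
  · intro h
    by_contra hle
    exact Nat.find_spec hex (hdown _ _ (not_lt.mp hle) h)

theorem lt_colLen_iff_of_rank (μ : YoungDiagram) (i : ℕ) :
    i < frobeniusRank μ ↔ i < μ.colLen i := by
  rw [lt_frobeniusRank_iff, ← YoungDiagram.mem_iff_lt_rowLen, YoungDiagram.mem_iff_lt_colLen]

/-- `λ = (α | α + 1)` means that the Maya diagram is antisymmetric about `-1`, and contains `-1`:
the nonnegative members are the `αᵢ`, the negative non-members are the `-βᵢ - 1`. -/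
theorem isSymplectic_iff_inMaya (μ : YoungDiagram) :
    IsSymplectic μ ↔ InMaya μ (-1) ∧ ∀ s : ℤ, 0 ≤ s → (InMaya μ s ↔ ¬ InMaya μ (-2 - s)) := by
  have harm : ∀ i < frobeniusRank μ, (frobeniusArm μ i : ℤ) = (μ.rowLen i : ℤ) - i - 1 := by
    intro i hi
    rw [lt_frobeniusRank_iff] at hi
    rw [frobeniusArm]
    omega
  have hleg : ∀ i < frobeniusRank μ, (frobeniusLeg μ i : ℤ) = (μ.colLen i : ℤ) - i - 1 := by
    intro i hi
    rw [lt_colLen_iff_of_rank] at hi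
    rw [frobeniusLeg]
    omega
  have hpos : ∀ s : ℤ, 0 ≤ s → InMaya μ s → ∃ i < frobeniusRank μ, s = frobeniusArm μ i := by
    rintro s hs ⟨i, rfl⟩
    have hi : i < frobeniusRank μ := by rw [lt_frobeniusRank_iff]; omega
    exact ⟨i, hi, (harm i hi).symm⟩
  have hneg : ∀ s : ℤ, s < 0 → ¬ InMaya μ s →
      ∃ i < frobeniusRank μ, s = -(frobeniusLeg μ i : ℤ) - 1 := by
    intro s hs h
    obtain ⟨j, rfl⟩ := (not_inMaya_iff μ s).mp h
    have hj : j < frobeniusRank μ := by rw [lt_colLen_iff_of_rank]; omega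
    refine ⟨j, hj, ?_⟩
    rw [hleg j hj]
    ring
  constructor
  · intro h
    refine ⟨?_, fun s hs => ⟨fun h1 => ?_, fun h1 => ?_⟩⟩
    · by_contra h1
      obtain ⟨i, hi, h2⟩ := hneg _ (by norm_num) h1
      have := h i hi
      omega
    · obtain ⟨i, hi, rfl⟩ := hpos s hs h1
      rw [not_inMaya_iff]
      refine ⟨i, ?_⟩
      have h2 := h i hi
      have h3 := hleg i hi
      omega
    · obtain ⟨i, hi, h2⟩ := hneg _ (by omega) h1
      have h3 := h i hi
      have h4 := harm i hi
      exact ⟨i, by omega⟩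
  · rintro ⟨h0, h⟩
    -- both coordinate sequences enumerate the same finite set in decreasing order
    have hA : StrictAnti fun i : Fin (frobeniusRank μ) => (frobeniusArm μ i : ℤ) + 1 := by
      intro a b hab
      simp only
      rw [harm a a.2, harm b b.2]
      have := μ.rowLen_anti a b hab.le
      rw [Fin.lt_def] at hab
      omega
    have hL : StrictAnti fun i : Fin (frobeniusRank μ) => (frobeniusLeg μ i : ℤ) := by
      intro a b hab
      simp only
      rw [hleg a a.2, hleg b b.2]
      have := μ.colLen_anti a b hab.le
      rw [Fin.lt_def] at hab
      omega
    have hrange : Set.range (fun i : Fin (frobeniusRank μ) => (frobeniusLeg μ i : ℤ)) =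
        Set.range fun i : Fin (frobeniusRank μ) => (frobeniusArm μ i : ℤ) + 1 := by
      ext z
      simp only [Set.mem_range]
      constructor
      · rintro ⟨i, rfl⟩
        have hn : ¬ InMaya μ (-(frobeniusLeg μ i : ℤ) - 1) := by
          rw [not_inMaya_iff]
          exact ⟨i, by rw [hleg i i.2]; ring⟩
        have hl : (frobeniusLeg μ i : ℤ) ≠ 0 := by
          intro hl
          rw [hl] at hn
          exact hn h0
        obtain ⟨j, hj, hj2⟩ := hpos ((frobeniusLeg μ i : ℤ) - 1) (by omega) ((h _ (by omega)).mpr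
          (by rwa [show -2 - ((frobeniusLeg μ i : ℤ) - 1) = -(frobeniusLeg μ i : ℤ) - 1 by ring]))
        exact ⟨⟨j, hj⟩, by simp only; omega⟩
      · rintro ⟨i, rfl⟩
        have hm : InMaya μ (frobeniusArm μ i) := ⟨i, harm i i.2⟩
        obtain ⟨j, hj, hj2⟩ := hneg _ (by omega) ((h _ (by omega)).mp hm)
        exact ⟨⟨j, hj⟩, by simp only; omega⟩
    have heq : (fun i : Fin (frobeniusRank μ) => -(frobeniusLeg μ i : ℤ)) =
        fun i : Fin (frobeniusRank μ) => -((frobeniusArm μ i : ℤ) + 1) := by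
      apply StrictMono.range_inj hL.neg hA.neg |>.mp
      have := congrArg (fun S : Set ℤ => Neg.neg '' S) hrange
      simpa only [← Set.range_comp, Function.comp_def] using this
    intro i hi
    have := congrFun heq ⟨i, hi⟩
    simp only at this
    omega

theorem inMaya_partitionOfBeta (B : Finset ℕ) (z : ℤ) :
    InMaya (partitionOfBeta B) (z - B.card) ↔ z < 0 ∨ ∃ b ∈ B, z = (b : ℕ) := by
  constructor
  · rintro ⟨i, hi⟩
    rcases lt_or_ge i B.card with h | h
    · right
      exact ⟨_, rowLen_partitionOfBeta_mem B h, by omega⟩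
    · rw [rowLen_partitionOfBeta_of_ge B h] at hi
      left
      omega
  · rintro (h | ⟨b, hb, rfl⟩)
    · refine ⟨((B.card : ℤ) - 1 - z).toNat, ?_⟩
      rw [rowLen_partitionOfBeta_of_ge B (by omega)]
      omega
    · obtain ⟨x, hx, rfl⟩ := exists_rowLen_partitionOfBeta B hb
      exact ⟨x, by omega⟩

theorem frobeniusRank_partitionOfBeta (B : Finset ℕ) :
    frobeniusRank (partitionOfBeta B) = (B.filter fun b => B.card ≤ b).card := by
  conv_lhs => rw [← Finset.card_range (frobeniusRank (partitionOfBeta B))]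
  have hlt : ∀ i < frobeniusRank (partitionOfBeta B), i < B.card := by
    intro i hi
    by_contra! hle
    rw [lt_frobeniusRank_iff, rowLen_partitionOfBeta_of_ge B hle] at hi
    omega
  refine Finset.card_bij (fun i _ => (partitionOfBeta B).rowLen i + (B.card - 1 - i)) ?_ ?_ ?_
  · intro i hi
    rw [Finset.mem_range] at hi
    have h1 := hlt i hi
    rw [Finset.mem_filter]
    refine ⟨rowLen_partitionOfBeta_mem B h1, ?_⟩
    rw [lt_frobeniusRank_iff] at hi
    omega
  · intro a ha b hb h
    rw [Finset.mem_range] at ha hb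
    have h1 := hlt a ha
    have h2 := hlt b hb
    rcases lt_trichotomy a b with h3 | h3 | h3
    · have := (partitionOfBeta B).rowLen_anti a b h3.le
      omega
    · exact h3
    · have := (partitionOfBeta B).rowLen_anti b a h3.le
      omega
  · intro b hb
    rw [Finset.mem_filter] at hb
    obtain ⟨x, hx, rfl⟩ := exists_rowLen_partitionOfBeta B hb.1
    refine ⟨x, ?_, rfl⟩
    rw [Finset.mem_range, lt_frobeniusRank_iff]
    omega

end Maya

section Core

/-- The beta-set of the core with residue counts `c`. -/
theorem mem_coreBeta (p : ℕ) (c : ℕ → ℕ) (z : ℕ) :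
    z ∈ ((Finset.range p).biUnion fun i => (Finset.range (c i)).image fun j => p * j + i) ↔
      ∃ i < p, ∃ j < c i, z = p * j + i := by
  simp [eq_comm]

theorem mul_add_inj_of_lt {p i i' j j' : ℤ} (hi0 : 0 ≤ i) (hi : i < p) (hi0' : 0 ≤ i')
    (hi' : i' < p) (h : p * j + i = p * j' + i') : j = j' ∧ i = i' := by
  have h1 : j = j' := by
    rcases lt_trichotomy j j' with hlt | heq | hlt
    · nlinarith
    · exact heq
    · nlinarith
  subst h1
  exact ⟨rfl, by linarith⟩

theorem card_coreBeta (p : ℕ) (c : ℕ → ℕ) :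
    ((Finset.range p).biUnion fun i =>
      (Finset.range (c i)).image fun j => p * j + i).card = ∑ i ∈ Finset.range p, c i := by
  rw [Finset.card_biUnion]
  · refine Finset.sum_congr rfl fun i hi => ?_
    rw [Finset.mem_range] at hi
    rw [Finset.card_image_of_injective, Finset.card_range]
    intro a b h
    have h' : p * a = p * b := by simpa using h
    exact Nat.eq_of_mul_eq_mul_left (by omega) h'
  · intro i hi i' hi' hne
    rw [Finset.coe_range, Set.mem_Iio] at hi hi'
    rw [Function.onFun, Finset.disjoint_left]
    intro z hz hz'
    rw [Finset.mem_image] at hz hz'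
    obtain ⟨j, _, rfl⟩ := hz
    obtain ⟨j', _, h⟩ := hz'
    exact hne (by
      have := mul_add_inj_of_lt (p := p) (i := i) (i' := i') (j := j) (j' := j') (by omega)
        (by omega) (by omega) (by omega) (by exact_mod_cast h.symm)
      omega)

theorem inMaya_core (p : ℕ) (c : ℕ → ℕ) (M : ℕ) (hM : ∑ i ∈ Finset.range p, c i = M)
    (j : ℤ) (u : ℕ) (hu : u < p) :
    InMaya (partitionOfBeta ((Finset.range p).biUnion fun i =>
      (Finset.range (c i)).image fun j => p * j + i)) (p * j + u - M) ↔ j < c u := by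
  rw [← hM, ← card_coreBeta, inMaya_partitionOfBeta]
  have hp : (0 : ℤ) < p := by omega
  constructor
  · rintro (h | ⟨b, hb, h⟩)
    · have : j < 0 := by nlinarith
      omega
    · rw [mem_coreBeta] at hb
      obtain ⟨i, hi, j', hj', rfl⟩ := hb
      push_cast at h
      obtain ⟨h1, h2⟩ := mul_add_inj_of_lt (by omega) (by omega) (by omega) (by omega) h
      have h3 : u = i := by exact_mod_cast h2
      subst h3
      omega
  · intro h
    rcases lt_or_ge j 0 with h0 | h0
    · left
      nlinarith
    · right
      lift j to ℕ using h0
      refine ⟨p * j + u, ?_, by push_cast; ring⟩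
      rw [mem_coreBeta]
      exact ⟨u, hu, j, by omega, rfl⟩

/-- The core with residue counts `c` (modulo `2 T`, with `2 T (2 n + 1)` beta-numbers) is
symplectic iff the counts balance in pairs of residues `u`, `2 T - 2 - u`. -/
theorem isSymplectic_core_iff (T n : ℕ) (hT : 0 < T) (c : ℕ → ℕ)
    (hM : ∑ i ∈ Finset.range (2 * T), c i = 2 * T * (2 * n + 1)) :
    IsSymplectic (partitionOfBeta ((Finset.range (2 * T)).biUnion fun i =>
      (Finset.range (c i)).image fun j => 2 * T * j + i)) ↔
    c (2 * T - 1) = 2 * n + 1 ∧ ∀ u < 2 * T - 1, c u + c (2 * T - 2 - u) = 4 * n + 2 := by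
  have key := inMaya_core (2 * T) c _ hM
  rw [isSymplectic_iff_inMaya]
  set μ := partitionOfBeta ((Finset.range (2 * T)).biUnion fun i =>
      (Finset.range (c i)).image fun j => 2 * T * j + i)
  push_cast at key
  have hlast : ∀ j : ℤ, (InMaya μ (2 * T * j + (2 * T - 1 : ℕ) - 2 * T * (2 * n + 1)) ↔
      j < c (2 * T - 1)) := fun j => key j _ (by omega)
  have hm1 : InMaya μ (-1) ↔ 2 * n < c (2 * T - 1) := by
    rw [show (-1 : ℤ) = 2 * T * (2 * n : ℕ) + (2 * T - 1 : ℕ) - 2 * T * (2 * n + 1) by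
      rw [Nat.cast_sub (by omega)]; push_cast; ring, hlast]
    omega
  have hmirror1 : ∀ j : ℤ, -2 - (2 * T * j + (2 * T - 1 : ℕ) - 2 * T * (2 * n + 1)) =
      2 * T * (4 * n - j) + (2 * T - 1 : ℕ) - 2 * T * (2 * n + 1) := by
    intro j
    rw [Nat.cast_sub (by omega)]
    push_cast
    ring
  have hmirror2 : ∀ (j : ℤ) (u : ℕ), u < 2 * T - 1 →
      -2 - (2 * T * j + u - 2 * T * (2 * n + 1)) =
      2 * T * (4 * n + 1 - j) + (2 * T - 2 - u : ℕ) - 2 * T * (2 * n + 1) := by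
    intro j u hu
    rw [Nat.cast_sub (by omega), Nat.cast_sub (by omega)]
    push_cast
    ring
  rw [hm1]
  have hT' : (0 : ℤ) < T := by omega
  constructor
  · rintro ⟨h0, h⟩
    have h1 : ∀ j : ℤ, 2 * n + 1 ≤ j → (j < c (2 * T - 1) ↔ ¬ 4 * n - j < c (2 * T - 1)) := by
      intro j hj
      have := h (2 * T * j + (2 * T - 1 : ℕ) - 2 * T * (2 * n + 1)) (by nlinarith)
      rwa [hmirror1, hlast, hlast] at this
    have h2 : ∀ u < 2 * T - 1, ∀ j : ℤ, 2 * n + 1 ≤ j →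
        (j < c u ↔ ¬ 4 * n + 1 - j < c (2 * T - 2 - u)) := by
      intro u hu j hj
      have := h (2 * T * j + u - 2 * T * (2 * n + 1)) (by nlinarith)
      rwa [hmirror2 j u hu, key j u (by omega), key _ _ (by omega)] at this
    refine ⟨?_, ?_⟩
    · have := h1 (2 * n + 1) le_rfl
      omega
    · intro u hu
      have h3 := h2 u hu
      have h4 := h2 (2 * T - 2 - u) (by omega)
      rw [show 2 * T - 2 - (2 * T - 2 - u) = u by omega] at h4
      generalize c u = a at *
      generalize c (2 * T - 2 - u) = a' at *
      rcases lt_trichotomy a (2 * n + 1) with h5 | h5 | h5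
      · have := h3 (2 * n + 1) le_rfl
        rcases Nat.lt_or_ge (2 * n + 1) a' with h6 | h6
        · have := h4 a' (by omega)
          have := h4 (a' - 1) (by omega)
          omega
        · have := h4 (2 * n + 1) le_rfl
          omega
      · have := h3 (2 * n + 1) le_rfl
        rcases Nat.lt_or_ge (2 * n + 1) a' with h6 | h6
        · have := h4 (a' - 1) (by omega)
          omega
        · omega
      · have := h3 a (by omega)
        have := h3 (a - 1) (by omega)
        omega
  · rintro ⟨h1, h2⟩
    refine ⟨by omega, ?_⟩
    intro s hs
    obtain ⟨j, u, hu, rfl⟩ : ∃ (j : ℤ) (u : ℕ), u < 2 * T ∧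
        s = 2 * T * j + u - 2 * T * (2 * n + 1) := by
      refine ⟨(s + 2 * T * (2 * n + 1)) / (2 * T : ℕ), ((s + 2 * T * (2 * n + 1)) % (2 * T : ℕ)).toNat,
        ?_, ?_⟩
      · have := Int.emod_lt_of_pos (s + 2 * T * (2 * n + 1)) (show (0 : ℤ) < (2 * T : ℕ) by omega)
        omega
      · rw [Int.toNat_of_nonneg (Int.emod_nonneg _ (by omega))]
        have := Int.mul_ediv_add_emod (s + 2 * T * (2 * n + 1)) (2 * T : ℕ)
        push_cast at this ⊢
        linarith
    rcases Nat.lt_or_ge u (2 * T - 1) with hu1 | hu1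
    · rw [hmirror2 j u hu1, key j u hu, key _ _ (by omega)]
      have := h2 u hu1
      omega
    · obtain rfl : u = 2 * T - 1 := by omega
      rw [hmirror1, hlast, hlast]
      have hj : 2 * n + 1 ≤ j := by
        by_contra! hlt
        have : (2 * T * (j + 1) : ℤ) ≤ 2 * T * (2 * n + 1) := by nlinarith
        rw [Nat.cast_sub (by omega)] at hs
        push_cast at hs
        nlinarith
      omega

/-- The rank of a core counts the beta-numbers beyond the ground state. -/
theorem frobeniusRank_core (p k : ℕ) (c : ℕ → ℕ)
    (hM : ∑ i ∈ Finset.range p, c i = p * k) :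
    frobeniusRank (partitionOfBeta ((Finset.range p).biUnion fun i =>
      (Finset.range (c i)).image fun j => p * j + i)) = ∑ i ∈ Finset.range p, (c i - k) := by
  rw [frobeniusRank_partitionOfBeta, card_coreBeta, hM]
  rw [Finset.filter_biUnion, Finset.card_biUnion]
  · refine Finset.sum_congr rfl fun i hi => ?_
    rw [Finset.mem_range] at hi
    rw [Finset.filter_image, Finset.card_image_of_injective, ← Nat.card_Ico]
    · congr 1
      ext j
      simp only [Finset.mem_filter, Finset.mem_range, Finset.mem_Ico]
      constructor
      · rintro ⟨h1, h2⟩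
        refine ⟨?_, h1⟩
        by_contra! h3
        have : p * (j + 1) ≤ p * k := Nat.mul_le_mul_left _ h3
        rw [mul_add] at this
        omega
      · rintro ⟨h1, h2⟩
        exact ⟨h2, (Nat.mul_le_mul_left p h1).trans (Nat.le_add_right _ _)⟩
    · intro a b h
      have h' : p * a = p * b := by simpa using h
      exact Nat.eq_of_mul_eq_mul_left (by omega) h'
  · intro i hi i' hi' hne
    rw [Finset.coe_range, Set.mem_Iio] at hi hi'
    rw [Function.onFun, Finset.disjoint_left]
    intro z hz hz'
    rw [Finset.mem_filter, Finset.mem_image] at hz hz'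
    obtain ⟨⟨j, _, rfl⟩, _⟩ := hz
    obtain ⟨⟨j', _, h⟩, _⟩ := hz'
    exact hne (by
      have := mul_add_inj_of_lt (p := p) (i := i) (i' := i') (j := j) (j' := j') (by omega)
        (by omega) (by omega) (by omega) (by exact_mod_cast h.symm)
      omega)

end Core

/-! ### Determinants with a block structure up to permutations -/

section BlockDeterminant

/-- A matrix that is block diagonal after numbering rows by `ρ` and columns by `γ`. -/
theorem det_of_blocks {R : Type*} [CommRing R] {N K : ℕ} (s : Fin K → ℕ)
    (M : Matrix (Fin N) (Fin N) R) (ρ γ : (Σ k, Fin (s k)) ≃ Fin N)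
    (h : ∀ a b, a.1 ≠ b.1 → M (ρ a) (γ b) = 0) :
    M.det = ((Equiv.Perm.sign (ρ.symm.trans γ) : ℤ) : R) *
      ∏ k, Matrix.det (Matrix.of fun x y : Fin (s k) => M (ρ ⟨k, x⟩) (γ ⟨k, y⟩)) := by
  have h1 : (M.submatrix ρ γ).det =
      ∏ k, Matrix.det (Matrix.of fun x y : Fin (s k) => M (ρ ⟨k, x⟩) (γ ⟨k, y⟩)) := by
    have hT : (M.submatrix ρ γ).BlockTriangular Sigma.fst := by
      intro a b hab
      exact h a b hab.ne'
    rw [hT.det_fintype]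
    refine Finset.prod_congr rfl fun k _ => ?_
    rw [← Matrix.det_submatrix_equiv_self (Equiv.sigmaSubtype k).symm]
    rfl
  have h2 : M.submatrix ρ γ = (M.submatrix id (ρ.symm.trans γ)).submatrix ρ ρ := by
    ext a b
    simp
  rw [← h1, h2, Matrix.det_submatrix_equiv_self, Matrix.det_permute', ← mul_assoc, ← Int.cast_mul,
    ← Units.val_mul, Int.units_mul_self]
  simp

/-- The sign of a numbering `ρ` of `Fin N` by blocks, by counting inversions of its inverse. -/
def numberingSign {N K : ℕ} {s : Fin K → ℕ} (ρ : (Σ k, Fin (s k)) ≃ Fin N) : ℤˣ :=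
  ∏ j, ∏ i ∈ Finset.Iio j, if toLex (ρ.symm i) < toLex (ρ.symm j) then 1 else -1

theorem sign_symm_trans {N K : ℕ} {s : Fin K → ℕ} (ρ γ : (Σ k, Fin (s k)) ≃ Fin N) :
    Equiv.Perm.sign (ρ.symm.trans γ) = numberingSign ρ * numberingSign γ := by
  have hcard : Fintype.card (Σₗ k, Fin (s k)) = N := by
    rw [← Fintype.card_fin N]
    exact Fintype.card_congr (toLex.symm.trans ρ)
  let κ : Fin N ≃o Σₗ k, Fin (s k) := Fintype.orderIsoFinOfCardEq _ hcard
  have key : ∀ τ : (Σ k, Fin (s k)) ≃ Fin N,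
      Equiv.Perm.sign ((τ.symm.trans toLex).trans κ.symm.toEquiv) = numberingSign τ := by
    intro τ
    rw [Equiv.Perm.sign_eq_prod_prod_Iio, numberingSign]
    refine Finset.prod_congr rfl fun j _ => Finset.prod_congr rfl fun i _ => ?_
    congr 1
    exact propext (κ.symm.lt_iff_lt)
  have h1 : ρ.symm.trans γ = ((γ.symm.trans toLex).trans κ.symm.toEquiv)⁻¹ *
      ((ρ.symm.trans toLex).trans κ.symm.toEquiv) := by
    ext i
    simp [Equiv.Perm.inv_def]
  rw [h1, Equiv.Perm.sign_mul, Equiv.Perm.sign_inv, key, key, mul_comm]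

end BlockDeterminant

/-! ### Inversions -/

section Inversions

/-- The number of pairs `i < j < M` with `P (r i) (r j)`. -/
def pairCount (P : ℕ → ℕ → Prop) [∀ u v, Decidable (P u v)] (r : ℕ → ℕ) (M : ℕ) : ℕ :=
  ∑ j ∈ Finset.range M, ∑ i ∈ Finset.range j, if P (r i) (r j) then 1 else 0

theorem prod_Iio_eq_neg_one_pow {M : ℕ} (P : ℕ → ℕ → Prop) [∀ u v, Decidable (P u v)] (r : ℕ → ℕ)
    (Q : Fin M → Fin M → Prop) [∀ i j, Decidable (Q i j)]
    (h : ∀ i j : Fin M, i < j → (Q i j ↔ ¬ P (r i) (r j))) :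
    ∏ j, ∏ i ∈ Finset.Iio j, (if Q i j then 1 else -1 : ℤˣ) = (-1) ^ pairCount P r M := by
  rw [pairCount, ← Finset.prod_pow_eq_pow_sum,
    ← Fin.prod_univ_eq_prod_range (fun j => (-1 : ℤˣ) ^ ∑ i ∈ Finset.range j,
      if P (r i) (r j) then 1 else 0)]
  refine Finset.prod_congr rfl fun j _ => ?_
  rw [← Finset.prod_pow_eq_pow_sum, ← Nat.Iio_eq_range, ← Fin.map_valEmbedding_Iio,
    Finset.prod_map]
  refine Finset.prod_congr rfl fun i hi => ?_
  rw [Finset.mem_Iio] at hi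
  have h1 := h i j hi
  by_cases hP : P (r i) (r j)
  · rw [if_neg (by rw [h1]; exact not_not.mpr hP)]
    simp [hP]
  · rw [if_pos (h1.mpr hP)]
    simp [hP]

theorem strictAnti_beta (lam : YoungDiagram) (m : ℕ) {i j : ℕ} (hij : i < j) (hj : j < m) :
    lam.rowLen j + (m - 1 - j) < lam.rowLen i + (m - 1 - i) := by
  have := lam.rowLen_anti i j hij.le
  omega

theorem sign_sigmaPerm (p : ℕ) (lam : YoungDiagram) (m : ℕ) :
    Equiv.Perm.sign (sigmaPerm p lam m) =
      (-1) ^ pairCount (fun u v => v < u) (fun i => (lam.rowLen i + (m - 1 - i)) % p) m := by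
  set f : Fin m → ℕ ×ₗ ℕᵒᵈ := fun j =>
    (toLex (beta lam m j % p, OrderDual.toDual (beta lam m j)) : ℕ ×ₗ ℕᵒᵈ) with hf
  have hanti : ∀ i j : Fin m, i < j → beta lam m j < beta lam m i := fun i j hij =>
    strictAnti_beta lam m hij j.2
  have hinj : Function.Injective f := by
    intro i j h
    have h2 : beta lam m i = beta lam m j := congrArg (fun x => OrderDual.ofDual (ofLex x).2) h
    rcases lt_trichotomy i j with h3 | h3 | h3
    · exact absurd h2 (hanti i j h3).ne'
    · exact h3
    · exact absurd h2 (hanti j i h3).ne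
  have hmono : StrictMono (f ∘ Tuple.sort f) :=
    (Tuple.monotone_sort f).strictMono_of_injective (hinj.comp (Tuple.sort f).injective)
  rw [← Equiv.Perm.sign_inv, Equiv.Perm.sign_eq_prod_prod_Iio]
  apply prod_Iio_eq_neg_one_pow
  intro i j hij
  have h1 : (sigmaPerm p lam m)⁻¹ i < (sigmaPerm p lam m)⁻¹ j ↔ f i < f j := by
    rw [← hmono.lt_iff_lt]
    simp only [Function.comp_apply]
    change f ((sigmaPerm p lam m) ((sigmaPerm p lam m).symm i)) <
      f ((sigmaPerm p lam m) ((sigmaPerm p lam m).symm j)) ↔ _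
    rw [Equiv.apply_symm_apply, Equiv.apply_symm_apply]
  rw [h1, hf, Prod.Lex.toLex_lt_toLex, OrderDual.toDual_lt_toDual]
  have := hanti i j hij
  change _ ↔ ¬ (beta lam m j % p < beta lam m i % p)
  simp only
  omega

theorem sum_range_mul_eq {α : Type*} [AddCommMonoid α] (p B : ℕ) (g : ℕ → α) :
    ∑ i ∈ Finset.range (p * B), g i =
      ∑ Q ∈ Finset.range B, ∑ v ∈ Finset.range p, g (p * Q + v) := by
  induction B with
  | zero => simp
  | succ B ih => rw [Finset.sum_range_succ, ← ih, mul_add, mul_one, Finset.sum_range_add]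

/-- The number of `i < p k + a` congruent to `u` is `k` or `k + 1`. -/
theorem card_filter_mod_eq (p k a u : ℕ) (ha : a ≤ p) (hu : u < p) :
    ((Finset.range (p * k + a)).filter fun i => i % p = u).card = k + if u < a then 1 else 0 := by
  rw [Finset.card_filter, Finset.sum_range_add, sum_range_mul_eq]
  congr 1
  · rw [Finset.sum_congr rfl (g := fun _ => 1), Finset.sum_const, Finset.card_range]
    · simp
    · intro Q _
      rw [Finset.sum_eq_single u]
      · rw [Nat.mul_add_mod, Nat.mod_eq_of_lt hu, if_pos rfl]
      · intro v hv hne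
        rw [Finset.mem_range] at hv
        rw [Nat.mul_add_mod, Nat.mod_eq_of_lt hv, if_neg hne]
      · simp [hu]
  · have h1 : ∀ v ∈ Finset.range a, (if (p * k + v) % p = u then 1 else 0) =
        if v = u then 1 else 0 := by
      intro v hv
      rw [Finset.mem_range] at hv
      rw [Nat.mul_add_mod, Nat.mod_eq_of_lt (by omega)]
    rw [Finset.sum_congr rfl h1]
    simp

theorem card_filter_mod_lt (p j : ℕ) (hp : 0 < p) :
    (∑ i ∈ Finset.range j, if i % p < j % p then 1 else 0) = (j / p + 1) * (j % p) := by
  have hj : j % p < p := Nat.mod_lt _ hp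
  conv_lhs => rw [show Finset.range j = Finset.range (p * (j / p) + j % p) by
    rw [Nat.div_add_mod]]
  rw [Finset.sum_range_add, sum_range_mul_eq, add_mul, one_mul]
  congr 1
  · rw [Finset.sum_congr rfl (g := fun _ => j % p), Finset.sum_const, Finset.card_range]
    · simp
    · intro Q _
      rw [Finset.sum_congr rfl (g := fun v => if v < j % p then 1 else 0), ← Finset.card_filter]
      · rw [← Finset.card_range (j % p)]
        congr 1
        ext v
        simp only [Finset.mem_filter, Finset.mem_range, Finset.card_range]
        omega
      · intro v hv
        rw [Finset.mem_range] at hv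
        rw [Nat.mul_add_mod, Nat.mod_eq_of_lt hv]
  · rw [Finset.sum_congr rfl (g := fun _ => 1), Finset.sum_const, Finset.card_range]
    · simp
    · intro v hv
      rw [Finset.mem_range] at hv
      rw [Nat.mul_add_mod, Nat.mod_eq_of_lt (by omega), if_pos hv]

/-- The inversions of the sequence of residues of the empty partition. -/
theorem pairCount_ground (p B : ℕ) (hp : 0 < p) :
    pairCount (fun u v => v < u) (fun i => p - 1 - i % p) (p * B) =
      (∑ Q ∈ Finset.range B, (Q + 1)) * ∑ v ∈ Finset.range p, v := by
  have h : ∑ j ∈ Finset.range (p * B), (j / p + 1) * (j % p) =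
      ∑ Q ∈ Finset.range B, ∑ v ∈ Finset.range p, (Q + 1) * v := by
    rw [sum_range_mul_eq]
    refine Finset.sum_congr rfl fun Q _ => Finset.sum_congr rfl fun v hv => ?_
    rw [Finset.mem_range] at hv
    rw [Nat.mul_add_mod, Nat.mod_eq_of_lt hv, Nat.mul_add_div hp, Nat.div_eq_of_lt hv, add_zero]
  rw [pairCount, Finset.sum_mul_sum, ← h]
  refine Finset.sum_congr rfl fun j _ => ?_
  rw [← card_filter_mod_lt p j hp]
  refine Finset.sum_congr rfl fun i _ => ?_
  have h1 := Nat.mod_lt i hp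
  have h2 := Nat.mod_lt j hp
  congr 1
  apply propext
  omega

theorem sum_sum_range_symm {α : Type*} [AddCommMonoid α] (f : ℕ → ℕ → α) (N : ℕ)
    (hf : ∀ i < N, f i i = 0) :
    ∑ j ∈ Finset.range N, ∑ i ∈ Finset.range j, (f i j + f j i) =
      ∑ j ∈ Finset.range N, ∑ i ∈ Finset.range N, f i j := by
  induction N with
  | zero => simp
  | succ N ih =>
    rw [Finset.sum_range_succ, ih fun i hi => hf i (by omega), Finset.sum_range_succ (n := N)]
    simp only [Finset.sum_range_succ _ N, Finset.sum_add_distrib, hf N (by omega), add_zero]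
    rw [add_assoc, add_comm (∑ i ∈ Finset.range N, f i N)]

theorem sum_sum_range_eq_choose (r : ℕ → ℕ) (v N : ℕ) :
    (∑ j ∈ Finset.range N, ∑ i ∈ Finset.range j, if r i = v ∧ r j = v then 1 else 0) =
      (((Finset.range N).filter fun i => r i = v).card).choose 2 := by
  induction N with
  | zero => simp
  | succ N ih =>
    rw [Finset.sum_range_succ, ih, Finset.range_add_one, Finset.filter_insert]
    by_cases h : r N = v
    · rw [if_pos h, Finset.card_insert_of_notMem (by simp), Nat.choose_succ_succ' _ 1,
        Nat.choose_one_right, Finset.card_filter, add_comm]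
      simp [h]
    · simp [h]

theorem sum_range_comp (r : ℕ → ℕ) (N p : ℕ) (hr : ∀ i < N, r i < p) {α : Type*} [CommSemiring α]
    (g : ℕ → α) :
    ∑ i ∈ Finset.range N, g (r i) =
      ∑ v ∈ Finset.range p, (((Finset.range N).filter fun i => r i = v).card : α) * g v := by
  rw [← Finset.sum_fiberwise_of_maps_to (g := r) (t := Finset.range p)]
  · refine Finset.sum_congr rfl fun v _ => ?_
    rw [Finset.sum_congr rfl (g := fun _ => g v), Finset.sum_const, nsmul_eq_mul]
    intro i hi
    rw [(Finset.mem_filter.mp hi).2]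
  · intro i hi
    simpa using hr i (by simpa using hi)

theorem sum_range_two_mul_pairs {α : Type*} [AddCommMonoid α] (T : ℕ) (hT : 0 < T) (g : ℕ → α) :
    ∑ v ∈ Finset.range (2 * T), g v =
      (∑ k ∈ Finset.range (T - 1), (g k + g (2 * T - 2 - k))) + g (T - 1) + g (2 * T - 1) := by
  obtain ⟨T, rfl⟩ : ∃ S, T = S + 1 := ⟨T - 1, by omega⟩
  rw [show 2 * (T + 1) = T + 1 + T + 1 by ring, Finset.sum_range_succ, Finset.sum_range_add,
    Finset.sum_range_succ, Finset.sum_add_distrib, show T + 1 - 1 = T by omega,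
    show T + 1 + T + 1 - 1 = T + 1 + T by omega, ← Finset.sum_range_reflect (fun x => g (T + 1 + x))]
  have : ∑ k ∈ Finset.range T, g (T + 1 + T + 1 - 2 - k) =
      ∑ k ∈ Finset.range T, g (T + 1 + (T - 1 - k)) := by
    refine Finset.sum_congr rfl fun k hk => ?_
    rw [Finset.mem_range] at hk
    congr 1
    omega
  rw [this]
  abel

end Inversions

/-! ### The sign of the block decomposition -/

section BlockOrder

/-- The block of the Jacobi–Trudi matrix to which the residue `u` of a beta-number modulo `2 T`
contributes: `u` and `2 T - 2 - u` share a block, and `2 T - 1` comes last. -/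
def blockIndex (T u : ℕ) : ℕ := if u < T then u else if u = 2 * T - 1 then T else 2 * T - 2 - u

/-- The residues `T, …, 2 T - 2`, whose rows are read backwards inside their block. -/
def IsMirror (T u : ℕ) : Prop := T ≤ u ∧ u < 2 * T - 1

instance (T u : ℕ) : Decidable (IsMirror T u) := inferInstanceAs (Decidable (_ ∧ _))

/-- For beta-numbers `b > b'` of residues `u`, `v`: whether `b` comes after `b'` in the block
order. -/
def BlockInverted (T u v : ℕ) : Prop :=
  ¬ (blockIndex T u < blockIndex T v ∨ (blockIndex T u = blockIndex T v ∧ ¬ IsMirror T u))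

instance (T u v : ℕ) : Decidable (BlockInverted T u v) := inferInstanceAs (Decidable (¬ _))

/-- The number of `i < N` with `r i = u`. -/
def residueCount (r : ℕ → ℕ) (N u : ℕ) : ℕ := ((Finset.range N).filter fun i => r i = u).card

/-- The residues strictly between the mirror pair `2 T - 2 - v < v`. -/
def Between (T u v : ℕ) : Prop := IsMirror T v ∧ 2 * T - 2 - v < u ∧ u < v

instance (T u v : ℕ) : Decidable (Between T u v) := inferInstanceAs (Decidable (_ ∧ _))

/-- The block order and the order of residues disagree in a way symmetric in the two residues. -/
theorem blockInverted_add_lt (T u v : ℕ) (hu : u < 2 * T) (hv : v < 2 * T) :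
    ((if BlockInverted T u v then 1 else 0 : ZMod 2) + if v < u then 1 else 0) =
      ((if Between T u v then 1 else 0) + if Between T v u then 1 else 0) +
        if u = v ∧ IsMirror T u then 1 else 0 := by
  have h11 : (1 : ZMod 2) + 1 = 0 := by decide
  by_cases h1 : BlockInverted T u v <;> by_cases h2 : v < u <;>
    by_cases h3 : Between T u v <;> by_cases h4 : Between T v u <;>
    by_cases h5 : u = v ∧ IsMirror T u <;>
    (first | rw [if_pos h1] | rw [if_neg h1]) <;> (first | rw [if_pos h2] | rw [if_neg h2]) <;>
    (first | rw [if_pos h3] | rw [if_neg h3]) <;> (first | rw [if_pos h4] | rw [if_neg h4]) <;>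
    (first | rw [if_pos h5] | rw [if_neg h5]) <;> simp only [add_zero, zero_add, h11] <;>
    (exfalso; simp only [BlockInverted, Between, IsMirror, blockIndex, not_not] at h1 h3 h4 h5;
     split_ifs at h1 <;> omega)

/-- The hypotheses under which all blocks are square: the first `N = 2 T n + T` residues have
balanced counts, the last `N` are those of the beta-numbers `N - 1, …, 0`. -/
structure BalancedResidues (T n : ℕ) (r : ℕ → ℕ) : Prop where
  lt : ∀ i < 2 * T * n + T, r i < 2 * T
  last : residueCount r (2 * T * n + T) (2 * T - 1) = n + 1
  middle : residueCount r (2 * T * n + T) (T - 1) = n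
  pair : ∀ k < T - 1, residueCount r (2 * T * n + T) k +
    residueCount r (2 * T * n + T) (2 * T - 2 - k) = 2 * n + 1
  bottom : ∀ k < 2 * T * n + T, r (2 * T * n + T + k) = (2 * T * n + T - 1 - k) % (2 * T)

theorem sum_residueCount_between (T n : ℕ) (c : ℕ → ℕ) (hmid : c (T - 1) = n)
    (hpair : ∀ k < T - 1, c k + c (2 * T - 2 - k) = 2 * n + 1) (w : ℕ) (hw : w < T) :
    ∑ u ∈ Finset.Ico (T - 1 - w) (T + w), c u = w * (2 * n + 1) + n := by
  induction w with
  | zero =>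
    rw [Nat.sub_zero, show Finset.Ico (T - 1) (T + 0) = {T - 1} by
      ext x; simp only [Finset.mem_Ico, Finset.mem_singleton]; omega]
    simp [hmid]
  | succ w ih =>
    rw [show T + (w + 1) = T + w + 1 by ring, Finset.sum_Ico_succ_top (by omega),
      Finset.sum_eq_sum_Ico_succ_bot (by omega), show T - 1 - (w + 1) + 1 = T - 1 - w by omega,
      ih (by omega)]
    have := hpair (T - 1 - (w + 1)) (by omega)
    rw [show 2 * T - 2 - (T - 1 - (w + 1)) = T + w by omega] at this
    linarith

theorem card_between (T n : ℕ) (r : ℕ → ℕ) (h : BalancedResidues T n r) (v : ℕ) :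
    (∑ i ∈ Finset.range (2 * T * n + T), if Between T (r i) v then 1 else 0) =
      if IsMirror T v then (v - T) * (2 * n + 1) + n else 0 := by
  rw [sum_range_comp r _ (2 * T) h.lt (fun u => if Between T u v then 1 else 0)]
  by_cases hv : IsMirror T v
  · rw [if_pos hv]
    obtain ⟨hv1, hv2⟩ := hv
    rw [← sum_residueCount_between T n _ h.middle h.pair (v - T) (by omega)]
    simp only [mul_ite, mul_one, mul_zero]
    rw [← Finset.sum_filter]
    refine Finset.sum_congr ?_ fun _ _ => rfl
    ext u
    rw [Finset.mem_filter, Finset.mem_range, Finset.mem_Ico, Between, IsMirror]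
    omega
  · rw [if_neg hv]
    exact Finset.sum_eq_zero fun u _ => by rw [if_neg fun hb => hv hb.1, mul_zero]

theorem card_bottom_lt (T n v : ℕ) (hv : v ≤ 2 * T) :
    (∑ k ∈ Finset.range (2 * T * n + T), if (2 * T * n + T - 1 - k) % (2 * T) < v then 1 else 0) =
      v * n + min v T := by
  rw [Finset.sum_range_reflect (fun z => if z % (2 * T) < v then 1 else 0), Finset.sum_range_add,
    sum_range_mul_eq]
  have h1 : ∀ a ≤ 2 * T, ∀ Q, ∑ x ∈ Finset.range a, (if (2 * T * Q + x) % (2 * T) < v then 1 else 0)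
      = min v a := by
    intro a ha Q
    rw [← Finset.card_filter, ← Finset.card_range (min v a)]
    congr 1
    ext x
    simp only [Finset.mem_filter, Finset.mem_range]
    constructor
    · rintro ⟨h1, h2⟩
      rw [Nat.mul_add_mod, Nat.mod_eq_of_lt (by omega)] at h2
      omega
    · intro h
      refine ⟨by omega, ?_⟩
      rw [Nat.mul_add_mod, Nat.mod_eq_of_lt (by omega)]
      omega
  rw [h1 T (by omega) n]
  simp only [h1 (2 * T) le_rfl]
  rw [Finset.sum_const, Finset.card_range, smul_eq_mul, min_eq_left hv, mul_comm n v]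

/-- The contribution of one residue to the inversion count. -/
def residueWeight (T n v : ℕ) : ℕ :=
  v * n + min v T + if IsMirror T v then (v - T) * (2 * n + 1) + n else 0

theorem pairCount_add_pairCount (T n : ℕ) (r : ℕ → ℕ) (h : BalancedResidues T n r) :
    ((pairCount (BlockInverted T) r (2 * T * n + T) +
      pairCount (fun u v => v < u) r (2 * T * n + T + (2 * T * n + T)) : ℕ) : ZMod 2) =
    ((∑ v ∈ Finset.range (2 * T), residueCount r (2 * T * n + T) v * residueWeight T n v +
      ∑ v ∈ Finset.Ico T (2 * T - 1), (residueCount r (2 * T * n + T) v).choose 2 +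
      pairCount (fun u v => v < u) (fun k => (2 * T * n + T - 1 - k) % (2 * T))
        (2 * T * n + T) : ℕ) : ZMod 2) := by
  set N := 2 * T * n + T with hN
  -- pairs inside the first half, mixed pairs, and pairs inside the second half
  have hsplit : pairCount (fun u v => v < u) r (N + N) = pairCount (fun u v => v < u) r N +
      ∑ i ∈ Finset.range N, ((r i) * n + min (r i) T) +
      pairCount (fun u v => v < u) (fun k => (N - 1 - k) % (2 * T)) N := by
    unfold pairCount
    rw [Finset.sum_range_add, add_assoc]
    congr 1
    have h1 : ∀ k ∈ Finset.range N,
        (∑ i ∈ Finset.range (N + k), if r (N + k) < r i then 1 else 0) =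
        (∑ i ∈ Finset.range N, if (N - 1 - k) % (2 * T) < r i then 1 else 0) +
          ∑ i ∈ Finset.range k,
            if (N - 1 - k) % (2 * T) < (N - 1 - i) % (2 * T) then 1 else 0 := by
      intro k hk
      rw [Finset.mem_range] at hk
      rw [Finset.sum_range_add, h.bottom k hk]
      congr 1
      refine Finset.sum_congr rfl fun i hi => ?_
      rw [Finset.mem_range] at hi
      rw [h.bottom i (by omega)]
    rw [Finset.sum_congr rfl h1, Finset.sum_add_distrib, Finset.sum_comm]
    congr 1
    refine Finset.sum_congr rfl fun i hi => ?_
    rw [Finset.mem_range] at hi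
    exact card_bottom_lt T n (r i) (h.lt i hi).le
  have hfirst : ((pairCount (BlockInverted T) r N + pairCount (fun u v => v < u) r N : ℕ) : ZMod 2) =
      ((∑ j ∈ Finset.range N, (if IsMirror T (r j) then (r j - T) * (2 * n + 1) + n else 0) +
        ∑ v ∈ Finset.Ico T (2 * T - 1), (residueCount r N v).choose 2 : ℕ) : ZMod 2) := by
    have h1 : ∑ v ∈ Finset.Ico T (2 * T - 1), (residueCount r N v).choose 2 =
        ∑ j ∈ Finset.range N, ∑ i ∈ Finset.range j,
          if r i = r j ∧ IsMirror T (r i) then 1 else 0 := by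
      simp only [residueCount, ← sum_sum_range_eq_choose]
      rw [Finset.sum_comm]
      refine Finset.sum_congr rfl fun j _ => ?_
      rw [Finset.sum_comm]
      refine Finset.sum_congr rfl fun i _ => ?_
      by_cases hij : r i = r j ∧ IsMirror T (r i)
      · rw [if_pos hij, Finset.sum_eq_single (r i)]
        · rw [if_pos ⟨rfl, hij.1.symm⟩]
        · intro v _ hv
          rw [if_neg fun hh => hv hh.1.symm]
        · intro hni
          exact absurd (Finset.mem_Ico.mpr hij.2) hni
      · rw [if_neg hij]
        refine Finset.sum_eq_zero fun v hv => ?_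
        rw [if_neg]
        rintro ⟨rfl, h3⟩
        exact hij ⟨h3.symm, Finset.mem_Ico.mp hv⟩
    have h2 : ∑ j ∈ Finset.range N, (if IsMirror T (r j) then (r j - T) * (2 * n + 1) + n else 0) =
        ∑ j ∈ Finset.range N, ∑ i ∈ Finset.range j,
          ((if Between T (r i) (r j) then 1 else 0) + if Between T (r j) (r i) then 1 else 0) := by
      rw [sum_sum_range_symm (fun i j => if Between T (r i) (r j) then 1 else 0)]
      · exact Finset.sum_congr rfl fun j _ => (card_between T n r h (r j)).symm
      · intro i _
        rw [if_neg fun hb => lt_irrefl _ hb.2.2]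
    rw [h1, h2, pairCount, pairCount, ← Finset.sum_add_distrib, ← Finset.sum_add_distrib]
    push_cast
    refine Finset.sum_congr rfl fun j hj => ?_
    rw [← Finset.sum_add_distrib, ← Finset.sum_add_distrib]
    refine Finset.sum_congr rfl fun i hi => ?_
    rw [Finset.mem_range] at hi hj
    exact blockInverted_add_lt T (r i) (r j) (h.lt i (by omega)) (h.lt j hj)
  have hweight : ∑ v ∈ Finset.range (2 * T), residueCount r N v * residueWeight T n v =
      ∑ i ∈ Finset.range N, ((r i) * n + min (r i) T) +
      ∑ j ∈ Finset.range N, (if IsMirror T (r j) then (r j - T) * (2 * n + 1) + n else 0) := by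
    rw [← Finset.sum_add_distrib]
    exact (sum_range_comp r N (2 * T) h.lt (residueWeight T n)).symm
  rw [hsplit, hweight]
  push_cast at hfirst ⊢
  linear_combination hfirst

/-- Modulo `2` the weighted sum depends on the counts only through those of the mirror residues. -/
theorem sum_residueCount_mul_weight (T n : ℕ) (hT : 0 < T) (c : ℕ → ℕ) (h1 : c (2 * T - 1) = n + 1)
    (h2 : c (T - 1) = n) (h3 : ∀ k < T - 1, c k + c (2 * T - 2 - k) = 2 * n + 1) :
    ((∑ v ∈ Finset.range (2 * T), c v * residueWeight T n v : ℕ) : ZMod 2) =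
      ∑ k ∈ Finset.range (T - 1), (n * (c (2 * T - 2 - k) : ZMod 2) + k * (n + 1)) +
        n * residueWeight T n (T - 1) + (n + 1) * residueWeight T n (2 * T - 1) := by
  rw [sum_range_two_mul_pairs T hT, h1, h2]
  push_cast
  congr 2
  refine Finset.sum_congr rfl fun k hk => ?_
  rw [Finset.mem_range] at hk
  have hk3 := h3 k hk
  have hw1 : (residueWeight T n k : ZMod 2) = k * (n + 1) := by
    rw [residueWeight, if_neg (by rw [IsMirror]; omega), min_eq_left (by omega)]
    push_cast
    ring
  have hw2 : (residueWeight T n (2 * T - 2 - k) : ZMod 2) = k * (n + 1) + n := by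
    rw [residueWeight, if_pos (by rw [IsMirror]; omega), min_eq_right (by omega)]
    obtain ⟨d, rfl⟩ : ∃ d, T = k + d + 2 := ⟨T - k - 2, by omega⟩
    rw [show 2 * (k + d + 2) - 2 - k = k + 2 * d + 2 by omega,
      show k + 2 * d + 2 - (k + d + 2) = d by omega]
    have h20 : (2 : ZMod 2) = 0 := by decide
    push_cast
    linear_combination ((d + 1) * n + (d + 1) + d * n) * h20
  have hc : (c k : ZMod 2) = 2 * n + 1 - c (2 * T - 2 - k) := by
    rw [eq_sub_iff_add_eq]
    exact_mod_cast congrArg (Nat.cast : ℕ → ZMod 2) hk3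
  have h20 : (2 : ZMod 2) = 0 := by decide
  rw [hw1, hw2, hc]
  linear_combination (n * (k * (n + 1))) * h20

theorem choose_two_add (a b : ℕ) : (a + b).choose 2 = a.choose 2 + b.choose 2 + a * b := by
  induction b with
  | zero => simp
  | succ b ih =>
    rw [← add_assoc, Nat.choose_succ_succ' (a + b) 1, Nat.choose_succ_succ' b 1, ih,
      Nat.choose_one_right, Nat.choose_one_right]
    ring

/-- The residues of the beta-numbers of the empty partition, which are also those attached to the
columns. -/
theorem balancedResidues_ground (T n : ℕ) (hT : 0 < T) :
    BalancedResidues T n (fun j => 2 * T - 1 - j % (2 * T)) ∧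
      ∀ v ∈ Finset.Ico T (2 * T - 1),
        residueCount (fun j => 2 * T - 1 - j % (2 * T)) (2 * T * n + T) v = n + 1 := by
  have hcount : ∀ v < 2 * T, residueCount (fun j => 2 * T - 1 - j % (2 * T)) (2 * T * n + T) v =
      n + if 2 * T - 1 - v < T then 1 else 0 := by
    intro v hv
    rw [← card_filter_mod_eq (2 * T) n T (2 * T - 1 - v) (by omega) (by omega), residueCount]
    congr 1
    ext j
    have := Nat.mod_lt j (show 0 < 2 * T by omega)
    rw [Finset.mem_filter, Finset.mem_filter]
    refine and_congr_right fun _ => ?_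
    omega
  refine ⟨⟨fun i _ => by omega, ?_, ?_, ?_, ?_⟩, ?_⟩
  · rw [hcount _ (by omega), if_pos (by omega)]
  · rw [hcount _ (by omega), if_neg (by omega), add_zero]
  · intro k hk
    rw [hcount _ (by omega), hcount _ (by omega), if_neg (by omega), if_pos (by omega)]
    ring
  · intro k hk
    -- `N + k` and `N - 1 - k` are reflections of each other in `2 T (2 n + 1) - 1`
    have h1 := Nat.mod_lt (2 * T * n + T + k) (show 0 < 2 * T by omega)
    have h2 : 2 * T * n + T - 1 - k =
        2 * T * (2 * n - (2 * T * n + T + k) / (2 * T)) + (2 * T - 1 - (2 * T * n + T + k) % (2 * T)) := by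
      have h3 := Nat.div_add_mod (2 * T * n + T + k) (2 * T)
      have h4 : (2 * T * n + T + k) / (2 * T) ≤ 2 * n := by
        rw [← Nat.lt_succ_iff, Nat.div_lt_iff_lt_mul (by omega)]
        nlinarith
      rw [Nat.mul_sub]
      have h5 := Nat.mul_le_mul_left (2 * T) h4
      have h6 : 2 * T * (2 * n) = 2 * T * n + 2 * T * n := by ring
      omega
    show 2 * T - 1 - (2 * T * n + T + k) % (2 * T) = (2 * T * n + T - 1 - k) % (2 * T)
    rw [h2, Nat.mul_add_mod]
    exact (Nat.mod_eq_of_lt (by omega)).symm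
  · intro v hv
    rw [Finset.mem_Ico] at hv
    rw [hcount v (by omega), if_pos (by omega)]

theorem two_mul_sum_range_id (k : ℕ) : 2 * ∑ v ∈ Finset.range k, v = k * (k - 1) := by
  rw [mul_comm, Finset.sum_range_id_mul_two]

/-- The parity of all inversions, for the block orders of a balanced residue sequence and of the
empty partition together with the order of residues. -/
theorem pairCount_parity (T n : ℕ) (hT : 0 < T) (r : ℕ → ℕ) (h : BalancedResidues T n r) :
    ((pairCount (BlockInverted T) r (2 * T * n + T) +
      pairCount (BlockInverted T) (fun j => 2 * T - 1 - j % (2 * T)) (2 * T * n + T) +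
      pairCount (fun u v => v < u) r (2 * T * n + T + (2 * T * n + T)) : ℕ) : ZMod 2) =
    ((∑ v ∈ Finset.Ico T (2 * T - 1), ((residueCount r (2 * T * n + T) v + n + 1).choose 2 +
      (residueCount r (2 * T * n + T) v + n + 1)) + (n + 1) : ℕ) : ZMod 2) := by
  obtain ⟨h0, hc0⟩ := balancedResidues_ground T n hT
  have e1 := pairCount_add_pairCount T n r h
  have e2 := pairCount_add_pairCount T n _ h0
  have hground : ((pairCount (fun u v => v < u) (fun j => 2 * T - 1 - j % (2 * T))
      (2 * T * n + T + (2 * T * n + T)) : ℕ) : ZMod 2) = ((T * (n + 1) : ℕ) : ZMod 2) := by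
    rw [show 2 * T * n + T + (2 * T * n + T) = 2 * T * (2 * n + 1) by ring,
      pairCount_ground _ _ (by omega)]
    have h1 : ∑ Q ∈ Finset.range (2 * n + 1), (Q + 1) = (n + 1) * (2 * n + 1) := by
      have := two_mul_sum_range_id (2 * n + 1)
      rw [Nat.add_sub_cancel] at this
      rw [Finset.sum_add_distrib, Finset.sum_const, Finset.card_range, smul_eq_mul]
      nlinarith
    have h2 : ∑ v ∈ Finset.range (2 * T), v = T * (2 * T - 1) := by
      have := two_mul_sum_range_id (2 * T)
      rw [mul_assoc] at this
      exact Nat.eq_of_mul_eq_mul_left (by norm_num) this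
    rw [h1, h2]
    obtain ⟨S, rfl⟩ : ∃ S, T = S + 1 := ⟨T - 1, by omega⟩
    rw [show 2 * (S + 1) - 1 = 2 * S + 1 by omega]
    have h20 : (2 : ZMod 2) = 0 := by decide
    push_cast
    linear_combination ((n + 1) * (S + 1) * (n + S + 2 * n * S)) * h20
  have w1 := sum_residueCount_mul_weight T n hT _ h.last h.middle h.pair
  have w2 := sum_residueCount_mul_weight T n hT _ h0.last h0.middle h0.pair
  have hIco : ∀ g : ℕ → ZMod 2, ∑ v ∈ Finset.Ico T (2 * T - 1), g v =
      ∑ k ∈ Finset.range (T - 1), g (2 * T - 2 - k) := by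
    intro g
    rw [Finset.sum_Ico_eq_sum_range, show 2 * T - 1 - T = T - 1 by omega,
      ← Finset.sum_range_reflect]
    refine Finset.sum_congr rfl fun k hk => ?_
    rw [Finset.mem_range] at hk
    congr 1
    omega
  have hc0' : ∀ k ∈ Finset.range (T - 1),
      residueCount (fun j => 2 * T - 1 - j % (2 * T)) (2 * T * n + T) (2 * T - 2 - k) = n + 1 := by
    intro k hk
    rw [Finset.mem_range] at hk
    exact hc0 _ (by rw [Finset.mem_Ico]; omega)
  have h20 : (2 : ZMod 2) = 0 := by decide
  have hnn : ∀ x : ZMod 2, x * (x + 1) = 0 := by decide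
  have hterm : ∀ k ∈ Finset.range (T - 1),
      (((residueCount r (2 * T * n + T) (2 * T - 2 - k) + n + 1).choose 2 : ℕ) : ZMod 2) +
        (residueCount r (2 * T * n + T) (2 * T - 2 - k) + n + 1) =
      (n * (residueCount r (2 * T * n + T) (2 * T - 2 - k) : ZMod 2) + k * (n + 1)) +
        ((residueCount r (2 * T * n + T) (2 * T - 2 - k)).choose 2 : ℕ) +
        (n * (residueCount (fun j => 2 * T - 1 - j % (2 * T)) (2 * T * n + T) (2 * T - 2 - k) :
          ZMod 2) + k * (n + 1)) +
        ((residueCount (fun j => 2 * T - 1 - j % (2 * T)) (2 * T * n + T)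
          (2 * T - 2 - k)).choose 2 : ℕ) + (n + 1) := by
    intro k hk
    rw [hc0' k hk, add_assoc (residueCount r (2 * T * n + T) (2 * T - 2 - k)) n 1, choose_two_add]
    push_cast
    linear_combination ((residueCount r (2 * T * n + T) (2 * T - 2 - k) : ZMod 2) -
      k * (n + 1)) * h20 - hnn n
  have key : ∀ (A A' B B' : ℕ → ZMod 2) (d : ZMod 2),
      ∑ k ∈ Finset.range (T - 1), (A k + A' k + B k + B' k + d) =
        ∑ k ∈ Finset.range (T - 1), A k + ∑ k ∈ Finset.range (T - 1), A' k +
        ∑ k ∈ Finset.range (T - 1), B k + ∑ k ∈ Finset.range (T - 1), B' k +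
          ((T - 1 : ℕ) : ZMod 2) * d := by
    intro A A' B B' d
    simp [Finset.sum_add_distrib]
  have hsum := (Finset.sum_congr rfl hterm).trans (key _ _ _ _ _)
  have hT1 : ((T - 1 : ℕ) : ZMod 2) = T - 1 := by
    rw [Nat.cast_sub hT, Nat.cast_one]
  rw [hT1] at hsum
  push_cast at e1 e2 hground w1 w2 ⊢
  rw [hIco] at e1 e2 ⊢
  linear_combination e1 + e2 - hground + w1 + w2 - hsum + (n * residueWeight T n (T - 1) +
    (n + 1) * residueWeight T n (2 * T - 1) + pairCount (fun u v => v < u)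
    (fun k => (2 * T * n + T - 1 - k) % (2 * T)) (2 * T * n + T) - (T - 1 : ZMod 2) * (n + 1) - (n + 1)) * h20

end BlockOrder

/-! ### Numbering rows and columns by blocks -/

section BlockNumbering

theorem exists_sigma_equiv {N K : ℕ} (s : Fin K → ℕ) (hs : ∑ k, s k = N) (P : ℕ → ℕ → ℕ → Prop)
    (hex : ∀ (k : Fin K) (x : Fin (s k)), ∃ i < N, P k x i)
    (hinj : ∀ i k x k' x', P k x i → P k' x' i → k = k' ∧ x = x') :
    ∃ ρ : (Σ k, Fin (s k)) ≃ Fin N, ∀ a, P a.1 a.2 (ρ a) := by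
  choose f hf hP using hex
  let g : (Σ k, Fin (s k)) → Fin N := fun a => ⟨f a.1 a.2, hf a.1 a.2⟩
  have hg : Function.Injective g := by
    rintro ⟨k, x⟩ ⟨k', x'⟩ h
    have h' : f k x = f k' x' := congrArg Fin.val h
    have h2 := hP k' x'
    rw [← h'] at h2
    obtain ⟨h3, h4⟩ := hinj _ _ _ _ _ (hP k x) h2
    obtain rfl := Fin.ext h3
    obtain rfl := Fin.ext h4
    rfl
  have hbij : Function.Bijective g :=
    (Fintype.bijective_iff_injective_and_card g).mpr ⟨hg, by simp [hs]⟩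
  exact ⟨Equiv.ofBijective g hbij, fun a => hP a.1 a.2⟩

/-- The sizes of the blocks: `T - 1` mirror pairs of residues, then the residues `T - 1` and
`2 T - 1`. -/
def blockSize (T n k : ℕ) : ℕ := if k < T - 1 then 2 * n + 1 else if k = T - 1 then n else n + 1

theorem sum_blockSize (T n : ℕ) (hT : 0 < T) :
    ∑ k : Fin (T + 1), blockSize T n k = 2 * T * n + T := by
  obtain ⟨T, rfl⟩ : ∃ S, T = S + 1 := ⟨T - 1, by omega⟩
  rw [Fin.sum_univ_eq_sum_range (fun k => blockSize (T + 1) n k), Finset.sum_range_succ,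
    Finset.sum_range_succ, Finset.sum_congr rfl (g := fun _ => 2 * n + 1)]
  · rw [Finset.sum_const, Finset.card_range, smul_eq_mul, blockSize, blockSize,
      if_neg (by omega), if_pos (by omega), if_neg (by omega), if_neg (by omega)]
    ring
  · intro k hk
    rw [Finset.mem_range] at hk
    exact if_pos (by omega)

/-- The entry `i`, with residue `r i` and quotient `Q i`, is number `x` of block `k`. Here `f u`
lists the quotients with residue `u` in decreasing order. Mirror residues fill their block from
the end. -/
def IsBlockEntry (T n : ℕ) (r Q : ℕ → ℕ) (f : ℕ → ℕ → ℕ) (k x i : ℕ) : Prop :=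
  blockIndex T (r i) = k ∧
    ((IsMirror T (r i) ∧ x ≤ 2 * n ∧ 2 * n - x < residueCount r (2 * T * n + T) (r i) ∧
        Q i = f (r i) (2 * n - x)) ∨
      (¬ IsMirror T (r i) ∧ x < residueCount r (2 * T * n + T) (r i) ∧ Q i = f (r i) x))

theorem blockIndex_of_not_mirror {T u v : ℕ} (hu : u < 2 * T) (hv : v < 2 * T)
    (h : blockIndex T u = blockIndex T v) (hmu : ¬ IsMirror T u) (hmv : ¬ IsMirror T v) : u = v := by
  unfold IsMirror at hmu hmv
  unfold blockIndex at h
  split_ifs at h <;> omega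

theorem blockIndex_of_mirror {T u v : ℕ}
    (h : blockIndex T u = blockIndex T v) (hmu : IsMirror T u) (hmv : IsMirror T v) : u = v := by
  unfold IsMirror at hmu hmv
  unfold blockIndex at h
  split_ifs at h <;> omega

theorem add_eq_of_blockIndex {T u v : ℕ} (hv : v < 2 * T)
    (h : blockIndex T u = blockIndex T v) (hmu : IsMirror T u) (hmv : ¬ IsMirror T v) :
    v < T - 1 ∧ u = 2 * T - 2 - v := by
  unfold IsMirror at hmu hmv
  unfold blockIndex at h
  split_ifs at h <;> omega

/-- A numbering of the entries by blocks; its sign counts the pairs of entries that are inverted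
in the block order. -/
theorem exists_blockNumbering (T n : ℕ) (hT : 0 < T) (r Q : ℕ → ℕ) (f : ℕ → ℕ → ℕ)
    (h : BalancedResidues T n r)
    (hQ : ∀ i j, i < j → j < 2 * T * n + T → r i = r j → Q j < Q i)
    (hf : ∀ u < 2 * T, ∀ x < residueCount r (2 * T * n + T) u,
      ∃ i < 2 * T * n + T, r i = u ∧ Q i = f u x)
    (hanti : ∀ u < 2 * T, ∀ x y, x < y → y < residueCount r (2 * T * n + T) u → f u y < f u x) :
    ∃ ρ : (Σ k : Fin (T + 1), Fin (blockSize T n k)) ≃ Fin (2 * T * n + T),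
      (∀ a, IsBlockEntry T n r Q f a.1 a.2 (ρ a)) ∧
      numberingSign ρ = (-1) ^ pairCount (BlockInverted T) r (2 * T * n + T) := by
  -- comparing two entries of the same residue
  have hlt : ∀ u < 2 * T, ∀ x y, x < residueCount r (2 * T * n + T) u →
      y < residueCount r (2 * T * n + T) u → f u y < f u x → x < y := by
    intro u hu x y hx hy hxy
    by_contra! hle
    rcases hle.eq_or_lt with rfl | hlt
    · exact lt_irrefl _ hxy
    · exact lt_asymm hxy (hanti u hu y x hlt hx)
  have hne : ∀ u < 2 * T, ∀ x y, x < residueCount r (2 * T * n + T) u →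
      y < residueCount r (2 * T * n + T) u → f u x = f u y → x = y := by
    intro u hu x y hx hy hxy
    rcases lt_trichotomy x y with hlt | hlt | hlt
    · exact absurd hxy (hanti u hu x y hlt hy).ne'
    · exact hlt
    · exact absurd hxy (hanti u hu y x hlt hx).ne
  obtain ⟨ρ, hρ⟩ := exists_sigma_equiv (N := 2 * T * n + T)
    (fun k : Fin (T + 1) => blockSize T n k) (sum_blockSize T n hT)
    (fun k x i => i < 2 * T * n + T ∧ IsBlockEntry T n r Q f k x i) (by
      rintro ⟨k, hk⟩ ⟨x, hx⟩
      simp only at hx ⊢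
      unfold blockSize at hx
      split_ifs at hx with h1 h2
      · have hp := h.pair k h1
        by_cases hxc : x < residueCount r (2 * T * n + T) k
        · obtain ⟨i, hi, hri, hQi⟩ := hf k (by omega) x hxc
          refine ⟨i, hi, hi, ?_, Or.inr ⟨?_, by rwa [hri], by rw [hQi, hri]⟩⟩
          · rw [hri, blockIndex, if_pos (by omega)]
          · rw [hri, IsMirror]; omega
        · obtain ⟨i, hi, hri, hQi⟩ := hf (2 * T - 2 - k) (by omega) (2 * n - x) (by omega)
          refine ⟨i, hi, hi, ?_, Or.inl ⟨?_, by omega, by rw [hri]; omega, by rw [hQi, hri]⟩⟩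
          · rw [hri, blockIndex, if_neg (by omega), if_neg (by omega)]; omega
          · rw [hri, IsMirror]; omega
      · obtain ⟨i, hi, hri, hQi⟩ := hf (T - 1) (by omega) x (by rwa [h.middle])
        refine ⟨i, hi, hi, ?_, Or.inr ⟨?_, by rwa [hri, h.middle], by rw [hQi, hri]⟩⟩
        · rw [hri, blockIndex, if_pos (by omega)]; omega
        · rw [hri, IsMirror]; omega
      · obtain ⟨i, hi, hri, hQi⟩ := hf (2 * T - 1) (by omega) x (by rwa [h.last])
        refine ⟨i, hi, hi, ?_, Or.inr ⟨?_, by rwa [hri, h.last], by rw [hQi, hri]⟩⟩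
        · rw [hri, blockIndex, if_neg (by omega), if_pos rfl]; omega
        · rw [hri, IsMirror]; omega)
    (by
      rintro i k x k' x' ⟨hi, hk, h1⟩ ⟨-, hk', h2⟩
      refine ⟨hk.symm.trans hk', ?_⟩
      have hlti := h.lt i hi
      rcases h1 with ⟨m1, h1, h1', h1''⟩ | ⟨m1, h1, h1'⟩ <;>
        rcases h2 with ⟨m2, h2, h2', h2''⟩ | ⟨m2, h2, h2'⟩
      · have := hne _ hlti _ _ h1' h2' (h1''.symm.trans h2'')
        omega
      · exact absurd m1 m2
      · exact absurd m2 m1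
      · exact hne _ hlti _ _ h1 h2 (h1'.symm.trans h2'))
  refine ⟨ρ, fun a => (hρ a).2, ?_⟩
  apply prod_Iio_eq_neg_one_pow
  intro i j hij
  have hi := (hρ (ρ.symm i)).2
  have hj := (hρ (ρ.symm j)).2
  rw [Equiv.apply_symm_apply] at hi hj
  generalize ρ.symm i = a at hi ⊢
  generalize ρ.symm j = b at hj ⊢
  obtain ⟨⟨k, hk⟩, ⟨x, hx⟩⟩ := a
  obtain ⟨⟨l, hl⟩, ⟨y, hy⟩⟩ := b
  obtain ⟨hi1, hi2⟩ := hi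
  obtain ⟨hj1, hj2⟩ := hj
  simp only at hi1 hi2 hj1 hj2 hx hy
  have hri := h.lt i i.2
  have hrj := h.lt j j.2
  have hxy : k = l → (x < y ↔ ¬ IsMirror T (r i)) := by
    intro hkl
    have hb : blockIndex T (r i) = blockIndex T (r j) := by rw [hi1, hj1, hkl]
    rcases hi2 with ⟨m1, h1, h1', h1''⟩ | ⟨m1, h1, h1'⟩ <;>
      rcases hj2 with ⟨m2, h2, h2', h2''⟩ | ⟨m2, h2, h2'⟩
    · have hr := blockIndex_of_mirror hb m1 m2
      have hQij := hQ i j hij j.2 hr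
      rw [h1'', h2'', ← hr] at hQij
      rw [← hr] at h2'
      have := hlt _ hri _ _ h1' h2' hQij
      simp only [m1, not_true, iff_false]
      omega
    · obtain ⟨h3, h4⟩ := add_eq_of_blockIndex hrj hb m1 m2
      have hp := h.pair _ h3
      rw [← h4] at hp
      simp only [m1, not_true, iff_false]
      omega
    · obtain ⟨h3, h4⟩ := add_eq_of_blockIndex hri hb.symm m2 m1
      have hp := h.pair _ h3
      rw [← h4] at hp
      simp only [m1, not_false_eq_true, iff_true]
      omega
    · have hr := blockIndex_of_not_mirror hri hrj hb m1 m2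
      have hQij := hQ i j hij j.2 hr
      rw [h1', h2', ← hr] at hQij
      rw [← hr] at h2
      have := hlt _ hri _ _ h1 h2 hQij
      simp only [m1, not_false_eq_true, iff_true]
      omega
  rw [BlockInverted, not_not, hi1, hj1, Sigma.Lex.lt_def]
  simp only
  constructor
  · rintro (hkl | ⟨hkl, hlt'⟩)
    · exact Or.inl hkl
    · have hkl' : k = l := congrArg Fin.val hkl
      subst hkl'
      exact Or.inr ⟨rfl, (hxy rfl).mp hlt'⟩
  · rintro (hkl | ⟨hkl, hm⟩)
    · exact Or.inl hkl
    · subst hkl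
      exact Or.inr ⟨rfl, (hxy rfl).mpr hm⟩

/-- The columns behave like the rows of the empty partition: column `j` has residue
`2 T - 1 - j % (2 T)` and quotient `2 n - j / (2 T)`. -/
theorem exists_columnNumbering (T n : ℕ) (hT : 0 < T) :
    ∃ γ : (Σ k : Fin (T + 1), Fin (blockSize T n k)) ≃ Fin (2 * T * n + T),
      (∀ a, IsBlockEntry T n (fun j => 2 * T - 1 - j % (2 * T)) (fun j => 2 * n - j / (2 * T))
        (fun _ x => 2 * n - x) a.1 a.2 (γ a)) ∧
      numberingSign γ = (-1) ^ pairCount (BlockInverted T) (fun j => 2 * T - 1 - j % (2 * T))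
        (2 * T * n + T) := by
  obtain ⟨h, hc⟩ := balancedResidues_ground T n hT
  have hle : ∀ u < 2 * T, residueCount (fun j => 2 * T - 1 - j % (2 * T)) (2 * T * n + T) u ≤
      if u < T then n else n + 1 := by
    intro u hu
    by_cases h1 : u < T - 1
    · have h2 := h.pair u h1
      rw [hc (2 * T - 2 - u) (by rw [Finset.mem_Ico]; omega)] at h2
      rw [if_pos (by omega)]
      omega
    · split_ifs with h2
      · rw [show u = T - 1 by omega, h.middle]
      · by_cases h3 : u = 2 * T - 1
        · rw [h3, h.last]
        · rw [hc _ (by rw [Finset.mem_Ico]; omega)]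
  apply exists_blockNumbering T n hT _ _ _ h
  · intro i j hij hj hr
    have h1 := Nat.div_add_mod i (2 * T)
    have h2 := Nat.div_add_mod j (2 * T)
    have h3 := Nat.mod_lt i (show 0 < 2 * T by omega)
    have h4 := Nat.mod_lt j (show 0 < 2 * T by omega)
    have h5 : i % (2 * T) = j % (2 * T) := by omega
    have h6 : i / (2 * T) < j / (2 * T) := by
      by_contra! hle
      have := Nat.mul_le_mul_left (2 * T) hle
      omega
    have h7 : j / (2 * T) < n + 1 := by
      rw [Nat.div_lt_iff_lt_mul (by omega)]
      linarith [mul_comm (2 * T) n]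
    omega
  · intro u hu x hx
    have hle' := hle u hu
    refine ⟨2 * T * x + (2 * T - 1 - u), ?_, ?_, ?_⟩
    · split_ifs at hle' with hu'
      · have : 2 * T * (x + 1) ≤ 2 * T * n := Nat.mul_le_mul_left _ (by omega)
        rw [mul_add] at this
        omega
      · have : 2 * T * x ≤ 2 * T * n := Nat.mul_le_mul_left _ (by omega)
        omega
    · rw [Nat.mul_add_mod, Nat.mod_eq_of_lt (by omega)]
      omega
    · rw [Nat.mul_add_div (by omega), Nat.div_eq_of_lt (by omega), add_zero]
  · intro u hu x y hxy hy
    have hle' := hle u hu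
    split_ifs at hle' <;> omega

end BlockNumbering

/-! ### The diagonal blocks -/

section MirrorPairs

variable {F : Type*} [Field F]

theorem neg_one_zpow_eq_of_even {a b : ℤ} (h : Even (a - b)) : (-1 : F) ^ a = (-1) ^ b := by
  rw [← sub_add_cancel a b, zpow_add₀ (neg_ne_zero.mpr one_ne_zero), h.neg_one_zpow, one_mul]

theorem prod_neg_one_zpow {ι : Type*} (s : Finset ι) (f : ι → ℤ) :
    ∏ x ∈ s, (-1 : F) ^ f x = (-1) ^ ∑ x ∈ s, f x := by
  classical
  induction s using Finset.induction_on with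
  | empty => simp
  | insert a s ha ih =>
    rw [Finset.prod_insert ha, Finset.sum_insert ha, zpow_add₀ (neg_ne_zero.mpr one_ne_zero), ih]

/-- A rotation of an odd number of points has odd order, hence is an even permutation. -/
theorem sign_addRight {k : ℕ} (a : Fin (2 * k + 1)) :
    Equiv.Perm.sign (Equiv.addRight a) = 1 := by
  have h1 : (Equiv.addRight a) ^ (2 * k + 1) = 1 := by
    rw [Equiv.nsmul_addRight]
    ext x
    have : (2 * k + 1) • a = 0 := by
      have := card_nsmul_eq_zero (x := a)
      rwa [Fintype.card_fin] at this
    rw [this]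
    simp
  have h2 := congrArg Equiv.Perm.sign h1
  rw [map_pow, map_one] at h2
  rcases Int.units_eq_one_or (Equiv.Perm.sign (Equiv.addRight a)) with h | h
  · exact h
  · rw [h, pow_succ, pow_mul] at h2
    simp at h2

/-- The shift of the column `y` of a block belonging to a mirror pair of residues: the columns
`1, …, n` come first, then `-n, …, 0`. -/
def columnShift (n y : ℕ) : ℤ := if y < n then y + 1 else y - 2 * n

theorem columnShift_eq (n : ℕ) (y : Fin (2 * n + 1)) :
    columnShift n y = ((Equiv.addRight (Fin.ofNat (2 * n + 1) (n + 1)) y : Fin (2 * n + 1)) : ℕ) - n := by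
  have hy := y.2
  rw [Equiv.coe_addRight, Fin.val_add, Fin.val_ofNat, Nat.add_mod_mod, columnShift]
  split_ifs with h
  · rw [Nat.mod_eq_of_lt (by omega)]
    push_cast
    ring
  · rw [Nat.mod_eq_sub_mod (by omega), Nat.mod_eq_of_lt (by omega)]
    omega

theorem rowLen_pairPartition (lam mu : YoungDiagram) {N x : ℕ} (hx : x < N) :
    (pairPartition lam mu N).rowLen x =
      lam.rowLen x + (mu.rowLen 0 - mu.rowLen (N - 1 - x)) := by
  have h : ((Fin.rev ⟨x, hx⟩ : Fin N) : ℕ) = N - 1 - x := by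
    rw [Fin.val_rev]
    simp only
    omega
  rw [show (pairPartition lam mu N).rowLen x = _ from rowLen_partitionOfFn _ _ x, dif_pos hx, h]

/-- The block of a mirror pair of residues. Its first `c` rows belong to the first residue of the
pair, the others to the second one; the reflection of the `extendedH` makes the rows uniform. -/
theorem det_pairBlock {n : ℕ} (Y : Fin n → F) (hY : ∀ k, Y k ≠ 0) (lam mu : YoungDiagram) (c : ℕ)
    (hc : c ≤ 2 * n + 1) (hlam : lam.rowLen c = 0) (hmu : mu.rowLen (2 * n + 1 - c) = 0)
    (e : Fin (2 * n + 1) → ℤ)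
    (he : ∀ x, e x = (lam.rowLen x : ℤ) - mu.rowLen (2 * n - x) - (x : ℕ) + (c - n - 1)) :
    Matrix.det (Matrix.of fun x y : Fin (2 * n + 1) =>
      if (x : ℕ) < c then completeH (negVars Y) (e x + columnShift n y)
      else completeH (negVars Y) (-(2 * n + 1) - (e x + columnShift n y))) =
    (-1) ^ ((lam.card : ℤ) - mu.card) *
      schurPoly (pairPartition lam mu (2 * n + 1)) (adjoin (withInv Y) 1) := by
  have hlam0 : ∀ x, c ≤ x → lam.rowLen x = 0 := fun x hx => by
    have := lam.rowLen_anti c x hx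
    omega
  have hmu0 : ∀ x, x < c → mu.rowLen (2 * n - x) = 0 := fun x hx => by
    have := mu.rowLen_anti (2 * n + 1 - c) (2 * n - x) (by omega)
    omega
  have hd : ∀ y : Fin (2 * n + 1), -(n : ℤ) ≤ columnShift n y ∧ columnShift n y ≤ n := by
    intro y
    have := y.2
    unfold columnShift
    split_ifs <;> omega
  have hentry : ∀ x y : Fin (2 * n + 1),
      (if (x : ℕ) < c then completeH (negVars Y) (e x + columnShift n y)
        else completeH (negVars Y) (-(2 * n + 1) - (e x + columnShift n y))) =
      (-1) ^ (e x + if (x : ℕ) < c then 0 else 1) * ((-1) ^ columnShift n y *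
        extendedH n (palVars Y) (e x + columnShift n y)) := by
    intro x y
    have hd' := hd y
    have hx := x.2
    rw [← mul_assoc, ← zpow_add₀ (neg_ne_zero.mpr one_ne_zero), completeH_negVars,
      completeH_negVars, completeH_eq_ringCompleteH]
    split_ifs with h
    · have := hmu0 x h
      rw [extendedH_of_gt n _ (by rw [he]; omega), add_zero]
    · have := hlam0 x (by omega)
      rw [extendedH_of_neg n _ (by rw [he]; omega)]
      congr 1
      refine neg_one_zpow_eq_of_even ⟨-(n + 1) - e x - columnShift n y, by ring⟩
  simp only [hentry]
  have h1 := Matrix.det_mul_column (fun x : Fin (2 * n + 1) =>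
    (-1 : F) ^ (e x + if (x : ℕ) < c then 0 else 1)) (Matrix.of fun x y : Fin (2 * n + 1) =>
      (-1) ^ columnShift n y * extendedH n (palVars Y) (e x + columnShift n y))
  have h2 := Matrix.det_mul_row (fun y : Fin (2 * n + 1) => (-1 : F) ^ columnShift n y)
    (Matrix.of fun x y : Fin (2 * n + 1) => extendedH n (palVars Y) (e x + columnShift n y))
  simp only [Matrix.of_apply] at h1 h2
  rw [h1, h2, prod_neg_one_zpow, prod_neg_one_zpow]
  -- rotating the columns puts the shifts `-n, …, n` in increasing order
  have h3 : Matrix.det (Matrix.of fun x y : Fin (2 * n + 1) =>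
      extendedH n (palVars Y) (e x + columnShift n y)) =
      schurPoly (pairPartition lam mu (2 * n + 1)) (adjoin (withInv Y) 1) := by
    rw [← det_extendedH_eq_schurPoly Y hY (pairPartition lam mu (2 * n + 1)) e
      (c - n - 1 - mu.rowLen 0)]
    · have hp := Matrix.det_permute' (Equiv.addRight (Fin.ofNat (2 * n + 1) (n + 1)))
        (Matrix.of fun x y : Fin (2 * n + 1) => extendedH n (palVars Y) (e x + ((y : ℕ) - n)))
      rw [sign_addRight, Units.val_one, Int.cast_one, one_mul] at hp
      rw [← hp]
      congr 1
      ext x y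
      rw [Matrix.of_apply, Matrix.submatrix_apply, Matrix.of_apply, columnShift_eq, id]
    · intro x
      have hx := x.2
      have hm := mu.rowLen_anti 0 (2 * n - x) (Nat.zero_le _)
      rw [rowLen_pairPartition _ _ hx, he, Nat.add_sub_cancel, Nat.cast_add, Nat.cast_sub hm]
      ring
  have h4 : ∑ y : Fin (2 * n + 1), columnShift n y = 0 := by
    have hg := Finset.sum_range_id_mul_two (2 * n + 1)
    rw [← Fin.sum_univ_eq_sum_range (fun i => i)] at hg
    simp only [columnShift_eq]
    rw [Equiv.sum_comp (Equiv.addRight (Fin.ofNat (2 * n + 1) (n + 1)))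
      (fun y : Fin (2 * n + 1) => ((y : ℕ) : ℤ) - n), Finset.sum_sub_distrib]
    zify at hg
    simp at hg ⊢
    linarith
  have h5 : (-1 : F) ^ ∑ x : Fin (2 * n + 1), (e x + if (x : ℕ) < c then 0 else 1) =
      (-1) ^ ((lam.card : ℤ) - mu.card) := by
    apply neg_one_zpow_eq_of_even
    have hl : (lam.card : ℤ) = ∑ x : Fin (2 * n + 1), (lam.rowLen x : ℤ) := by
      rw [card_eq_sum_rowLen lam (hlam0 _ hc), ← Fin.sum_univ_eq_sum_range, Nat.cast_sum]
    have hm : (mu.card : ℤ) = ∑ x : Fin (2 * n + 1), (mu.rowLen (2 * n - x) : ℤ) := by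
      rw [card_eq_sum_rowLen mu (k := 2 * n + 1) (by
        have := mu.rowLen_anti (2 * n + 1 - c) (2 * n + 1) (by omega)
        omega), ← Finset.sum_range_reflect, ← Fin.sum_univ_eq_sum_range, Nat.cast_sum]
      refine Finset.sum_congr rfl fun x _ => ?_
      rw [Nat.add_sub_cancel]
    have hg := Finset.sum_range_id_mul_two (2 * n + 1)
    rw [← Fin.sum_univ_eq_sum_range (fun i => i)] at hg
    zify at hg
    have hs : ∑ x : Fin (2 * n + 1), (if (x : ℕ) < c then (0 : ℤ) else 1) = 2 * n + 1 - c := by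
      rw [Fin.sum_univ_eq_sum_range (fun x => if x < c then (0 : ℤ) else 1),
        ← Finset.sum_range_add_sum_Ico _ hc, Finset.sum_eq_zero, Finset.sum_congr rfl
        (g := fun _ => (1 : ℤ)), Finset.sum_const, Nat.card_Ico]
      · simp
        omega
      · intro x hx
        rw [Finset.mem_Ico] at hx
        rw [if_neg (by omega)]
      · intro x hx
        rw [Finset.mem_range] at hx
        rw [if_pos hx]
    simp only [he, Finset.sum_add_distrib, Finset.sum_sub_distrib, hs, ← hl, ← hm]
    refine ⟨n * (c - 2 * n - 1), ?_⟩
    simp at hg ⊢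
    linarith
  rw [h3, h4, h5, zpow_zero, one_mul]

end MirrorPairs

/-! ### Rows of the Jacobi–Trudi matrix and the quotient -/

section BetaNumbers

/-- The residue modulo `2 T` of the beta-number `λᵢ + m - 1 - i`, where `m = 2 (2 T n + T)`. -/
def betaResidue (T n : ℕ) (lam : YoungDiagram) (i : ℕ) : ℕ :=
  (lam.rowLen i + (2 * T * n + T + (2 * T * n + T) - 1 - i)) % (2 * T)

/-- The quotient modulo `2 T` of the beta-number `λᵢ + m - 1 - i`, where `m = 2 (2 T n + T)`. -/
def betaQuotient (T n : ℕ) (lam : YoungDiagram) (i : ℕ) : ℕ :=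
  (lam.rowLen i + (2 * T * n + T + (2 * T * n + T) - 1 - i)) / (2 * T)

/-- The number of integers in `[0, 2 T n + T)` that are congruent to `u` modulo `2 T`: these are
the beta-numbers of the empty rows below row `2 T n + T`. -/
def lowCount (T n u : ℕ) : ℕ := n + if u < T then 1 else 0

theorem betaResidue_bottom (T n : ℕ) (lam : YoungDiagram) (hlam : lam.rowLen (2 * T * n + T) = 0)
    (k : ℕ) : betaResidue T n lam (2 * T * n + T + k) = (2 * T * n + T - 1 - k) % (2 * T) := by
  have := lam.rowLen_anti (2 * T * n + T) (2 * T * n + T + k) (by omega)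
  rw [betaResidue]
  congr 1
  omega

theorem betaCount_eq (T n : ℕ) (hT : 0 < T) (lam : YoungDiagram)
    (hlam : lam.rowLen (2 * T * n + T) = 0) {u : ℕ} (hu : u < 2 * T) :
    betaCount (2 * T) lam (2 * T * n + T + (2 * T * n + T)) u =
      residueCount (betaResidue T n lam) (2 * T * n + T) u + lowCount T n u := by
  rw [betaCount, Finset.card_filter]
  change (∑ i : Fin _, if betaResidue T n lam i = u then 1 else 0) = _
  rw [Fin.sum_univ_eq_sum_range (fun i => if betaResidue T n lam i = u then 1 else 0),
    Finset.sum_range_add, residueCount, Finset.card_filter, lowCount,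
    ← card_filter_mod_eq (2 * T) n T u (by omega) hu, Finset.card_filter,
    ← Finset.sum_range_reflect (fun i => if i % (2 * T) = u then 1 else 0)]
  congr 1
  refine Finset.sum_congr rfl fun k _ => ?_
  rw [betaResidue_bottom T n lam hlam]

theorem sum_betaCount (p : ℕ) (hp : 0 < p) (lam : YoungDiagram) (m : ℕ) :
    ∑ u ∈ Finset.range p, betaCount p lam m u = m := by
  simp only [betaCount]
  rw [← Finset.card_eq_sum_card_fiberwise, Finset.card_univ, Fintype.card_fin]
  intro j _
  simpa using Nat.mod_lt _ hp

theorem card_quotientBeta (T n : ℕ) (hT : 0 < T) (lam : YoungDiagram)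
    (hlam : lam.rowLen (2 * T * n + T) = 0) {u : ℕ} (hu : u < 2 * T) :
    ((Finset.univ.filter (fun j : Fin (2 * T * n + T + (2 * T * n + T)) =>
      beta lam _ j % (2 * T) = u)).image fun j => beta lam _ j / (2 * T)).card =
      residueCount (betaResidue T n lam) (2 * T * n + T) u + lowCount T n u := by
  rw [← betaCount_eq T n hT lam hlam hu, betaCount]
  apply Finset.card_image_of_injOn
  intro i hi j hj hij
  simp only [Finset.coe_filter, Finset.mem_univ, true_and, Set.mem_ofPred_eq] at hi hj
  have h1 : beta lam _ i = beta lam _ j := by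
    rw [← Nat.div_add_mod (beta lam _ i) (2 * T), hi, ← Nat.div_add_mod (beta lam _ j) (2 * T),
      hj]
    simp only at hij
    rw [hij]
  rcases lt_trichotomy i j with h | h | h
  · exact absurd h1 (strictAnti_beta lam _ h j.2).ne'
  · exact h
  · exact absurd h1 (strictAnti_beta lam _ h i.2).ne

/-- A beta-number of a component of the quotient that is not among the lowest ones comes from a
row above `2 T n + T`. -/
theorem exists_row_of_lowCount_le (T n : ℕ) (hT : 0 < T) (lam : YoungDiagram)
    (hlam : lam.rowLen (2 * T * n + T) = 0) {u : ℕ} (hu : u < 2 * T) {x : ℕ}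
    (hx : x < residueCount (betaResidue T n lam) (2 * T * n + T) u + lowCount T n u)
    (hlow : lowCount T n u ≤
      (quotientPart (2 * T) lam (2 * T * n + T + (2 * T * n + T)) u).rowLen x +
        (residueCount (betaResidue T n lam) (2 * T * n + T) u + lowCount T n u - 1 - x)) :
    ∃ i < 2 * T * n + T, betaResidue T n lam i = u ∧ betaQuotient T n lam i =
      (quotientPart (2 * T) lam (2 * T * n + T + (2 * T * n + T)) u).rowLen x +
        (residueCount (betaResidue T n lam) (2 * T * n + T) u + lowCount T n u - 1 - x) := by
  have hcard := card_quotientBeta T n hT lam hlam hu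
  have hmem := rowLen_partitionOfBeta_mem _ (hcard.symm ▸ hx)
  rw [hcard] at hmem
  change (quotientPart _ _ _ _).rowLen x + _ ∈ _ at hmem
  obtain ⟨⟨i, hi⟩, hiu, hiQ⟩ := Finset.mem_image.mp hmem
  replace hiu : betaResidue T n lam i = u := (Finset.mem_filter.mp hiu).2
  change betaQuotient T n lam i = _ at hiQ
  refine ⟨i, ?_, hiu, hiQ⟩
  by_contra! hle
  rw [← hiQ] at hlow
  have h0 := lam.rowLen_anti _ _ hle
  have h1 := Nat.div_add_mod (lam.rowLen i + (2 * T * n + T + (2 * T * n + T) - 1 - i)) (2 * T)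
  change 2 * T * betaQuotient T n lam i + betaResidue T n lam i = _ at h1
  rw [hiu] at h1
  have h2 := Nat.mul_le_mul_left (2 * T) hlow
  rw [lowCount] at h2
  split_ifs at h2 with hu'
  · rw [mul_add] at h2
    omega
  · rw [add_zero] at h2
    omega

/-- A component of the quotient has at most as many nonzero parts as there are rows with its
residue: a nonzero part lifts its beta-number above the lowest ones. -/
theorem rowLen_quotientPart_eq_zero (T n : ℕ) (hT : 0 < T) (lam : YoungDiagram)
    (hlam : lam.rowLen (2 * T * n + T) = 0) {u : ℕ} (hu : u < 2 * T) :
    (quotientPart (2 * T) lam (2 * T * n + T + (2 * T * n + T)) u).rowLen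
      (residueCount (betaResidue T n lam) (2 * T * n + T) u) = 0 := by
  set c := residueCount (betaResidue T n lam) (2 * T * n + T) u with hc
  set μ := quotientPart (2 * T) lam (2 * T * n + T + (2 * T * n + T)) u with hμ
  by_contra hne
  have hpos : ∀ x ≤ c, 0 < μ.rowLen x := fun x hx => by
    have := μ.rowLen_anti x c hx
    omega
  by_cases hlow : lowCount T n u = 0
  -- without low beta-numbers the whole beta-set has only `c` elements
  · refine hne (rowLen_partitionOfBeta_of_ge _ (le_of_eq ?_))
    rw [card_quotientBeta T n hT lam hlam hu, hlow, add_zero]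
  -- otherwise the first `c + 1` parts would come from as many different rows
  · have hrow : ∀ x ∈ Finset.range (c + 1), μ.rowLen x + (c + lowCount T n u - 1 - x) ∈
        ((Finset.range (2 * T * n + T)).filter fun i => betaResidue T n lam i = u).image
          (betaQuotient T n lam) := by
      intro x hx
      rw [Finset.mem_range] at hx
      have := hpos x (by omega)
      obtain ⟨i, hi, hiu, hiQ⟩ := exists_row_of_lowCount_le T n hT lam hlam hu (x := x)
        (by omega) (by rw [← hμ, ← hc]; omega)
      exact Finset.mem_image.mpr ⟨i, by simp [hi, hiu], hiQ⟩
    have h1 := Finset.card_le_card_of_injOn (s := Finset.range (c + 1)) _ hrow (by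
      intro x hx y hy hxy
      simp only [Finset.coe_range, Set.mem_Iio] at hx hy hxy
      rcases lt_trichotomy x y with h | h | h
      · have := μ.rowLen_anti x y h.le
        omega
      · exact h
      · have := μ.rowLen_anti y x h.le
        omega)
    have h2 := h1.trans Finset.card_image_le
    rw [Finset.card_range, ← residueCount, ← hc] at h2
    omega

/-- The core is symplectic exactly when all blocks of the Jacobi–Trudi matrix are square. -/
theorem balancedResidues_betaResidue_iff (T n : ℕ) (hT : 0 < T) (lam : YoungDiagram)
    (hlam : lam.rowLen (2 * T * n + T) = 0) :
    IsSymplectic (core (2 * T) lam (2 * T * n + T + (2 * T * n + T))) ↔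
      BalancedResidues T n (betaResidue T n lam) := by
  have hsum := sum_betaCount (2 * T) (by omega) lam (2 * T * n + T + (2 * T * n + T))
  rw [show 2 * T * n + T + (2 * T * n + T) = 2 * T * (2 * n + 1) by ring] at hsum
  have key := isSymplectic_core_iff T n hT (betaCount (2 * T) lam (2 * T * (2 * n + 1))) hsum
  rw [show 2 * T * (2 * n + 1) = 2 * T * n + T + (2 * T * n + T) by ring] at key
  rw [core, key]
  have hb := fun u (hu : u < 2 * T) => betaCount_eq T n hT lam hlam hu
  have hlast := hb (2 * T - 1) (by omega)
  rw [lowCount, if_neg (by omega)] at hlast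
  have hmid := hb (T - 1) (by omega)
  rw [lowCount, if_pos (by omega)] at hmid
  have hlo := fun k (hk : k < T - 1) => hb k (by omega)
  have hhi := fun k (hk : k < T - 1) => hb (2 * T - 2 - k) (by omega)
  constructor
  · rintro ⟨h1, h2⟩
    refine ⟨fun i _ => Nat.mod_lt _ (by omega), by omega, ?_, fun k hk => ?_,
      fun k _ => betaResidue_bottom T n lam hlam k⟩
    · have := h2 (T - 1) (by omega)
      rw [show 2 * T - 2 - (T - 1) = T - 1 by omega] at this
      omega
    · have h3 := hlo k hk
      have h4 := hhi k hk
      rw [lowCount, if_pos (by omega)] at h3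
      rw [lowCount, if_neg (by omega)] at h4
      have := h2 k (by omega)
      omega
  · intro h
    have hlt : ∀ k < T - 1, betaCount (2 * T) lam (2 * T * n + T + (2 * T * n + T)) k +
        betaCount (2 * T) lam (2 * T * n + T + (2 * T * n + T)) (2 * T - 2 - k) = 4 * n + 2 := by
      intro k hk
      have h3 := hlo k hk
      have h4 := hhi k hk
      rw [lowCount, if_pos (by omega)] at h3
      rw [lowCount, if_neg (by omega)] at h4
      have := h.pair k hk
      omega
    refine ⟨by rw [hlast, h.last]; omega, fun u hu => ?_⟩
    rcases lt_trichotomy u (T - 1) with h1 | h1 | h1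
    · exact hlt u h1
    · rw [h1, show 2 * T - 2 - (T - 1) = T - 1 by omega, hmid, h.middle]
      omega
    · have := hlt (2 * T - 2 - u) (by omega)
      rw [show 2 * T - 2 - (2 * T - 2 - u) = u by omega] at this
      omega

end BetaNumbers

/-! ### The block structure of the Jacobi–Trudi matrix -/

section JacobiTrudi

variable {F : Type*} [Field F]

theorem betaQuotient_add_betaResidue (T n : ℕ) (lam : YoungDiagram) {i : ℕ}
    (hi : i < 2 * T * n + T) :
    (lam.rowLen i : ℤ) - i =
      2 * T * (betaQuotient T n lam i - 2 * n - 1) + betaResidue T n lam i + 1 := by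
  have h1 := Nat.div_add_mod (lam.rowLen i + (2 * T * n + T + (2 * T * n + T) - 1 - i)) (2 * T)
  change 2 * T * betaQuotient T n lam i + betaResidue T n lam i = _ at h1
  have h2 : 2 * T * n + T + (2 * T * n + T) - 1 - i + (i + 1) =
      2 * T * n + T + (2 * T * n + T) := by omega
  zify at h1 h2
  linarith

/-- The entry in row `i` and column `j`. Only entries whose row residue `r` and column residue `w`
are equal or mirror images survive, as `h` vanishes off the multiples of `2 T`. -/
theorem jacobiTrudi_entry (T n : ℕ) (h H : ℤ → F) (h1 : ∀ b : ℤ, h ((2 * T : ℕ) * b) = H b)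
    (h2 : ∀ k : ℤ, ¬ ((2 * T : ℕ) : ℤ) ∣ k → h k = 0) (lam : YoungDiagram) {i : ℕ}
    (hi : i < 2 * T * n + T) (j r w : ℕ) (hr : betaResidue T n lam i = r)
    (hw : 2 * T - 1 - j % (2 * T) = w) (hr2 : r < 2 * T) :
    h ((lam.rowLen i : ℤ) - i + j) + h ((lam.rowLen i : ℤ) - i - j) =
      (if r = w then H (betaQuotient T n lam i - 2 * n + (j / (2 * T) : ℕ)) else 0) +
        if r + w = 2 * T - 2 then H (betaQuotient T n lam i - 2 * n - 1 - (j / (2 * T) : ℕ))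
        else if r + w = 4 * T - 2 then H (betaQuotient T n lam i - 2 * n - (j / (2 * T) : ℕ))
        else 0 := by
  have ha := betaQuotient_add_betaResidue T n lam hi
  rw [hr] at ha
  have hj := Nat.div_add_mod j (2 * T)
  have hj2 := Nat.mod_lt j (show 0 < 2 * T by omega)
  generalize betaQuotient T n lam i = Q at *
  generalize j / (2 * T) = J at *
  generalize j % (2 * T) = v at *
  obtain rfl : v = 2 * T - 1 - w := by omega
  have hw2 : w < 2 * T := by omega
  have hj' : (j : ℤ) = 2 * T * J + (2 * T - 1 - w) := by
    rw [← hj, Nat.sub_sub]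
    push_cast [show 1 + w ≤ 2 * T by omega]
    ring
  rw [ha, hj']
  have hzero : ∀ b d : ℤ, d ≠ 0 → |d| < (2 * T : ℕ) → h ((2 * T : ℕ) * b + d) = 0 := by
    intro b d hd hd'
    refine h2 _ fun hdvd => hd ?_
    rw [Int.dvd_add_right (Dvd.intro _ rfl)] at hdvd
    exact Int.eq_zero_of_abs_lt_dvd hdvd hd'
  congr 1
  · rw [show (2 * T * ((Q : ℤ) - 2 * n - 1) + r + 1 + (2 * T * J + (2 * T - 1 - w))) =
      ((2 * T : ℕ) : ℤ) * (Q - 2 * n + J) + (r - w) by push_cast; ring]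
    split_ifs with hrw
    · rw [hrw, sub_self, add_zero, h1]
    · exact hzero _ _ (by omega) (by rw [abs_lt]; omega)
  · split_ifs with hrw hrw'
    · rw [← h1]
      congr 1
      have : (r : ℤ) + w = 2 * T - 2 := by omega
      push_cast
      linear_combination this
    · rw [← h1]
      congr 1
      have : (r : ℤ) + w = 4 * T - 2 := by omega
      push_cast
      linear_combination this
    · rw [show (2 * T * ((Q : ℤ) - 2 * n - 1) + r + 1 - (2 * T * J + (2 * T - 1 - w))) =
        ((2 * T : ℕ) : ℤ) * (Q - 2 * n - 1 - J) + (r + w + 2 - 2 * T) by push_cast; ring]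
      exact hzero _ _ (by omega) (by rw [abs_lt]; omega)

theorem jacobiTrudi_entry_eq_zero (T n : ℕ) (h H : ℤ → F)
    (h1 : ∀ b : ℤ, h ((2 * T : ℕ) * b) = H b)
    (h2 : ∀ k : ℤ, ¬ ((2 * T : ℕ) : ℤ) ∣ k → h k = 0) (lam : YoungDiagram) {i : ℕ} (hT : 0 < T)
    (hi : i < 2 * T * n + T) (j : ℕ)
    (hij : blockIndex T (betaResidue T n lam i) ≠ blockIndex T (2 * T - 1 - j % (2 * T))) :
    h ((lam.rowLen i : ℤ) - i + j) + h ((lam.rowLen i : ℤ) - i - j) = 0 := by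
  have hr : betaResidue T n lam i < 2 * T := Nat.mod_lt _ (by omega)
  have hw : j % (2 * T) < 2 * T := Nat.mod_lt _ (by omega)
  rw [jacobiTrudi_entry T n h H h1 h2 lam hi j _ _ rfl rfl hr]
  have h3 : betaResidue T n lam i ≠ 2 * T - 1 - j % (2 * T) := fun h => hij (by rw [h])
  unfold blockIndex at hij
  rw [if_neg h3, if_neg, if_neg, add_zero]
  · omega
  · intro h4
    split_ifs at hij <;> omega

theorem card_blockIndex_eq (T N : ℕ) (r : ℕ → ℕ) (hr : ∀ i < N, r i < 2 * T) (k : ℕ)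
    (hk : k < T - 1) :
    ((Finset.range N).filter fun i => blockIndex T (r i) = k).card =
      residueCount r N k + residueCount r N (2 * T - 2 - k) := by
  rw [residueCount, residueCount, Finset.card_filter, Finset.card_filter, Finset.card_filter,
    ← Finset.sum_add_distrib]
  refine Finset.sum_congr rfl fun i hi => ?_
  have := hr i (Finset.mem_range.mp hi)
  unfold blockIndex
  split_ifs <;> omega

theorem card_blockIndex_eq_middle (T N : ℕ) (hT : 0 < T) (r : ℕ → ℕ) (hr : ∀ i < N, r i < 2 * T) :
    ((Finset.range N).filter fun i => blockIndex T (r i) = T - 1).card =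
      residueCount r N (T - 1) := by
  rw [residueCount]
  congr 1
  refine Finset.filter_congr fun i hi => ?_
  have := hr i (Finset.mem_range.mp hi)
  unfold blockIndex
  split_ifs <;> omega

theorem card_blockIndex_eq_last (T N : ℕ) (hT : 0 < T) (r : ℕ → ℕ) (hr : ∀ i < N, r i < 2 * T) :
    ((Finset.range N).filter fun i => blockIndex T (r i) = T).card =
      residueCount r N (2 * T - 1) := by
  rw [residueCount]
  congr 1
  refine Finset.filter_congr fun i hi => ?_
  have := hr i (Finset.mem_range.mp hi)
  unfold blockIndex
  split_ifs <;> omega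

/-- A nonvanishing term of the Leibniz expansion matches the rows of each block with its columns,
so that every block is square. -/
theorem balancedResidues_of_det_ne_zero (T n : ℕ) (hT : 0 < T) (h H : ℤ → F)
    (h1 : ∀ b : ℤ, h ((2 * T : ℕ) * b) = H b)
    (h2 : ∀ k : ℤ, ¬ ((2 * T : ℕ) : ℤ) ∣ k → h k = 0) (lam : YoungDiagram)
    (hlam : lam.rowLen (2 * T * n + T) = 0)
    (hdet : Matrix.det (Matrix.of fun i j : Fin (2 * T * n + T) =>
      h ((lam.rowLen i : ℤ) - (i : ℕ) + (j : ℕ)) + h ((lam.rowLen i : ℤ) - (i : ℕ) - (j : ℕ))) ≠ 0) :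
    BalancedResidues T n (betaResidue T n lam) := by
  obtain ⟨h0, -⟩ := balancedResidues_ground T n hT
  rw [Matrix.det_apply] at hdet
  obtain ⟨σ, -, hσ⟩ := Finset.exists_ne_zero_of_sum_ne_zero hdet
  have hσ' : ∀ j, blockIndex T (betaResidue T n lam (σ j)) =
      blockIndex T (2 * T - 1 - (j : ℕ) % (2 * T)) := by
    intro j
    by_contra hne
    refine hσ ?_
    rw [Finset.prod_eq_zero (Finset.mem_univ j), smul_zero]
    exact jacobiTrudi_entry_eq_zero T n h H h1 h2 lam hT (σ j).2 j hne
  have hcard : ∀ k, ((Finset.range (2 * T * n + T)).filter fun i =>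
      blockIndex T (betaResidue T n lam i) = k).card =
      ((Finset.range (2 * T * n + T)).filter fun j =>
        blockIndex T (2 * T - 1 - j % (2 * T)) = k).card := by
    intro k
    rw [Finset.card_filter, Finset.card_filter,
      ← Fin.sum_univ_eq_sum_range (fun i => if blockIndex T (betaResidue T n lam i) = k then 1 else 0),
      ← Fin.sum_univ_eq_sum_range (fun j => if blockIndex T (2 * T - 1 - j % (2 * T)) = k then 1 else 0),
      ← Equiv.sum_comp σ]
    simp only [hσ']
  have hlt : ∀ i < 2 * T * n + T, betaResidue T n lam i < 2 * T :=
    fun i _ => Nat.mod_lt _ (by omega)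
  refine ⟨hlt, ?_, ?_, fun k hk => ?_, fun k _ => betaResidue_bottom T n lam hlam k⟩
  · rw [← card_blockIndex_eq_last T _ hT _ hlt, hcard, card_blockIndex_eq_last T _ hT _ h0.lt,
      h0.last]
  · rw [← card_blockIndex_eq_middle T _ hT _ hlt, hcard, card_blockIndex_eq_middle T _ hT _ h0.lt,
      h0.middle]
  · rw [← card_blockIndex_eq T _ _ hlt k hk, hcard, card_blockIndex_eq T _ _ h0.lt k hk, h0.pair k hk]

end JacobiTrudi

/-! ### Factorisation of the Jacobi–Trudi determinant -/

section Factorisation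

/-- The `x`-th row of residue `u` carries the `x`-th beta-number of the component `u` of the
quotient. -/
theorem exists_rowNumbering (T n : ℕ) (hT : 0 < T) (lam : YoungDiagram)
    (hlam : lam.rowLen (2 * T * n + T) = 0) (h : BalancedResidues T n (betaResidue T n lam)) :
    ∃ ρ : (Σ k : Fin (T + 1), Fin (blockSize T n k)) ≃ Fin (2 * T * n + T),
      (∀ a, IsBlockEntry T n (betaResidue T n lam) (betaQuotient T n lam)
        (fun u x => (quotientPart (2 * T) lam (2 * T * n + T + (2 * T * n + T)) u).rowLen x +
          (residueCount (betaResidue T n lam) (2 * T * n + T) u + lowCount T n u - 1 - x))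
        a.1 a.2 (ρ a)) ∧
      numberingSign ρ =
        (-1) ^ pairCount (BlockInverted T) (betaResidue T n lam) (2 * T * n + T) := by
  apply exists_blockNumbering T n hT _ _ _ h
  · intro i j hij hj hr
    have h1 := strictAnti_beta lam (2 * T * n + T + (2 * T * n + T)) hij (by omega)
    have h2 := Nat.div_add_mod (lam.rowLen i + (2 * T * n + T + (2 * T * n + T) - 1 - i)) (2 * T)
    have h3 := Nat.div_add_mod (lam.rowLen j + (2 * T * n + T + (2 * T * n + T) - 1 - j)) (2 * T)
    change 2 * T * betaQuotient T n lam i + betaResidue T n lam i = _ at h2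
    change 2 * T * betaQuotient T n lam j + betaResidue T n lam j = _ at h3
    by_contra! hle
    have := Nat.mul_le_mul_left (2 * T) hle
    omega
  · intro u hu x hx
    exact exists_row_of_lowCount_le T n hT lam hlam hu (by omega) (by omega)
  · intro u hu x y hxy hy
    have := (quotientPart (2 * T) lam (2 * T * n + T + (2 * T * n + T)) u).rowLen_anti x y hxy.le
    omega

variable {F : Type*} [Field F]

/-- The block of the residues `k` and `2 T - 2 - k`. -/
theorem det_block_pair (T n : ℕ) (h H : ℤ → F) (h1 : ∀ b : ℤ, h ((2 * T : ℕ) * b) = H b)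
    (h2 : ∀ k : ℤ, ¬ ((2 * T : ℕ) : ℤ) ∣ k → h k = 0) (lam : YoungDiagram)
    (q : ℕ → YoungDiagram) (hT : 0 < T)
    (hq : ∀ u < 2 * T, (q u).rowLen (residueCount (betaResidue T n lam) (2 * T * n + T) u) = 0)
    (hb : BalancedResidues T n (betaResidue T n lam)) (k : ℕ) (hk : k < T - 1) {s : ℕ}
    (hs : s = 2 * n + 1) (ρ γ : Fin s → Fin (2 * T * n + T))
    (hρ : ∀ x : Fin s, IsBlockEntry T n (betaResidue T n lam) (betaQuotient T n lam)
      (fun u x => (q u).rowLen x +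
        (residueCount (betaResidue T n lam) (2 * T * n + T) u + lowCount T n u - 1 - x)) k x (ρ x))
    (hγ : ∀ y : Fin s, IsBlockEntry T n (fun j => 2 * T - 1 - j % (2 * T))
      (fun j => 2 * n - j / (2 * T)) (fun _ x => 2 * n - x) k y (γ y))
    (Y : Fin n → F) (hY : ∀ k, Y k ≠ 0) (hH : H = completeH (negVars Y)) :
    Matrix.det (Matrix.of fun x y : Fin s =>
      h ((lam.rowLen (ρ x) : ℤ) - (ρ x : ℕ) + (γ y : ℕ)) +
        h ((lam.rowLen (ρ x) : ℤ) - (ρ x : ℕ) - (γ y : ℕ))) =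
    (-1) ^ (((q k).card : ℤ) - (q (2 * T - 2 - k)).card) *
      schurPoly (pairPartition (q k) (q (2 * T - 2 - k)) (2 * n + 1)) (adjoin (withInv Y) 1) := by
  subst hs
  obtain ⟨h0, hc0⟩ := balancedResidues_ground T n hT
  have hp := hb.pair k hk
  have hpc : residueCount (fun j => 2 * T - 1 - j % (2 * T)) (2 * T * n + T) k = n := by
    have := h0.pair k hk
    rw [hc0 (2 * T - 2 - k) (by rw [Finset.mem_Ico]; omega)] at this
    omega
  have hqk := hq k (by omega)
  have hqk' := hq (2 * T - 2 - k) (by omega)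
  set c := residueCount (betaResidue T n lam) (2 * T * n + T) k with hc
  rw [show residueCount (betaResidue T n lam) (2 * T * n + T) (2 * T - 2 - k) = 2 * n + 1 - c by
    omega] at hqk'
  rw [← det_pairBlock Y hY (q k) (q (2 * T - 2 - k)) c (by omega) hqk hqk' _ fun x => rfl]
  congr 1
  ext x y
  -- rows `x < c` have residue `k`, the others, read backwards, have the mirror residue
  have hrow : ((x : ℕ) < c ∧ betaResidue T n lam (ρ x) = k ∧
      (betaQuotient T n lam (ρ x) : ℤ) = (q k).rowLen x + c + n - (x : ℕ) ∧
      (q (2 * T - 2 - k)).rowLen (2 * n - x) = 0) ∨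
      (c ≤ x ∧ betaResidue T n lam (ρ x) = 2 * T - 2 - k ∧
      (betaQuotient T n lam (ρ x) : ℤ) =
        (q (2 * T - 2 - k)).rowLen (2 * n - x) + (x : ℕ) - c + n ∧ (q k).rowLen x = 0) := by
    obtain ⟨hb1, hb2⟩ := hρ x
    beta_reduce at hb2
    have hrlt := hb.lt _ (ρ x).2
    have hx := x.2
    rcases hb2 with ⟨m1, h3, h4, h5⟩ | ⟨m1, h3, h4⟩
    · right
      have hr : betaResidue T n lam (ρ x) = 2 * T - 2 - k := by
        unfold IsMirror at m1
        unfold blockIndex at hb1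
        split_ifs at hb1 <;> omega
      rw [hr] at h4 h5
      have := (q k).rowLen_anti c x (by omega)
      rw [lowCount, if_neg (by omega)] at h5
      refine ⟨by omega, hr, by omega, by omega⟩
    · left
      have hr : betaResidue T n lam (ρ x) = k := by
        unfold IsMirror at m1
        unfold blockIndex at hb1
        split_ifs at hb1 <;> omega
      rw [hr] at h3 h4
      have := (q (2 * T - 2 - k)).rowLen_anti (2 * n + 1 - c) (2 * n - x) (by omega)
      rw [lowCount, if_pos (by omega)] at h4
      refine ⟨by omega, hr, by omega, by omega⟩
  -- columns `y < n` have residue `k`, the others, read backwards, have the mirror residue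
  have hcol : ((y : ℕ) < n ∧ 2 * T - 1 - (γ y : ℕ) % (2 * T) = k ∧
      (γ y : ℕ) / (2 * T) = y) ∨
      (n ≤ (y : ℕ) ∧ 2 * T - 1 - (γ y : ℕ) % (2 * T) = 2 * T - 2 - k ∧
        (γ y : ℕ) / (2 * T) + y = 2 * n) := by
    obtain ⟨hb1, hb2⟩ := hγ y
    beta_reduce at hb1 hb2
    have hy := y.2
    have hJ : (γ y : ℕ) / (2 * T) < n + 1 := by
      rw [Nat.div_lt_iff_lt_mul (by omega)]
      linarith [mul_comm (2 * T) n, (γ y).2]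
    rcases hb2 with ⟨m1, h3, h4, h5⟩ | ⟨m1, h3, h4⟩
    · right
      have hr : 2 * T - 1 - (γ y : ℕ) % (2 * T) = 2 * T - 2 - k := by
        unfold IsMirror at m1
        unfold blockIndex at hb1
        split_ifs at hb1 <;> omega
      rw [hr, hc0 (2 * T - 2 - k) (by rw [Finset.mem_Ico]; omega)] at h4
      refine ⟨by omega, hr, by omega⟩
    · left
      have hr : 2 * T - 1 - (γ y : ℕ) % (2 * T) = k := by
        unfold IsMirror at m1
        unfold blockIndex at hb1
        split_ifs at hb1 <;> omega
      rw [hr, hpc] at h3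
      refine ⟨by omega, hr, by omega⟩
  rw [Matrix.of_apply, Matrix.of_apply, columnShift, ← hH]
  rcases hrow with ⟨hx, hr, hQ, hm⟩ | ⟨hx, hr, hQ, hm⟩ <;>
    rcases hcol with ⟨hy, hw, hJ⟩ | ⟨hy, hw, hJ⟩
  · rw [jacobiTrudi_entry T n h H h1 h2 lam (ρ x).2 _ _ _ hr hw (by omega), if_pos rfl,
      if_neg (by omega), if_neg (by omega), if_pos hx, if_pos hy, add_zero]
    congr 1
    omega
  · rw [jacobiTrudi_entry T n h H h1 h2 lam (ρ x).2 _ _ _ hr hw (by omega), if_neg (by omega),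
      if_pos (by omega), if_pos hx, if_neg (by omega), zero_add]
    congr 1
    omega
  · rw [jacobiTrudi_entry T n h H h1 h2 lam (ρ x).2 _ _ _ hr hw (by omega), if_neg (by omega),
      if_pos (by omega), if_neg (by omega), if_pos hy, zero_add]
    congr 1
    omega
  · rw [jacobiTrudi_entry T n h H h1 h2 lam (ρ x).2 _ _ _ hr hw (by omega), if_pos rfl,
      if_neg (by omega), if_neg (by omega), if_neg (by omega), if_neg (by omega), add_zero]
    congr 1
    omega

/-- The block of the residue `T - 1`. -/
theorem det_block_middle (T n : ℕ) (h H : ℤ → F) (h1 : ∀ b : ℤ, h ((2 * T : ℕ) * b) = H b)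
    (h2 : ∀ k : ℤ, ¬ ((2 * T : ℕ) : ℤ) ∣ k → h k = 0) (lam : YoungDiagram)
    (q : ℕ → YoungDiagram) (hT : 0 < T) (hn : 0 < n) (hF : (2 : F) ≠ 0)
    (hb : BalancedResidues T n (betaResidue T n lam)) {s : ℕ}
    (hs : s = n) (ρ γ : Fin s → Fin (2 * T * n + T))
    (hρ : ∀ x : Fin s, IsBlockEntry T n (betaResidue T n lam) (betaQuotient T n lam)
      (fun u x => (q u).rowLen x +
        (residueCount (betaResidue T n lam) (2 * T * n + T) u + lowCount T n u - 1 - x))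
      (T - 1) x (ρ x))
    (hγ : ∀ y : Fin s, IsBlockEntry T n (fun j => 2 * T - 1 - j % (2 * T))
      (fun j => 2 * n - j / (2 * T)) (fun _ x => 2 * n - x) (T - 1) y (γ y))
    (Y : Fin n → F) (hH : H = completeH (negVars Y)) :
    Matrix.det (Matrix.of fun x y : Fin s =>
      h ((lam.rowLen (ρ x) : ℤ) - (ρ x : ℕ) + (γ y : ℕ)) +
        h ((lam.rowLen (ρ x) : ℤ) - (ρ x : ℕ) - (γ y : ℕ))) =
    spChar (q (T - 1)) (fun k => -Y k) := by
  subst hs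
  rw [spChar_neg_eq_det hn hF, ← hH]
  congr 1
  ext x y
  obtain ⟨hx1, hx2⟩ := hρ x
  obtain ⟨hy1, hy2⟩ := hγ y
  beta_reduce at hx2 hy1 hy2
  have hrlt := hb.lt _ (ρ x).2
  have hr : betaResidue T s lam (ρ x) = T - 1 := by
    unfold blockIndex at hx1
    split_ifs at hx1 <;> omega
  have hw : 2 * T - 1 - (γ y : ℕ) % (2 * T) = T - 1 := by
    unfold blockIndex at hy1
    split_ifs at hy1 <;> omega
  have hm : ¬ IsMirror T (T - 1) := by
    unfold IsMirror
    omega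
  have hx := x.2
  have hy := y.2
  have hJ : (γ y : ℕ) / (2 * T) < s + 1 := by
    rw [Nat.div_lt_iff_lt_mul (by omega)]
    linarith [mul_comm (2 * T) s, (γ y).2]
  rw [hr, hb.middle, lowCount, if_pos (by omega)] at hx2
  rw [hw] at hy2
  rw [Matrix.of_apply, Matrix.of_apply,
    jacobiTrudi_entry T s h H h1 h2 lam (ρ x).2 _ _ _ hr hw (by omega), if_pos rfl,
    if_pos (by omega)]
  have hQ := (hx2.resolve_left fun h => hm h.1).2.2
  have hJ' := (hy2.resolve_left fun h => hm h.1).2.2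
  congr 2 <;> omega

/-- The block of the residue `2 T - 1`. -/
theorem det_block_last (T n : ℕ) (h H : ℤ → F) (h1 : ∀ b : ℤ, h ((2 * T : ℕ) * b) = H b)
    (h2 : ∀ k : ℤ, ¬ ((2 * T : ℕ) : ℤ) ∣ k → h k = 0) (lam : YoungDiagram)
    (q : ℕ → YoungDiagram) (hT : 0 < T)
    (hb : BalancedResidues T n (betaResidue T n lam)) {s : ℕ}
    (hs : s = n + 1) (ρ γ : Fin s → Fin (2 * T * n + T))
    (hρ : ∀ x : Fin s, IsBlockEntry T n (betaResidue T n lam) (betaQuotient T n lam)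
      (fun u x => (q u).rowLen x +
        (residueCount (betaResidue T n lam) (2 * T * n + T) u + lowCount T n u - 1 - x))
      T x (ρ x))
    (hγ : ∀ y : Fin s, IsBlockEntry T n (fun j => 2 * T - 1 - j % (2 * T))
      (fun j => 2 * n - j / (2 * T)) (fun _ x => 2 * n - x) T y (γ y))
    (Y : Fin n → F) (hH : H = completeH (negVars Y)) :
    Matrix.det (Matrix.of fun x y : Fin s =>
      h ((lam.rowLen (ρ x) : ℤ) - (ρ x : ℕ) + (γ y : ℕ)) +
        h ((lam.rowLen (ρ x) : ℤ) - (ρ x : ℕ) - (γ y : ℕ))) =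
    2 * ooChar (q (2 * T - 1)) (adjoin (fun k => -Y k) (-1)) := by
  subst hs
  rw [← det_eq_two_mul_ooChar, ← hH]
  congr 1
  ext x y
  obtain ⟨hx1, hx2⟩ := hρ x
  obtain ⟨hy1, hy2⟩ := hγ y
  beta_reduce at hx2 hy1 hy2
  have hrlt := hb.lt _ (ρ x).2
  have hr : betaResidue T n lam (ρ x) = 2 * T - 1 := by
    unfold blockIndex at hx1
    split_ifs at hx1 <;> omega
  have hw : 2 * T - 1 - (γ y : ℕ) % (2 * T) = 2 * T - 1 := by
    unfold blockIndex at hy1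
    split_ifs at hy1 <;> omega
  have hm : ¬ IsMirror T (2 * T - 1) := by
    unfold IsMirror
    omega
  have hx := x.2
  have hy := y.2
  have hJ : (γ y : ℕ) / (2 * T) < n + 1 := by
    rw [Nat.div_lt_iff_lt_mul (by omega)]
    linarith [mul_comm (2 * T) n, (γ y).2]
  rw [hr, hb.last, lowCount, if_neg (by omega)] at hx2
  rw [hw] at hy2
  rw [Matrix.of_apply, Matrix.of_apply,
    jacobiTrudi_entry T n h H h1 h2 lam (ρ x).2 _ _ _ hr hw (by omega), if_pos rfl,
    if_neg (by omega), if_pos (by omega)]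
  have hQ := (hx2.resolve_left fun h => hm h.1).2.2
  have hJ' := (hy2.resolve_left fun h => hm h.1).2.2
  congr 2 <;> omega

end Factorisation

/-! ### The sign and the factorisation -/

section Assembly

/-- Modulo 2 the rank of the core counts the rows with mirror residues, relative to the balanced
count `n + 1`. -/
theorem exists_frobeniusRank_add (T n : ℕ) (hT : 0 < T) (lam : YoungDiagram)
    (hlam : lam.rowLen (2 * T * n + T) = 0) (hb : BalancedResidues T n (betaResidue T n lam)) :
    ∃ d : ℕ, ∑ v ∈ Finset.Ico T (2 * T - 1),
      (residueCount (betaResidue T n lam) (2 * T * n + T) v + n + 1) =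
      frobeniusRank (core (2 * T) lam (2 * T * n + T + (2 * T * n + T))) + 2 * d := by
  have hsum := sum_betaCount (2 * T) (by omega) lam (2 * T * n + T + (2 * T * n + T))
  rw [show 2 * T * n + T + (2 * T * n + T) = 2 * T * (2 * n + 1) by ring] at hsum
  have key := frobeniusRank_core (2 * T) (2 * n + 1)
    (betaCount (2 * T) lam (2 * T * (2 * n + 1))) hsum
  rw [show 2 * T * (2 * n + 1) = 2 * T * n + T + (2 * T * n + T) by ring] at key
  rw [core, key, sum_range_two_mul_pairs T hT]
  have hcnt := fun u (hu : u < 2 * T) => betaCount_eq T n hT lam hlam hu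
  rw [hcnt (T - 1) (by omega), hcnt (2 * T - 1) (by omega), hb.middle, hb.last, lowCount, lowCount,
    if_pos (by omega), if_neg (by omega), show n + (n + 1) - (2 * n + 1) = 0 by omega,
    show n + 1 + (n + 0) - (2 * n + 1) = 0 by omega, add_zero, add_zero,
    Finset.sum_Ico_eq_sum_range, show 2 * T - 1 - T = T - 1 by omega, ← Finset.sum_range_reflect]
  -- the rank contributes `|c - (n + 1)|` per mirror pair, and `c + n + 1` exceeds it by twice the
  -- minimum of `c` and `n + 1`
  refine ⟨∑ k ∈ Finset.range (T - 1),
    min (residueCount (betaResidue T n lam) (2 * T * n + T) (2 * T - 2 - k)) (n + 1), ?_⟩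
  rw [Finset.mul_sum, ← Finset.sum_add_distrib]
  refine Finset.sum_congr rfl fun k hk => ?_
  rw [Finset.mem_range] at hk
  rw [hcnt k (by omega), hcnt (2 * T - 2 - k) (by omega), lowCount, lowCount, if_pos (by omega),
    if_neg (by omega), show T + (T - 1 - 1 - k) = 2 * T - 2 - k by omega]
  have := hb.pair k hk
  omega

/-- The sign `(-1) ^ ε` is that of all inversions, up to the sizes of the quotients. -/
theorem neg_one_pow_pairCount {F : Type*} [Field F] (T n : ℕ) (hT : 0 < T) (lam : YoungDiagram)
    (hlam : lam.rowLen (2 * T * n + T) = 0) (hb : BalancedResidues T n (betaResidue T n lam))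
    (S ε : ℤ)
    (hε : ε = -(∑ i ∈ Finset.Ico T (2 * T - 1),
          ((betaCount (2 * T) lam (2 * T * n + T + (2 * T * n + T)) i + 1).choose 2 : ℤ))
        + (n + 1) + frobeniusRank (core (2 * T) lam (2 * T * n + T + (2 * T * n + T))) + S)
    (a : ℕ) (ha : a = pairCount (BlockInverted T) (betaResidue T n lam) (2 * T * n + T) +
      pairCount (BlockInverted T) (fun j => 2 * T - 1 - j % (2 * T)) (2 * T * n + T) +
      pairCount (fun u v => v < u) (betaResidue T n lam) (2 * T * n + T + (2 * T * n + T))) :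
    (-1 : F) ^ ε = (-1) ^ a * (-1) ^ S := by
  have h1 := pairCount_parity T n hT _ hb
  rw [← ha, Finset.sum_add_distrib] at h1
  obtain ⟨d, hd⟩ := exists_frobeniusRank_add T n hT lam hlam hb
  rw [hd, ZMod.natCast_eq_natCast_iff] at h1
  have hchoose : ∑ i ∈ Finset.Ico T (2 * T - 1),
      ((betaCount (2 * T) lam (2 * T * n + T + (2 * T * n + T)) i + 1).choose 2 : ℤ) =
      ((∑ v ∈ Finset.Ico T (2 * T - 1),
        (residueCount (betaResidue T n lam) (2 * T * n + T) v + n + 1).choose 2 : ℕ) : ℤ) := by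
    rw [Nat.cast_sum]
    refine Finset.sum_congr rfl fun v hv => ?_
    rw [Finset.mem_Ico] at hv
    rw [betaCount_eq T n hT lam hlam (by omega), lowCount, if_neg (by omega), add_zero]
  rw [hchoose] at hε
  rw [← zpow_natCast, ← zpow_add₀ (neg_ne_zero.mpr one_ne_zero)]
  apply neg_one_zpow_eq_of_even
  rw [Int.even_iff]
  rw [Nat.ModEq] at h1
  omega

theorem card_twistedVars_index (T n : ℕ) :
    Fintype.card ((Fin (4 * T / 2) × Fin n) ⊕ Fin (4 * T / 4)) = 2 * T * n + T := by
  simp only [Fintype.card_sum, Fintype.card_prod, Fintype.card_fin]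
  rw [show 4 * T / 2 = 2 * T by omega, show 4 * T / 4 = T by omega]

/-- The factorisation when all blocks are square. -/
theorem spChar_twistedVars_eq (T n : ℕ) (hT : 0 < T) (hn : 0 < n) (ω : ℂ)
    (hω : IsPrimitiveRoot ω (4 * T)) (lam : YoungDiagram)
    (hlam : lam.rowLen (2 * T * n + T) = 0) (hb : BalancedResidues T n (betaResidue T n lam))
    (q : ℕ → YoungDiagram)
    (hq : ∀ i, q i = quotientPart (2 * T) lam (2 * T * n + T + (2 * T * n + T)) i)
    (Y : Fin n → RatFun n) (hY : ∀ k, Y k = indet n k ^ (2 * T)) (ε : ℤ)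
    (hε : ε = -(∑ i ∈ Finset.Ico T (2 * T - 1),
          ((betaCount (2 * T) lam (2 * T * n + T + (2 * T * n + T)) i + 1).choose 2 : ℤ))
        + (n + 1) + frobeniusRank (core (2 * T) lam (2 * T * n + T + (2 * T * n + T)))
        + ∑ i ∈ Finset.range (T - 1), (((q i).card : ℤ) - ((q (2 * T - 2 - i)).card : ℤ))) :
    spChar lam (twistedVars (4 * T) n ω) =
        (-1) ^ ε * ((Equiv.Perm.sign (sigmaPerm (2 * T) lam (2 * T * n + T + (2 * T * n + T))) : ℤ)
            : RatFun n)
          * ooChar (q (2 * T - 1)) (adjoin (fun k => -Y k) (-1))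
          * spChar (q (T - 1)) (fun k => -Y k)
          * ∏ i ∈ Finset.range (T - 1),
              schurPoly (pairPartition (q i) (q (2 * T - 2 - i)) (2 * n + 1))
                (adjoin (withInv Y) 1) := by
  obtain ⟨h1, h2⟩ := ringCompleteH_of_expand (2 * T) (by omega) _ _
    (genDenom_twistedVars T n hT ω hω Y hY)
  rw [← completeH_eq_ringCompleteH] at h1 h2
  rw [← completeH_eq_ringCompleteH] at h1
  set h := completeH (withInv (twistedVars (4 * T) n ω)) with hh
  have hY0 : ∀ k, Y k ≠ 0 := fun k => by
    rw [hY]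
    exact pow_ne_zero _ (indet_ne_zero n k)
  have hq0 : ∀ u < 2 * T,
      (q u).rowLen (residueCount (betaResidue T n lam) (2 * T * n + T) u) = 0 := fun u hu => by
    rw [hq]
    exact rowLen_quotientPart_eq_zero T n hT lam hlam hu
  obtain ⟨ρ, hρ, hρs⟩ := exists_rowNumbering T n hT lam hlam hb
  obtain ⟨γ, hγ, hγs⟩ := exists_columnNumbering T n hT
  simp only [← hq] at hρ
  rw [spChar_eq_det lam _ _ (card_twistedVars_index T n), ← hh]
  have hdet := det_of_blocks (fun k : Fin (T + 1) => blockSize T n k)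
    (Matrix.of fun i j : Fin (2 * T * n + T) =>
      h ((lam.rowLen i : ℤ) - (i : ℕ) + (j : ℕ)) + h ((lam.rowLen i : ℤ) - (i : ℕ) - (j : ℕ))) ρ γ
    (by
      intro a b hab
      refine jacobiTrudi_entry_eq_zero T n h _ h1 h2 lam hT (ρ a).2 (γ b) ?_
      rw [(hρ a).1, (hγ b).1]
      exact fun h => hab (Fin.ext h))
  set g : ℕ → RatFun n := fun k =>
    if k < T - 1 then (-1) ^ (((q k).card : ℤ) - (q (2 * T - 2 - k)).card) *
      schurPoly (pairPartition (q k) (q (2 * T - 2 - k)) (2 * n + 1)) (adjoin (withInv Y) 1)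
    else if k = T - 1 then spChar (q (T - 1)) (fun k => -Y k)
    else 2 * ooChar (q (2 * T - 1)) (adjoin (fun k => -Y k) (-1)) with hg
  have hblock : ∀ k : Fin (T + 1), Matrix.det (Matrix.of fun x y : Fin (blockSize T n k) =>
      (Matrix.of fun i j : Fin (2 * T * n + T) =>
        h ((lam.rowLen i : ℤ) - (i : ℕ) + (j : ℕ)) + h ((lam.rowLen i : ℤ) - (i : ℕ) - (j : ℕ)))
          (ρ ⟨k, x⟩) (γ ⟨k, y⟩)) = g k := by
    rintro ⟨k, hk⟩
    rw [hg]
    simp only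
    split_ifs with hk1 hk2
    · exact det_block_pair T n h _ h1 h2 lam q hT hq0 hb k hk1 (if_pos hk1)
        (fun x => ρ ⟨⟨k, hk⟩, x⟩) (fun y => γ ⟨⟨k, hk⟩, y⟩) (fun x => hρ ⟨⟨k, hk⟩, x⟩)
        (fun y => hγ ⟨⟨k, hk⟩, y⟩) Y hY0 rfl
    · subst hk2
      exact det_block_middle T n h _ h1 h2 lam q hT hn two_ne_zero hb
        ((if_neg (lt_irrefl _)).trans (if_pos rfl))
        (fun x => ρ ⟨⟨T - 1, hk⟩, x⟩) (fun y => γ ⟨⟨T - 1, hk⟩, y⟩) (fun x => hρ ⟨⟨T - 1, hk⟩, x⟩)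
        (fun y => hγ ⟨⟨T - 1, hk⟩, y⟩) Y rfl
    · obtain rfl : k = T := by omega
      exact det_block_last k n h _ h1 h2 lam q hT hb
        ((if_neg hk1).trans (if_neg hk2))
        (fun x => ρ ⟨⟨k, hk⟩, x⟩) (fun y => γ ⟨⟨k, hk⟩, y⟩) (fun x => hρ ⟨⟨k, hk⟩, x⟩)
        (fun y => hγ ⟨⟨k, hk⟩, y⟩) Y rfl
  have hprod : ∏ k : Fin (T + 1), g k =
      (-1) ^ (∑ i ∈ Finset.range (T - 1), (((q i).card : ℤ) - ((q (2 * T - 2 - i)).card : ℤ))) *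
      (∏ i ∈ Finset.range (T - 1), schurPoly (pairPartition (q i) (q (2 * T - 2 - i)) (2 * n + 1))
        (adjoin (withInv Y) 1)) * spChar (q (T - 1)) (fun k => -Y k) *
      (2 * ooChar (q (2 * T - 1)) (adjoin (fun k => -Y k) (-1))) := by
    rw [Fin.prod_univ_eq_prod_range g, Finset.prod_range_succ]
    conv_lhs => rw [show T = T - 1 + 1 by omega]
    rw [Finset.prod_range_succ, ← prod_neg_one_zpow, ← Finset.prod_mul_distrib]
    congr 1
    · congr 1
      · refine Finset.prod_congr rfl fun k hk => ?_
        exact if_pos (Finset.mem_range.mp hk)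
      · exact (if_neg (lt_irrefl _)).trans (if_pos rfl)
    · exact (if_neg (by omega)).trans (if_neg (by omega))
  have hsign := sign_sigmaPerm (2 * T) lam (2 * T * n + T + (2 * T * n + T))
  change _ = (-1) ^ pairCount _ (betaResidue T n lam) _ at hsign
  rw [hdet, Finset.prod_congr rfl fun k _ => hblock k, hprod, sign_symm_trans, hρs, hγs, hsign,
    neg_one_pow_pairCount T n hT lam hlam hb _ ε hε _ rfl, ← pow_add, pow_add _ (_ + _)]
  push_cast
  -- on the right `sgn σ_λ` occurs twice: explicitly, and inside `(-1) ^ ε`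
  have h3 : ((-1 : RatFun n) ^ pairCount (fun u v => v < u) (betaResidue T n lam)
      (2 * T * n + T + (2 * T * n + T))) ^ 2 = 1 := by
    rw [← pow_mul, mul_comm, pow_mul, neg_one_sq, one_pow]
  field_simp
  rw [h3, mul_one]

end Assembly

theorem mainTheorem1 (t n : ℕ) (ht : 0 < t) (ht4 : 4 ∣ t) (hn : 0 < n)
    (ω : ℂ) (hω : IsPrimitiveRoot ω t)
    (lam : YoungDiagram) (hlam : lam.colLen 0 ≤ t * n / 2 + t / 4)
    (m : ℕ) (hm : m = t * n + t / 2)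
    (nu : YoungDiagram) (hnu : nu = core (t / 2) lam m)
    (q : ℕ → YoungDiagram) (hq : ∀ i, q i = quotientPart (t / 2) lam m i)
    (Y : Fin n → RatFun n) (hY : ∀ k, Y k = indet n k ^ (t / 2))
    (ε : ℤ)
    (hε : ε = -(∑ i ∈ Finset.Ico (t / 4) (t / 2 - 1),
          ((betaCount (t / 2) lam m i + 1).choose 2 : ℤ))
        + (n + 1) + frobeniusRank nu
        + ∑ i ∈ Finset.range (t / 4 - 1), (((q i).card : ℤ) - ((q (t / 2 - 2 - i)).card : ℤ))) :
    (spChar lam (twistedVars t n ω) ≠ 0 ↔ IsSymplectic nu) ∧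
    (IsSymplectic nu →
      (q (t / 2 - 1)).colLen 0 ≤ n + 1 ∧
      (q (t / 4 - 1)).colLen 0 ≤ n ∧
      (∀ i < t / 4 - 1, (q i).colLen 0 + (q (t / 2 - 2 - i)).colLen 0 ≤ 2 * n + 1) ∧
      spChar lam (twistedVars t n ω) =
        (-1) ^ ε * ((Equiv.Perm.sign (sigmaPerm (t / 2) lam m) : ℤ) : RatFun n)
          * ooChar (q (t / 2 - 1)) (adjoin (fun k => -Y k) (-1))
          * spChar (q (t / 4 - 1)) (fun k => -Y k)
          * ∏ i ∈ Finset.range (t / 4 - 1),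
              schurPoly (pairPartition (q i) (q (t / 2 - 2 - i)) (2 * n + 1))
                (adjoin (withInv Y) 1)) := by
  obtain ⟨T, rfl⟩ := ht4
  have hT : 0 < T := by omega
  have e1 : 4 * T / 2 = 2 * T := by omega
  have e2 : 4 * T / 4 = T := by omega
  have e3 : 4 * T * n / 2 = 2 * T * n := by
    rw [show 4 * T * n = 2 * (2 * T * n) by ring, Nat.mul_div_cancel_left _ (by norm_num)]
  have e4 : 4 * T * n + 2 * T = 2 * T * n + T + (2 * T * n + T) := by ring
  rw [e2, e3] at hlam
  rw [e1] at hm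
  simp only [e1, e2] at hnu hq hY hε ⊢
  rw [e4] at hm
  subst hm
  subst hnu
  have hrow := rowLen_eq_zero_of_colLen_zero_le lam hlam
  have hiff := balancedResidues_betaResidue_iff T n hT lam hrow
  have hfac := fun hb => spChar_twistedVars_eq T n hT hn ω hω lam hrow hb q hq Y hY ε hε
  have hcol : ∀ u < 2 * T,
      (q u).colLen 0 ≤ residueCount (betaResidue T n lam) (2 * T * n + T) u := fun u hu => by
    rw [hq]
    exact colLen_zero_le_of_rowLen_eq_zero _ (rowLen_quotientPart_eq_zero T n hT lam hrow hu)
  refine ⟨⟨fun hne => ?_, fun hs => ?_⟩, fun hs => ?_⟩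
  · rw [hiff]
    obtain ⟨h1, h2⟩ := ringCompleteH_of_expand (2 * T) (by omega) _ _
      (genDenom_twistedVars T n hT ω hω Y hY)
    refine balancedResidues_of_det_ne_zero T n hT _ _ h1 h2 lam hrow fun h0 => hne ?_
    rw [spChar_eq_det lam _ _ (card_twistedVars_index T n), completeH_eq_ringCompleteH, h0, mul_zero]
  · rw [hfac (hiff.mp hs)]
    obtain rfl : Y = fun k => indet n k ^ (2 * T) := funext hY
    refine mul_ne_zero (mul_ne_zero (mul_ne_zero (mul_ne_zero ?_ ?_)
      (ooChar_neg_ne_zero n _ _)) (spChar_neg_ne_zero n _ hn _))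
      (Finset.prod_ne_zero_iff.mpr fun i _ => schurPoly_ne_zero n _ _)
    · exact zpow_ne_zero _ (neg_ne_zero.mpr one_ne_zero)
    · exact Int.cast_ne_zero.mpr (Units.ne_zero _)
  · have hb := hiff.mp hs
    refine ⟨(hcol _ (by omega)).trans hb.last.le, (hcol _ (by omega)).trans hb.middle.le,
      fun i hi => ?_, hfac hb⟩
    exact (add_le_add (hcol i (by omega)) (hcol (2 * T - 2 - i) (by omega))).trans (hb.pair i hi).le
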